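/- All curves are smooth projective curves over $\mathbb C$. A curve with affine equation $y^n=f(x)$, where $n\ge 2$ and $f\in\mathbb C[x]$ is monic with $r=\deg f$ distinct roots, is called \emph{pre-superelliptic of level $n$} if it has genus at least $2$ and either $n\mid r$ or $\gcd(n,r)=1$. For a curve $\mathcal C$ given by $y^n=f(x)$ let $H\subseteq\operatorname{Aut}(\mathcal C)$ be the group generated by $(x,y)\mapsto(x,e^{2\pi i/n}y)$, let $N$ be the normalizer of $H$ in $\operatorname{Aut}(\mathcal C)$ and $\overline N=N/H$ (the reduced automorphism group). Put \begin{align*} p_4&=x^4+2i\sqrt3\,x^2+1, & r_4&=x^{12}-33x^8-33x^4+1,\\ s_4&=x^8+14x^4+1, & t_4&=x(x^4-1),\\ r_5&=x^{20}-228x^{15}+494x^{10}+228x^5+1, & s_5&=x(x^{10}+11x^5-1),\\ t_5&=x^{30}+522x^{25}-10005x^{20}-10005x^{10}-522x^5+1, && \end{align*} and consider the lists \begin{align*} L(A_4)&=\{p_4,\ t_4p_4\},\\ L(S_4)&=\{r_4,\ s_4,\ t_4,\ r_4s_4,\ r_4t_4,\ s_4t_4,\ r_4s_4t_4\},\\ L(A_5)&=\{r_5,\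 s_5,\ t_5,\ r_5s_5,\ r_5t_5,\ s_5t_5,\ r_5s_5t_5\}. \end{align*} Let $\delta=1$ if $t_4\mid f$ or $s_5\mid f$, and $\delta=0$ otherwise. (i) Let $\mathcal C$ be a pre-superelliptic curve of level $n$ given by $y^n=f(x)$ such that $\mathcal C\to\mathcal C/N$ is branched at exactly three points, and suppose that $\overline N\cong\Gamma$ and $f\in L(\Gamma)$ for some $\Gamma\in\{A_4,S_4,A_5\}$. Then $n\mid \deg f+\delta$, and $\deg f+\delta$ is the number of branch points of the map $\mathcal C\to\mathbb P^1$ given by the $x$-coordinate. (ii) Conversely, let $n\ge2$, let $f\in L(A_4)\cup L(S_4)\cup L(A_5)$ with $(n,f)\neq(2,p_4)$, and let $\mathcal C$ be the smooth projective curve with affine equation $y^n=f(x)$. If $n\mid\deg f+\delta$, then $\mathcal C$ is pre-superelliptic of level $n$, the map $\mathcal C\to\mathcal C/N$ is branched at exactly three points, and $\overline N\cong\Gamma$ for a $\Gamma\in\{A_4,S_4,A_5\}$ with $f\in L(\Gamma)$. -/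

import Mathlib

open Polynomial

noncomputable section

/-! ### Curves through their function fields

A smooth projective curve over `ℂ` is represented by its function field `F`; its closed points are
the places of `F`, its automorphisms are the `ℂ`-automorphisms of `F`, and a finite morphism
is an inclusion of function fields. -/

/-- The valuation rings of `F` over `ℂ`, that is, the closed points of the curve: valuation rings
`ℂ ⊆ V ⊊ F`. -/
def IsPlace {F : Type*} [Field F] [Algebra ℂ F] (V : ValuationSubring F) : Prop :=
  (∀ c : ℂ, algebraMap ℂ F c ∈ V) ∧ V ≠ ⊤

/-- The differentials of `F / ℂ` that are regular at every place `V`, that is, that lie in the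
`V`-span of `{db | b ∈ V}` for each `V`. -/
def holomorphicDifferentials (F : Type*) [Field F] [Algebra ℂ F] : Submodule ℂ (Ω[F⁄ℂ]) :=
  ⨅ (V : ValuationSubring F) (_ : IsPlace V),
    Submodule.span ℂ {ω | ∃ a ∈ V, ∃ b ∈ V, ω = a • KaehlerDifferential.D ℂ F b}

/-- The genus, as the dimension of the space of holomorphic differentials. -/
def curveGenus (F : Type*) [Field F] [Algebra ℂ F] : Cardinal :=
  Module.rank ℂ (holomorphicDifferentials F)

/-- The places of `K` above a place `P` of the subfield `E`: the fibre above `P` of the morphism of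
curves given by `E ⊆ K`. -/
def fibre {K : Type*} [Field K] [Algebra ℂ K] (E : IntermediateField ℂ K)
    (P : ValuationSubring E) : Set (ValuationSubring K) :=
  {V | IsPlace V ∧ V.comap (algebraMap E K) = P}

/-- The branch points of the morphism of curves given by `E ⊆ K`: the places of `E` whose fibre
has fewer than `[K : E]` points. -/
def branchPoints {K : Type*} [Field K] [Algebra ℂ K] (E : IntermediateField ℂ K) :
    Set (ValuationSubring E) :=
  {P | IsPlace P ∧ (fibre E P).encard < (Module.finrank E K : ℕ∞)}

/-! ### Curves `y ^ n = f x` -/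

/-- `K` is the function field of the curve with affine equation `y ^ n = f x`. -/
structure IsCurveWithEquation {K : Type*} [Field K] [Algebra ℂ K]
    (n : ℕ) (f : ℂ[X]) (x y : K) : Prop where
  transcendental : Transcendental ℂ x
  equation : y ^ n = aeval x f
  generate : IntermediateField.adjoin ℂ {x, y} = ⊤

/-- The function field `ℂ(x)` of the projective `x`-line. -/
abbrev xLine {K : Type*} [Field K] [Algebra ℂ K] (x : K) : IntermediateField ℂ K :=
  IntermediateField.adjoin ℂ {x}

/-- The group `H` generated by the automorphism `τ` with `τ x = x` and
`τ y = exp (2 π i / n) y`. -/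
def levelGroup {K : Type*} [Field K] [Algebra ℂ K] (n : ℕ) (x y : K) : Subgroup (K ≃ₐ[ℂ] K) :=
  Subgroup.closure {τ | τ x = x ∧
    τ y = algebraMap ℂ K (Complex.exp (2 * Real.pi * Complex.I / n)) * y}

/-- The normalizer `N` of `H` in the automorphism group of the curve. -/
def levelNormalizer {K : Type*} [Field K] [Algebra ℂ K] (n : ℕ) (x y : K) :
    Subgroup (K ≃ₐ[ℂ] K) :=
  Subgroup.normalizer (levelGroup n x y : Set (K ≃ₐ[ℂ] K))

instance levelGroup_normal {K : Type*} [Field K] [Algebra ℂ K] (n : ℕ) (x y : K) :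
    ((levelGroup n x y).subgroupOf (levelNormalizer n x y)).Normal :=
  Subgroup.normal_in_normalizer

/-- The reduced automorphism group `N / H`. -/
abbrev ReducedGroup {K : Type*} [Field K] [Algebra ℂ K] (n : ℕ) (x y : K) : Type _ :=
  levelNormalizer n x y ⧸ (levelGroup n x y).subgroupOf (levelNormalizer n x y)

/-- The function field of the quotient curve `C / N`. -/
abbrev quotientField {K : Type*} [Field K] [Algebra ℂ K] (n : ℕ) (x y : K) :
    IntermediateField ℂ K :=
  IntermediateField.fixedField (levelNormalizer n x y)

/-- A pre-superelliptic curve of level `n`: it has genus at least `2` and an affine equation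
`y ^ n = ∏ (x - a i)` with `r` distinct `a i`, and `n ∣ r` or `gcd (n, r) = 1`. -/
structure IsPreSuperelliptic {K : Type*} [Field K] [Algebra ℂ K]
    (n : ℕ) (f : ℂ[X]) (x y : K) : Prop where
  curve : IsCurveWithEquation n f x y
  two_le_level : 2 ≤ n
  monic : f.Monic
  separable : f.Separable
  divides_or_coprime : n ∣ f.natDegree ∨ Nat.Coprime n f.natDegree
  two_le_genus : 2 ≤ curveGenus K

/-! ### The polynomials -/

def p4 : ℂ[X] := X ^ 4 + C (2 * Complex.I * (Real.sqrt 3 : ℂ)) * X ^ 2 + 1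

def r4 : ℂ[X] := X ^ 12 - 33 * X ^ 8 - 33 * X ^ 4 + 1

def s4 : ℂ[X] := X ^ 8 + 14 * X ^ 4 + 1

def t4 : ℂ[X] := X * (X ^ 4 - 1)

def r5 : ℂ[X] := X ^ 20 - 228 * X ^ 15 + 494 * X ^ 10 + 228 * X ^ 5 + 1

def s5 : ℂ[X] := X * (X ^ 10 + 11 * X ^ 5 - 1)

def t5 : ℂ[X] := X ^ 30 + 522 * X ^ 25 - 10005 * X ^ 20 - 10005 * X ^ 10 - 522 * X ^ 5 + 1

/-- The polynomials for the reduced group `A₄`. -/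
def listA4 : Set ℂ[X] := {p4, t4 * p4}

/-- The polynomials for the reduced group `S₄`. -/
def listS4 : Set ℂ[X] := {r4, s4, t4, r4 * s4, r4 * t4, s4 * t4, r4 * s4 * t4}

/-- The polynomials for the reduced group `A₅`. -/
def listA5 : Set ℂ[X] := {r5, s5, t5, r5 * s5, r5 * t5, s5 * t5, r5 * s5 * t5}

/-- The reduced group is `A₄`, `S₄` or `A₅`, and `f` is in the list for this group. -/
def IsExceptionalCase {K : Type*} [Field K] [Algebra ℂ K]
    (n : ℕ) (f : ℂ[X]) (x y : K) : Prop :=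
  (f ∈ listA4 ∧ Nonempty (ReducedGroup n x y ≃* alternatingGroup (Fin 4))) ∨
  (f ∈ listS4 ∧ Nonempty (ReducedGroup n x y ≃* Equiv.Perm (Fin 4))) ∨
  (f ∈ listA5 ∧ Nonempty (ReducedGroup n x y ≃* alternatingGroup (Fin 5)))

open Classical in
/-- `δ = 1` if `t4 ∣ f` or `s5 ∣ f`, and `δ = 0` otherwise. -/
def delta (f : ℂ[X]) : ℕ := if t4 ∣ f ∨ s5 ∣ f then 1 else 0

end

/-! The group `H` is the Galois group of `K` over `ℂ(x)`, so the reduced group acts faithfully on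
`ℙ¹` by Möbius transformations, and it preserves the branch points of `x`. More precisely, if `σ ∈
N` conjugates the generator of `H` to its `i`-th power, then `σ y / y ^ i` lies in `ℂ(x)`, and
taking `n`-th powers gives `ord_p f ≡ i * ord_{σ p} f` modulo `n` (`exists_multiplier`). Since `n`
divides `deg f` or is prime to it, `H` fixes every place above a branch point and acts freely on the
other places. The branch points are the roots of `f`, together with `∞` if `n ∤ deg f`.

(i) The reduced group contains a Klein four-group. Distinct commuting Möbius involutions have no
common fixed point, so the number of branch points is even (`even_ncard_branchSet`). This number is
`deg f` or `deg f + 1`, and `deg f + δ` is even, so it equals `deg f + δ`. If `δ = 1`, then `∞` is a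
branch point, and comparing the multiplier congruence at `∞`, where `f` has order `-deg f`, with the
one at a suitable root, where it has order `1`, yields `n ∣ deg f + 1` (`dvd_natDegree_add`).

(ii) Put `m = deg f + δ`. As a form of degree `m`, `f` is semi-invariant under generators of its
polyhedral group, and because `n ∣ m` these transformations lift to the curve (`exists_lift`). Hence
the reduced group is a finite group `G` of Möbius transformations without nonempty invariant sets of
at most two points. Every nontrivial element has two fixed points, and counting them gives three
orbits with nontrivial stabilizer and order 12, 24 or 60 (`exists_orbits`). The order is pinned down
by the size of the branch set in the tetrahedral case and by a rotation of order 4 or 5 about `0` in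
the others; the isomorphism type follows from the permutations of four points, of the Sylow
3-subgroups or of the Sylow 2-subgroups.

As `m ≤ |G| + 2` and `m ≠ |G|`, no branch point has trivial stabilizer, so the three exceptional
orbits are exactly the branch points of the quotient by `N`. The genus is bounded below by the
differentials `dx / y ^ (n - 1)` and `x dx / y ^ (n - 1)`, where the symmetry `x ↦ ε / x` settles
regularity at infinity (`two_le_genus`). -/

open scoped Pointwise OnePoint

/-! ### Valuation rings of a function field and the action of automorphisms on them. -/

section Valuations

variable {K : Type*} [Field K] [Algebra ℂ K]

theorem smul_valuation_le_one_iff (σ : K ≃ₐ[ℂ] K) (V : ValuationSubring K) (z : K) :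
    (σ • V).valuation z ≤ 1 ↔ V.valuation (σ⁻¹ z) ≤ 1 := by
  rw [ValuationSubring.valuation_le_one_iff, ValuationSubring.valuation_le_one_iff,
    ValuationSubring.mem_pointwise_smul_iff_inv_smul_mem, AlgEquiv.smul_def]

omit [Algebra ℂ K] in
theorem valuation_lt_one_iff_inv (V : ValuationSubring K) {z : K} (hz : z ≠ 0) :
    V.valuation z < 1 ↔ ¬ V.valuation z⁻¹ ≤ 1 := by
  rw [← ValuationSubring.mem_nonunits_iff, ValuationSubring.mem_nonunits_iff_or,
    ValuationSubring.valuation_le_one_iff]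
  simp [hz]

theorem smul_valuation_lt_one_iff (σ : K ≃ₐ[ℂ] K) (V : ValuationSubring K) (z : K) :
    (σ • V).valuation z < 1 ↔ V.valuation (σ⁻¹ z) < 1 := by
  by_cases hz : z = 0
  · simp [hz]
  rw [valuation_lt_one_iff_inv _ hz, valuation_lt_one_iff_inv _ (by simpa using hz),
    smul_valuation_le_one_iff, map_inv₀]

theorem smul_valuation_eq_one_iff (σ : K ≃ₐ[ℂ] K) (V : ValuationSubring K) (z : K) :
    (σ • V).valuation z = 1 ↔ V.valuation (σ⁻¹ z) = 1 := by
  have h1 := smul_valuation_le_one_iff σ V z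
  have h2 := smul_valuation_lt_one_iff σ V z
  constructor
  · intro h
    by_contra h'
    exact (h2.2 (lt_of_le_of_ne (h1.1 h.le) h')).ne h
  · intro h
    by_contra h'
    exact (h2.1 (lt_of_le_of_ne (h1.2 h.le) h')).ne h

theorem IsPlace.smul {V : ValuationSubring K} (hV : IsPlace V) (σ : K ≃ₐ[ℂ] K) :
    IsPlace (σ • V) := by
  refine ⟨fun c => ?_, fun h => hV.2 ?_⟩
  · rw [ValuationSubring.mem_pointwise_smul_iff_inv_smul_mem, AlgEquiv.smul_def, AlgEquiv.commutes]
    exact hV.1 c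
  · ext z
    simp only [ValuationSubring.mem_top, iff_true]
    have : σ z ∈ σ • V := by rw [h]; exact ValuationSubring.mem_top _
    rw [ValuationSubring.mem_pointwise_smul_iff_inv_smul_mem, AlgEquiv.smul_def] at this
    simpa [← AlgEquiv.mul_apply] using this

theorem valuation_algebraMap_eq_one {V : ValuationSubring K}
    (hV : ∀ c : ℂ, algebraMap ℂ K c ∈ V) {c : ℂ} (hc : c ≠ 0) :
    V.valuation (algebraMap ℂ K c) = 1 := by
  have hc' : algebraMap ℂ K c ≠ 0 := by simpa using hc
  refine le_antisymm ((V.valuation_le_one_iff _).2 (hV c)) ?_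
  have := (V.valuation_le_one_iff _).2 (hV c⁻¹)
  rw [map_inv₀, map_inv₀] at this
  exact (inv_le_one₀ (zero_lt_iff.2 (by simpa using hc))).1 this

/-- At most one constant is a bad shift for `z`: for all other `c`, both `(z - c)⁻¹` and
`z * (z - c)⁻¹` lie in `V`. -/
theorem bad_shift_subsingleton {V : ValuationSubring K} (hV : ∀ c : ℂ, algebraMap ℂ K c ∈ V)
    (z : K) :
    {c : ℂ | ¬ ((z - algebraMap ℂ K c)⁻¹ ∈ V ∧ z * (z - algebraMap ℂ K c)⁻¹ ∈ V)}.Subsingleton := by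
  have key : ∀ c : ℂ, ¬ ((z - algebraMap ℂ K c)⁻¹ ∈ V ∧ z * (z - algebraMap ℂ K c)⁻¹ ∈ V) →
      V.valuation (z - algebraMap ℂ K c) < 1 := by
    intro c hc
    by_contra hlt
    apply hc
    push Not at hlt
    have h1 : (z - algebraMap ℂ K c)⁻¹ ∈ V := by
      rw [← V.valuation_le_one_iff, map_inv₀]
      exact inv_le_one_of_one_le₀ hlt
    refine ⟨h1, ?_⟩
    have h0 : z - algebraMap ℂ K c ≠ 0 := by
      intro h0; rw [h0] at hlt; simp at hlt
    have : z * (z - algebraMap ℂ K c)⁻¹ = 1 + algebraMap ℂ K c * (z - algebraMap ℂ K c)⁻¹ := by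
      field_simp; ring
    rw [this]
    exact V.add_mem _ _ V.one_mem (V.mul_mem _ _ (hV c) h1)
  intro c hc d hd
  by_contra hne
  have h : V.valuation (algebraMap ℂ K (d - c)) < 1 := by
    have : algebraMap ℂ K (d - c) = (z - algebraMap ℂ K c) - (z - algebraMap ℂ K d) := by
      rw [map_sub]; ring
    rw [this]
    exact lt_of_le_of_lt (Valuation.map_sub _ _ _) (max_lt (key c hc) (key d hd))
  rw [valuation_algebraMap_eq_one hV (sub_ne_zero.2 (Ne.symm hne))] at h
  exact lt_irrefl _ h

/-- Every element of one of finitely many valuation rings over `ℂ` is a quotient of elements of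
their intersection, with denominator a unit of that valuation ring. -/
theorem exists_common_denominator {ι : Type*} [Finite ι] {U : ι → ValuationSubring K}
    (hU : ∀ i, ∀ c : ℂ, algebraMap ℂ K c ∈ U i) {z : K} :
    ∃ s : K, s ≠ 0 ∧ (∀ i, s ∈ U i ∧ z * s ∈ U i) ∧
      ∀ i, z ∈ U i → (U i).valuation s = 1 := by
  -- Each ring excludes at most one shift `c`, so some `c` is good for all rings at once and `s = (z
  -- - c)⁻¹` serves as denominator.
  have hfin : ((⋃ i, {c : ℂ | ¬ ((z - algebraMap ℂ K c)⁻¹ ∈ U i ∧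
      z * (z - algebraMap ℂ K c)⁻¹ ∈ U i)}) ∪ {c : ℂ | z = algebraMap ℂ K c}).Finite := by
    refine Set.Finite.union (Set.finite_iUnion fun i => (bad_shift_subsingleton (hU i) z).finite)
      (Set.Subsingleton.finite ?_)
    intro c hc d hd
    exact (algebraMap ℂ K).injective (hc.symm.trans hd)
  obtain ⟨c, hc⟩ := hfin.infinite_compl.nonempty
  simp only [Set.mem_compl_iff, Set.mem_union, Set.mem_iUnion, Set.mem_ofPred_eq, not_or,
    not_exists, not_not] at hc
  have h0 : z - algebraMap ℂ K c ≠ 0 := sub_ne_zero.2 hc.2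
  refine ⟨(z - algebraMap ℂ K c)⁻¹, inv_ne_zero h0, hc.1, fun i hz => ?_⟩
  have h1 := ((U i).valuation_le_one_iff _).2 (hc.1 i).1
  have h2 := ((U i).valuation_le_one_iff _).2 (sub_mem hz (hU i c))
  refine le_antisymm h1 ?_
  rw [map_inv₀]
  exact (one_le_inv₀ (zero_lt_iff.2 (by simpa using h0))).2 h2

/-- A finite group of automorphisms acts transitively on the valuation rings above a given
valuation ring of its fixed field. -/
theorem exists_smul_eq_of_mem_iff (G : Subgroup (K ≃ₐ[ℂ] K)) [Finite G]
    {V W : ValuationSubring K} (hV : IsPlace V) (hW : IsPlace W)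
    (h : ∀ z ∈ IntermediateField.fixedField G, z ∈ V ↔ z ∈ W) :
    ∃ σ ∈ G, σ • V = W := by
  classical
  -- The conjugates of both `V` and `W` are intersected, so that `B` is stable under `G` and has a
  -- center for each of the two rings.
  let U : G × Bool → ValuationSubring K := fun i => i.1.1 • (if i.2 then V else W)
  have hU : ∀ i, ∀ c : ℂ, algebraMap ℂ K c ∈ U i := by
    rintro ⟨σ, b⟩
    cases b
    · exact (hW.smul σ.1).1
    · exact (hV.smul σ.1).1
  let B : Subring K := ⨅ i, (U i).toSubring
  have hB : ∀ z, z ∈ B ↔ ∀ i, z ∈ U i := fun z => by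
    simp only [B, Subring.mem_iInf]; rfl
  have : IsInvariantSubring G B := ⟨fun g z hz => by
    rw [hB] at hz ⊢
    rintro ⟨σ, b⟩
    have h1 := hz (g⁻¹ * σ, b)
    have h2 : (U (g⁻¹ * σ, b)) = (g : K ≃ₐ[ℂ] K)⁻¹ • U (σ, b) := by
      simp only [U, Subgroup.coe_mul, InvMemClass.coe_inv, mul_smul]
    rw [h2, ValuationSubring.mem_pointwise_smul_iff_inv_smul_mem, inv_inv] at h1
    exact h1⟩
  let m : ∀ X : ValuationSubring K, (B ≤ X.toSubring) → Ideal B := fun X hX =>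
    (IsLocalRing.maximalIdeal X).comap (Subring.inclusion hX)
  have hm : ∀ (X : ValuationSubring K) (hX : B ≤ X.toSubring) (z : B),
      z ∈ m X hX ↔ X.valuation (z : K) < 1 := fun X hX z => by
    simp only [m, Ideal.mem_comap]
    exact X.valuation_lt_one_iff _
  have hBU : ∀ i, B ≤ (U i).toSubring := fun i => iInf_le _ i
  have hU1 : U (1, true) = V := by simp [U]
  have hU2 : U (1, false) = W := by simp [U]
  have hBV : B ≤ V.toSubring := hU1 ▸ hBU (1, true)
  have hBW : B ≤ W.toSubring := hU2 ▸ hBU (1, false)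
  have : (m V hBV).IsPrime := Ideal.IsPrime.comap _
  have : (m W hBW).IsPrime := Ideal.IsPrime.comap _
  -- A finite group permutes transitively the primes of `B` above a prime of the ring of invariants;
  -- this is applied to the centers of `V` and `W`.
  have : Algebra.IsInvariant (FixedPoints.subring B G) B G := ⟨fun b hb => ⟨⟨b, hb⟩, rfl⟩⟩
  obtain ⟨g, hg⟩ := Algebra.IsInvariant.exists_smul_of_under_eq (FixedPoints.subring B G) B G
    (m V hBV) (m W hBW) (by
      ext a
      change (a : B) ∈ m V hBV ↔ (a : B) ∈ m W hBW
      rw [hm, hm]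
      have ha : ((a : B) : K) ∈ IntermediateField.fixedField G := by
        rintro σ
        exact congrArg Subtype.val (a.2 σ)
      by_cases h0 : ((a : B) : K) = 0
      · simp [h0]
      rw [valuation_lt_one_iff_inv _ h0, valuation_lt_one_iff_inv _ h0,
        V.valuation_le_one_iff, W.valuation_le_one_iff, h _ (inv_mem ha)])
  have key : ∀ z : B, V.valuation ((g : K ≃ₐ[ℂ] K)⁻¹ (z : K)) < 1 ↔ W.valuation (z : K) < 1 := by
    intro z
    rw [← hm W hBW, hg, Ideal.mem_pointwise_smul_iff_inv_smul_mem, hm]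
    rfl
  -- The center on `B` determines the valuation ring: `z` in one ring is `(z * s) / s` with both
  -- elements in `B` and `s` a unit there, and equal centers make `s` a unit in the other ring too.
  have hle : ∀ X Y : ValuationSubring K, (∃ i, X = U i) → (∃ i, Y = U i) →
      (∀ z : B, X.valuation (z : K) < 1 ↔ Y.valuation (z : K) < 1) → X ≤ Y := by
    rintro X Y ⟨i, rfl⟩ ⟨j, rfl⟩ hXY z hz
    obtain ⟨s, hs0, hs, hs1⟩ := exists_common_denominator hU (z := z)
    have hsB : s ∈ B := (hB s).2 fun i => (hs i).1
    have hsi : (U i).valuation s = 1 := hs1 i hz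
    have hsj : (U j).valuation s = 1 := by
      refine le_antisymm (((U j).valuation_le_one_iff _).2 (hs j).1) (not_lt.1 fun hlt => ?_)
      have := (hXY ⟨s, hsB⟩).2 hlt
      rw [hsi] at this
      exact lt_irrefl _ this
    have h3 := ((U j).valuation_le_one_iff _).2 (hs j).2
    rw [map_mul, hsj, mul_one] at h3
    exact ((U j).valuation_le_one_iff _).1 h3
  refine ⟨g, g.2, le_antisymm (hle _ _ ⟨(g, true), by simp [U]⟩ ⟨_, hU2.symm⟩ ?_)
    (hle _ _ ⟨_, hU2.symm⟩ ⟨(g, true), by simp [U]⟩ ?_)⟩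
  · intro z; rw [smul_valuation_lt_one_iff]; exact key z
  · intro z; rw [smul_valuation_lt_one_iff]; exact (key z).symm

end Valuations

/-! ### The function field of `y ^ n = f x` as a cyclic extension of `ℂ(x)`. -/

theorem irreducible_X_pow_sub_C_of_separable {n : ℕ} (hn : n ≠ 0) {f : ℂ[X]} (hf : f.Separable)
    (hd : f.natDegree ≠ 0) : Irreducible (X ^ n - C f : ℂ[X][X]) := by
  obtain ⟨a, ha⟩ := IsAlgClosed.exists_root f (by
    intro h; exact hd (natDegree_eq_zero_iff_degree_le_zero.2 h.le))
  have hdvd : X - C a ∣ f := dvd_iff_isRoot.2 ha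
  have hprime : (Ideal.span {X - C a}).IsPrime :=
    (Ideal.span_singleton_prime (X_sub_C_ne_zero a)).2 (prime_X_sub_C a)
  have hlead : (X ^ n - C f : ℂ[X][X]).leadingCoeff = 1 := leadingCoeff_X_pow_sub_C hn.bot_lt
  have hdeg : (X ^ n - C f : ℂ[X][X]).degree = n := degree_X_pow_sub_C hn.bot_lt f
  -- Eisenstein at `X - a`: the root `a` is simple, so `(X - a) ^ 2` does not divide the constant
  -- term.
  refine irreducible_of_eisenstein_criterion hprime ?_ ?_ ?_ ?_ ?_
  · rw [hlead]
    exact (Ideal.ne_top_iff_one _).1 hprime.ne_top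
  · intro k hk
    rw [hdeg] at hk
    have hk' : k < n := by exact_mod_cast hk
    rw [coeff_sub, coeff_X_pow, if_neg hk'.ne, coeff_C, zero_sub]
    split_ifs
    · exact neg_mem (Ideal.mem_span_singleton.2 hdvd)
    · simp
  · rw [hdeg]; exact_mod_cast hn.bot_lt
  · rw [coeff_sub, coeff_X_pow, if_neg (Ne.symm hn), coeff_C_zero, zero_sub, neg_mem_iff,
      Ideal.span_singleton_pow, Ideal.mem_span_singleton]
    intro h
    have := hf.squarefree (X - C a) (by rwa [← sq])
    exact not_isUnit_X_sub_C a this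
  · exact (monic_X_pow_sub_C f hn).isPrimitive

section Curve

variable {K : Type*} [Field K] [Algebra ℂ K] {n : ℕ} {f : ℂ[X]} {x y : K}

theorem mem_xLine_iff {g : K} :
    g ∈ xLine x ↔ ∃ A B : ℂ[X], g = aeval x A / aeval x B :=
  IntermediateField.mem_adjoin_simple_iff ℂ g

theorem aeval_mem_xLine (A : ℂ[X]) : aeval x A ∈ xLine x :=
  mem_xLine_iff.2 ⟨A, 1, by simp⟩

theorem self_mem_xLine : x ∈ xLine x := by simpa using aeval_mem_xLine (x := x) X

/-- Gauss's lemma passes from `ℂ[X]` to its fraction field, which is identified with `ℂ(x)` because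
`x` is transcendental. -/
theorem irreducible_X_pow_sub_C_xLine (hx : Transcendental ℂ x) (hn : n ≠ 0) (hf : f.Separable)
    (hd : f.natDegree ≠ 0) :
    Irreducible (X ^ n - C ⟨aeval x f, aeval_mem_xLine f⟩ : (xLine x)[X]) := by
  have h1 : Irreducible ((X ^ n - C f : ℂ[X][X]).map (algebraMap ℂ[X] (RatFunc ℂ))) :=
    (monic_X_pow_sub_C f hn).irreducible_iff_irreducible_map_fraction_map.1
      (irreducible_X_pow_sub_C_of_separable hn hf hd)
  let e := RatFunc.algEquivOfTranscendental x hx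
  have h2 := (MulEquiv.irreducible_iff (mapEquiv e.toRingEquiv)).2 h1
  convert h2 using 1
  rw [mapEquiv_apply, Polynomial.map_map]
  simp only [Polynomial.map_sub, Polynomial.map_pow, map_X, map_C]
  congr 2
  apply Subtype.ext
  change aeval x f = (e (algebraMap ℂ[X] (RatFunc ℂ) f) : K)
  rw [RatFunc.algEquivOfTranscendental_algebraMap]
  simp

theorem IsCurveWithEquation.algHom_ext (hc : IsCurveWithEquation n f x y) {K' : Type*} [Field K']
    [Algebra ℂ K'] {φ ψ : K →ₐ[ℂ] K'} (h1 : φ x = ψ x) (h2 : φ y = ψ y) : φ = ψ := by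
  ext z
  have hz : z ∈ IntermediateField.adjoin ℂ {x, y} := hc.generate ▸ IntermediateField.mem_top
  induction hz using IntermediateField.adjoin_induction with
  | mem z hz =>
    rcases hz with rfl | rfl
    · exact h1
    · exact h2
  | algebraMap c => rw [φ.commutes, ψ.commutes]
  | add u v _ _ hu hv => rw [map_add, map_add, hu, hv]
  | inv u _ hu => rw [map_inv₀, map_inv₀, hu]
  | mul u v _ _ hu hv => rw [map_mul, map_mul, hu, hv]

theorem IsCurveWithEquation.algEquiv_ext (hc : IsCurveWithEquation n f x y) {σ τ : K ≃ₐ[ℂ] K}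
    (h1 : σ x = τ x) (h2 : σ y = τ y) : σ = τ := by
  have : σ.toAlgHom = τ.toAlgHom := hc.algHom_ext h1 h2
  ext z
  exact DFunLike.congr_fun this z

theorem IsCurveWithEquation.of_mem_adjoin (hc : IsCurveWithEquation n f x y) {x' y' : K}
    (hx' : Transcendental ℂ x') (hy' : y' ^ n = aeval x' f)
    (h1 : x ∈ IntermediateField.adjoin ℂ {x', y'}) (h2 : y ∈ IntermediateField.adjoin ℂ {x', y'}) :
    IsCurveWithEquation n f x' y' := by
  refine ⟨hx', hy', top_le_iff.1 ?_⟩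
  rw [← hc.generate, IntermediateField.adjoin_le_iff]
  rintro z (rfl | rfl)
  · exact h1
  · exact h2

theorem finrank_fixedField_of_finite (G : Subgroup (K ≃ₐ[ℂ] K)) [Finite G] :
    Module.finrank (IntermediateField.fixedField G) K = Nat.card G := by
  cases nonempty_fintype G
  rw [Nat.card_eq_fintype_card]
  exact FixedPoints.finrank_eq_card G K

theorem algEquiv_inv_apply_self (σ : K ≃ₐ[ℂ] K) (z : K) : σ⁻¹ (σ z) = z := σ.symm_apply_apply z

theorem algEquiv_apply_inv_self (σ : K ≃ₐ[ℂ] K) (z : K) : σ (σ⁻¹ z) = z := σ.apply_symm_apply z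

/-- The curve `y ^ n = f x` with `f` separable and not constant. -/
structure IsSeparableCurve (n : ℕ) (f : ℂ[X]) (x y : K) : Prop extends
    IsCurveWithEquation n f x y where
  level_ne_zero : n ≠ 0
  separable : f.Separable
  natDegree_ne_zero : f.natDegree ≠ 0

namespace IsSeparableCurve

variable (hc : IsSeparableCurve n f x y)
include hc

theorem adjoin_xLine_eq_top : IntermediateField.adjoin (xLine x) {y} = ⊤ := by
  have h := hc.generate
  have h2 := IntermediateField.adjoin_adjoin_left ℂ ({x} : Set K) ({y} : Set K)
  rw [Set.singleton_union, h] at h2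
  apply IntermediateField.restrictScalars_injective ℂ
  rw [h2]; rfl

theorem isIntegral_xLine : IsIntegral (xLine x) y :=
  ⟨X ^ n - C ⟨aeval x f, aeval_mem_xLine f⟩, monic_X_pow_sub_C _ hc.level_ne_zero, by
    simp only [eval₂_sub, eval₂_pow, eval₂_X, eval₂_C, hc.equation]
    exact sub_self _⟩

theorem minpoly_xLine : minpoly (xLine x) y = X ^ n - C ⟨aeval x f, aeval_mem_xLine f⟩ := by
  symm
  refine minpoly.eq_of_irreducible_of_monic (irreducible_X_pow_sub_C_xLine hc.transcendental
    hc.level_ne_zero hc.separable hc.natDegree_ne_zero) ?_ (monic_X_pow_sub_C _ hc.level_ne_zero)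
  simp only [map_sub, map_pow, aeval_X, aeval_C, hc.equation]
  exact sub_self _

theorem finrank_xLine : Module.finrank (xLine x) K = n := by
  have h := IntermediateField.adjoin.finrank hc.isIntegral_xLine
  rw [hc.adjoin_xLine_eq_top, IntermediateField.finrank_top', hc.minpoly_xLine,
    natDegree_X_pow_sub_C] at h
  exact h

theorem finiteDimensional_xLine : FiniteDimensional (xLine x) K :=
  Module.finite_of_finrank_pos (hc.finrank_xLine ▸ hc.level_ne_zero.bot_lt)

theorem y_ne_zero : y ≠ 0 := by
  rintro rfl
  have h := hc.equation
  rw [zero_pow hc.level_ne_zero] at h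
  exact hc.transcendental ⟨f, hc.separable.ne_zero, h.symm⟩

/-- Two points of the same affine curve are related by an embedding of function fields. -/
theorem exists_algHom {K' : Type*} [Field K'] [Algebra ℂ K'] {x' y' : K'}
    (hx' : Transcendental ℂ x') (hy' : y' ^ n = aeval x' f) :
    ∃ φ : K →ₐ[ℂ] K', φ x = x' ∧ φ y = y' := by
  let ψ : xLine x →ₐ[ℂ] K' := (xLine x').val.comp
    (((RatFunc.algEquivOfTranscendental x hc.transcendental).symm.trans
      (RatFunc.algEquivOfTranscendental x' hx')).toAlgHom)
  have hψ : ψ ⟨x, self_mem_xLine⟩ = x' := by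
    change (((RatFunc.algEquivOfTranscendental x' hx')
      ((RatFunc.algEquivOfTranscendental x hc.transcendental).symm
        (IntermediateField.AdjoinSimple.gen ℂ x))) : K') = x'
    rw [RatFunc.algEquivOfTranscendental_symm_gen, RatFunc.algEquivOfTranscendental_X]
  have hψf : ∀ g : ℂ[X], ψ ⟨aeval x g, aeval_mem_xLine g⟩ = aeval x' g := by
    intro g
    have h1 : (⟨aeval x g, aeval_mem_xLine g⟩ : xLine x) =
        aeval (⟨x, self_mem_xLine⟩ : xLine x) g := by
      apply Subtype.ext
      have := (aeval_algHom_apply (xLine x).val (⟨x, self_mem_xLine⟩ : xLine x) g)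
      simpa using this
    rw [h1, ← aeval_algHom_apply, hψ]
  -- With `K'` made an extension of `ℂ(x)` through `ψ`, the power basis of `y` allows `y` to be sent
  -- to any root of its minimal polynomial.
  let _ : Algebra (xLine x) K' := ψ.toRingHom.toAlgebra
  have : IsScalarTower ℂ (xLine x) K' := IsScalarTower.of_algebraMap_eq fun c => (ψ.commutes c).symm
  let pb := PowerBasis.ofAdjoinEqTop hc.isIntegral_xLine (by
    rw [← IntermediateField.adjoin_simple_toSubalgebra_of_isAlgebraic
      hc.isIntegral_xLine.isAlgebraic, hc.adjoin_xLine_eq_top]; rfl)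
  have hgen : pb.gen = y := by simp [pb]
  have hroot : aeval y' (minpoly (xLine x) pb.gen) = 0 := by
    rw [hgen, hc.minpoly_xLine]
    simp only [map_sub, map_pow, aeval_X, aeval_C, hy']
    exact sub_eq_zero.2 (hψf f).symm
  let φ := pb.lift y' hroot
  refine ⟨φ.restrictScalars ℂ, (φ.commutes ⟨x, self_mem_xLine⟩).trans hψ, ?_⟩
  have h : φ pb.gen = y' := pb.lift_gen y' hroot
  have h' : φ pb.gen = φ y := congrArg φ hgen
  exact h'.symm.trans h

/-- Two generating points of the same affine curve are related by an automorphism. -/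
theorem exists_algEquiv {x' y' : K} (hc' : IsCurveWithEquation n f x' y') :
    ∃ σ : K ≃ₐ[ℂ] K, σ x = x' ∧ σ y = y' := by
  have hs' : IsSeparableCurve n f x' y' :=
    ⟨hc', hc.level_ne_zero, hc.separable, hc.natDegree_ne_zero⟩
  obtain ⟨φ, h1, h2⟩ := hc.exists_algHom hc'.transcendental hc'.equation
  obtain ⟨ψ, h3, h4⟩ := hs'.exists_algHom hc.transcendental hc.equation
  refine ⟨AlgEquiv.ofAlgHom φ ψ (hc'.algHom_ext ?_ ?_) (hc.algHom_ext ?_ ?_), h1, h2⟩ <;>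
    simp [h1, h2, h3, h4]

theorem exists_levelGenerator : ∃ τ : K ≃ₐ[ℂ] K, τ x = x ∧
    τ y = algebraMap ℂ K (Complex.exp (2 * Real.pi * Complex.I / n)) * y := by
  set ζ := Complex.exp (2 * Real.pi * Complex.I / n)
  have hζ : IsPrimitiveRoot ζ n := Complex.isPrimitiveRoot_exp n hc.level_ne_zero
  have hζ0 : algebraMap ℂ K ζ ≠ 0 := by
    simpa using hζ.ne_zero hc.level_ne_zero
  refine hc.exists_algEquiv (hc.toIsCurveWithEquation.of_mem_adjoin hc.transcendental ?_ ?_ ?_)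
  · rw [mul_pow, ← map_pow, hζ.pow_eq_one, map_one, one_mul, hc.equation]
  · exact IntermediateField.subset_adjoin _ _ (by simp)
  · have h1 : algebraMap ℂ K ζ * y ∈ IntermediateField.adjoin ℂ {x, algebraMap ℂ K ζ * y} :=
      IntermediateField.subset_adjoin _ _ (by simp)
    have h2 := mul_mem (IntermediateField.algebraMap_mem
      (IntermediateField.adjoin ℂ {x, algebraMap ℂ K ζ * y}) ζ⁻¹) h1
    rwa [map_inv₀, inv_mul_cancel_left₀ hζ0] at h2

theorem levelGroup_eq_zpowers {τ : K ≃ₐ[ℂ] K} (h1 : τ x = x)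
    (h2 : τ y = algebraMap ℂ K (Complex.exp (2 * Real.pi * Complex.I / n)) * y) :
    levelGroup n x y = Subgroup.zpowers τ := by
  rw [levelGroup, Subgroup.zpowers_eq_closure]
  congr 1
  ext σ
  simp only [Set.mem_ofPred_eq, Set.mem_singleton_iff]
  constructor
  · rintro ⟨h3, h4⟩
    exact hc.algEquiv_ext (h3.trans h1.symm) (h4.trans h2.symm)
  · rintro rfl
    exact ⟨h1, h2⟩

omit hc in
theorem levelGenerator_pow_apply {τ : K ≃ₐ[ℂ] K} {c : ℂ} (h2 : τ y = algebraMap ℂ K c * y)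
    (k : ℕ) : (τ ^ k) y = algebraMap ℂ K (c ^ k) * y := by
  induction k with
  | zero => simp
  | succ k ih =>
    rw [pow_succ', AlgEquiv.mul_apply, ih, map_mul, τ.commutes, h2, pow_succ, map_mul]
    ring

/-- Since `f x` is fixed, `σ y / y` is an `n`-th root of unity, hence a power of the chosen
primitive one. -/
theorem exists_apply_y {σ : K ≃ₐ[ℂ] K} (h : σ x = x) :
    ∃ i : ℕ, σ y = algebraMap ℂ K (Complex.exp (2 * Real.pi * Complex.I / n) ^ i) * y := by
  have hy := hc.y_ne_zero
  have : NeZero n := ⟨hc.level_ne_zero⟩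
  have hζK : IsPrimitiveRoot (algebraMap ℂ K (Complex.exp (2 * Real.pi * Complex.I / n))) n :=
    (Complex.isPrimitiveRoot_exp n hc.level_ne_zero).map_of_injective (algebraMap ℂ K).injective
  have hpow : (σ y / y) ^ n = 1 := by
    rw [div_pow, ← map_pow, hc.equation, ← aeval_algHom_apply, h, div_self]
    rw [← hc.equation]
    exact pow_ne_zero n hy
  obtain ⟨i, -, hi⟩ := hζK.eq_pow_of_pow_eq_one hpow
  exact ⟨i, by rw [map_pow, hi, div_mul_cancel₀ _ hy]⟩

/-- An automorphism over `ℂ(x)` multiplies `y` by a power of the root of unity, so it is a power of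
the generator: `H` is the full group of automorphisms over `ℂ(x)`. -/
theorem mem_levelGroup_iff {σ : K ≃ₐ[ℂ] K} : σ ∈ levelGroup n x y ↔ σ x = x := by
  constructor
  · intro h
    induction h using Subgroup.closure_induction with
    | mem τ hτ => exact hτ.1
    | one => rfl
    | mul σ τ _ _ h1 h2 => rw [AlgEquiv.mul_apply, h2, h1]
    | inv σ _ h =>
      rw [AlgEquiv.aut_inv]
      exact (AlgEquiv.symm_apply_eq σ).2 h.symm
  · intro h
    obtain ⟨τ, h1, h2⟩ := hc.exists_levelGenerator
    rw [hc.levelGroup_eq_zpowers h1 h2]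
    obtain ⟨i, hi⟩ := hc.exists_apply_y h
    refine Subgroup.mem_zpowers_iff.2 ⟨i, ?_⟩
    rw [zpow_natCast]
    refine hc.algEquiv_ext ?_ ((levelGenerator_pow_apply h2 i).trans hi.symm)
    rw [h]
    clear hi
    induction i with
    | zero => rfl
    | succ k ih => rw [pow_succ, AlgEquiv.mul_apply, h1, ih]

theorem card_levelGroup : Nat.card (levelGroup n x y) = n := by
  obtain ⟨τ, h1, h2⟩ := hc.exists_levelGenerator
  rw [hc.levelGroup_eq_zpowers h1 h2, Nat.card_zpowers]
  have hζ := Complex.isPrimitiveRoot_exp n hc.level_ne_zero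
  have hpow : ∀ k : ℕ, τ ^ k = 1 ↔ n ∣ k := by
    intro k
    rw [← hζ.pow_eq_one_iff_dvd]
    constructor
    · intro h
      have h3 := levelGenerator_pow_apply h2 k
      rw [h, AlgEquiv.one_apply] at h3
      have h4 : algebraMap ℂ K (Complex.exp (2 * Real.pi * Complex.I / n) ^ k) = 1 :=
        mul_right_cancel₀ hc.y_ne_zero (by rw [← h3, one_mul])
      exact (algebraMap ℂ K).injective (by rw [h4, map_one])
    · intro h
      refine hc.algEquiv_ext ?_ ?_
      · clear h
        induction k with
        | zero => rfl
        | succ k ih => rw [pow_succ, AlgEquiv.mul_apply, h1, ih]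
      · rw [levelGenerator_pow_apply h2, h, map_one, one_mul, AlgEquiv.one_apply]
  exact Nat.dvd_antisymm (orderOf_dvd_of_pow_eq_one ((hpow n).2 dvd_rfl))
    ((hpow _).1 (pow_orderOf_eq_one τ))

theorem finite_levelGroup : Finite (levelGroup n x y) :=
  Nat.finite_of_card_ne_zero (by rw [hc.card_levelGroup]; exact hc.level_ne_zero)

/-- One inclusion is clear, and `K` has degree `n` over both fields. -/
theorem fixedField_levelGroup : IntermediateField.fixedField (levelGroup n x y) = xLine x := by
  have := hc.finite_levelGroup
  have := hc.finiteDimensional_xLine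
  symm
  apply IntermediateField.eq_of_le_of_finrank_eq'
  · rw [xLine, IntermediateField.adjoin_simple_le_iff, IntermediateField.mem_fixedField_iff]
    exact fun σ hσ => hc.mem_levelGroup_iff.1 hσ
  · rw [finrank_fixedField_of_finite, hc.card_levelGroup, hc.finrank_xLine]

theorem mem_xLine_iff_levelGroup {g : K} : g ∈ xLine x ↔ ∀ σ ∈ levelGroup n x y, σ g = g := by
  rw [← hc.fixedField_levelGroup, IntermediateField.mem_fixedField_iff]

/-- As `ℂ(x)` is the fixed field of `H`, normalizing `H` means preserving `ℂ(x)`; each of the two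
conditions supplies one direction of the conjugation equivalence. -/
theorem mem_levelNormalizer_iff {σ : K ≃ₐ[ℂ] K} :
    σ ∈ levelNormalizer n x y ↔ σ x ∈ xLine x ∧ σ⁻¹ x ∈ xLine x := by
  rw [levelNormalizer, Subgroup.mem_normalizer_iff]
  constructor
  · intro h
    constructor <;> rw [hc.mem_xLine_iff_levelGroup] <;> intro τ hτ
    · have h1 := (h (σ⁻¹ * τ * σ)).2 (by simpa only [mul_assoc, mul_inv_cancel_left,
        mul_inv_cancel, mul_one] using hτ)
      have h2 := congrArg σ (hc.mem_levelGroup_iff.1 h1)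
      rwa [AlgEquiv.mul_apply, AlgEquiv.mul_apply, algEquiv_apply_inv_self] at h2
    · have h1 := (h τ).1 hτ
      have h2 := congrArg (σ⁻¹ : K ≃ₐ[ℂ] K) (hc.mem_levelGroup_iff.1 h1)
      rwa [AlgEquiv.mul_apply, AlgEquiv.mul_apply, algEquiv_inv_apply_self] at h2
  · rintro ⟨h1, h2⟩ τ
    constructor
    · intro hτ
      rw [hc.mem_levelGroup_iff, AlgEquiv.mul_apply, AlgEquiv.mul_apply,
        hc.mem_xLine_iff_levelGroup.1 h2 τ hτ, algEquiv_apply_inv_self]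
    · intro hτ
      have h3 := congrArg (σ⁻¹ : K ≃ₐ[ℂ] K) (hc.mem_xLine_iff_levelGroup.1 h1 _ hτ)
      rw [hc.mem_levelGroup_iff]
      rwa [AlgEquiv.mul_apply, AlgEquiv.mul_apply, algEquiv_inv_apply_self,
        algEquiv_inv_apply_self] at h3

end IsSeparableCurve

end Curve

/-! ### The value of `x` at a place, and orders of rational functions. -/

section Points

variable {K : Type*} [Field K] [Algebra ℂ K]

open Classical in
/-- The point of `ℙ¹(ℂ)` with affine coordinate singled out by `P`, or `∞`. -/
noncomputable def pointOf (P : ℂ → Prop) : OnePoint ℂ :=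
  if h : ∃ a : ℂ, P a then (h.choose : OnePoint ℂ) else ∞

/-- The value in `ℙ¹(ℂ)` of the function `x` at the place `V`. -/
noncomputable def pointAt (x : K) (V : ValuationSubring K) : OnePoint ℂ :=
  pointOf fun a => V.valuation (x - algebraMap ℂ K a) < 1

theorem pointAt_smul (x : K) (V : ValuationSubring K) (σ : K ≃ₐ[ℂ] K) :
    pointAt x (σ • V) = pointAt (σ⁻¹ x) V := by
  refine congrArg pointOf (funext fun a => propext ?_)
  rw [smul_valuation_lt_one_iff, map_sub, AlgEquiv.commutes]

/-- The choice in `pointOf` is harmless: two residues would differ by a nonzero constant, which is a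
unit at every place. -/
theorem pointAt_eq_coe_iff {x : K} {V : ValuationSubring K} (hV : IsPlace V) {a : ℂ} :
    pointAt x V = (a : OnePoint ℂ) ↔ V.valuation (x - algebraMap ℂ K a) < 1 := by
  have huniq : ∀ {a b : ℂ}, V.valuation (x - algebraMap ℂ K a) < 1 →
      V.valuation (x - algebraMap ℂ K b) < 1 → a = b := by
    intro a b ha hb
    by_contra hne
    have h : V.valuation (algebraMap ℂ K (b - a)) < 1 := by
      have : algebraMap ℂ K (b - a) = (x - algebraMap ℂ K a) - (x - algebraMap ℂ K b) := by
        rw [map_sub]; ring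
      rw [this]
      exact lt_of_le_of_lt (Valuation.map_sub _ _ _) (max_lt ha hb)
    rw [valuation_algebraMap_eq_one hV.1 (sub_ne_zero.2 (Ne.symm hne))] at h
    exact lt_irrefl _ h
  unfold pointAt pointOf
  split_ifs with h
  · rw [OnePoint.coe_eq_coe]
    exact ⟨fun h' => h' ▸ h.choose_spec, fun h' => huniq h.choose_spec h'⟩
  · exact ⟨fun h' => absurd h' (OnePoint.infty_ne_coe a), fun h' => absurd ⟨a, h'⟩ h⟩

theorem valuation_aeval_eq_prod {V : ValuationSubring K} (hV : IsPlace V) (x : K) {A : ℂ[X]}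
    (hA : A ≠ 0) : V.valuation (aeval x A) =
      (A.roots.map fun a => V.valuation (x - algebraMap ℂ K a)).prod := by
  conv_lhs => rw [(IsAlgClosed.splits A).eq_prod_roots]
  rw [map_mul, map_mul, aeval_C, valuation_algebraMap_eq_one hV.1 (leadingCoeff_ne_zero.2 hA),
    one_mul, map_multiset_prod, map_multiset_prod, Multiset.map_map, Multiset.map_map]
  simp

theorem valuation_aeval_le_one {V : ValuationSubring K} (hV : IsPlace V) {x : K}
    (hx : V.valuation x ≤ 1) (A : ℂ[X]) : V.valuation (aeval x A) ≤ 1 := by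
  rw [V.valuation_le_one_iff] at hx ⊢
  induction A using Polynomial.induction_on' with
  | add p q hp hq => rw [map_add]; exact add_mem hp hq
  | monomial k a => rw [aeval_monomial]; exact mul_mem (hV.1 a) (pow_mem hx k)

/-- A valuation ring that contains a subfield over which the field is algebraic is everything. -/
theorem eq_top_of_isAlgebraic {E : IntermediateField ℂ K} [Algebra.IsAlgebraic E K]
    {V : ValuationSubring K} (h : ∀ z ∈ E, z ∈ V) : V = ⊤ := by
  ext z
  simp only [ValuationSubring.mem_top, iff_true]
  obtain ⟨p, hp, hpz⟩ := (Algebra.IsAlgebraic.isAlgebraic (R := E) z).isIntegral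
  let φ : E →+* V := (algebraMap E K).codRestrict V.toSubring fun e => h _ e.2
  have hz : IsIntegral V z := ⟨p.map φ, hp.map φ, by
    rw [eval₂_map]
    exact hpz⟩
  obtain ⟨w, rfl⟩ := IsIntegrallyClosed.isIntegral_iff.1 hz
  exact w.2

/-- If every `x - a` were a unit, all nonzero polynomials in `x` would be units, because they split;
then `V` would contain `ℂ(x)` and so the whole algebraic extension `K`. -/
theorem exists_residue {x : K} [Algebra.IsAlgebraic (xLine x) K] {V : ValuationSubring K}
    (hV : IsPlace V) (hx : V.valuation x ≤ 1) :
    ∃ a : ℂ, V.valuation (x - algebraMap ℂ K a) < 1 := by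
  by_contra! hne
  apply hV.2
  have h1 : ∀ a : ℂ, V.valuation (x - algebraMap ℂ K a) = 1 := fun a =>
    le_antisymm (le_trans (Valuation.map_sub _ _ _)
      (max_le hx ((V.valuation_le_one_iff _).2 (hV.1 a)))) (hne a)
  have h2 : ∀ A : ℂ[X], A ≠ 0 → V.valuation (aeval x A) = 1 := fun A hA => by
    rw [valuation_aeval_eq_prod hV x hA]
    simp [h1]
  apply eq_top_of_isAlgebraic (E := xLine x)
  intro z hz
  obtain ⟨A, B, rfl⟩ := mem_xLine_iff.1 hz
  rw [← V.valuation_le_one_iff, map_div₀]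
  by_cases hB : B = 0
  · simp [hB]
  rw [h2 B hB, div_one]
  exact valuation_aeval_le_one hV hx A

theorem pointAt_eq_infty_iff {x : K} [Algebra.IsAlgebraic (xLine x) K] {V : ValuationSubring K}
    (hV : IsPlace V) : pointAt x V = ∞ ↔ 1 < V.valuation x := by
  rw [← not_le]
  constructor
  · intro h hx
    obtain ⟨a, ha⟩ := exists_residue hV hx
    rw [(pointAt_eq_coe_iff hV).2 ha] at h
    exact OnePoint.coe_ne_infty a h
  · intro h
    by_contra hne
    obtain ⟨a, ha⟩ := OnePoint.ne_infty_iff_exists.1 hne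
    have h1 := (pointAt_eq_coe_iff hV).1 ha.symm
    apply h
    have h2 := Valuation.map_add V.valuation (x - algebraMap ℂ K a) (algebraMap ℂ K a)
    rw [sub_add_cancel] at h2
    exact h2.trans (max_le h1.le ((V.valuation_le_one_iff _).2 (hV.1 a)))

theorem transcendental_ne_zero {z : K} (hz : Transcendental ℂ z) : z ≠ 0 := by
  rintro rfl
  exact hz isAlgebraic_zero

/-- The element `z` is not a unit of `ℂ[z]`, and a valuation ring of `K` exists that contains `ℂ[z]`
and has the ideal `(z)` among its nonunits. -/
theorem exists_place_valuation_lt_one {z : K} (hz : Transcendental ℂ z) :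
    ∃ V : ValuationSubring K, IsPlace V ∧ V.valuation z < 1 := by
  let A : Subring K := (Algebra.adjoin ℂ {z}).toSubring
  have hzA : z ∈ A := Algebra.subset_adjoin (Set.mem_singleton z)
  obtain ⟨V, hV1, hV2⟩ := Ideal.image_subset_nonunits_valuationSubring
    (Ideal.span {(⟨z, hzA⟩ : A)}) (by
      rw [Ne, Ideal.span_singleton_eq_top]
      rintro hu
      obtain ⟨⟨w, hw⟩, hw1⟩ := hu.exists_right_inv
      have hw' : w ∈ Algebra.adjoin ℂ {z} := hw
      rw [Algebra.adjoin_singleton_eq_range_aeval] at hw'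
      obtain ⟨P, rfl⟩ := hw'
      have h1 : z * aeval z P = 1 := congrArg Subtype.val hw1
      refine hz ⟨X * P - 1, fun h0 => ?_, by simp [h1]⟩
      have := congrArg (eval 0) h0
      simp at this)
  have hz1 : V.valuation z < 1 := hV2 ⟨⟨z, hzA⟩, Ideal.subset_span rfl, rfl⟩
  refine ⟨V, ⟨fun c => hV1 ((Algebra.adjoin ℂ {z}).algebraMap_mem c), ?_⟩, hz1⟩
  rintro rfl
  rw [valuation_lt_one_iff_inv _ (transcendental_ne_zero hz), ValuationSubring.valuation_le_one_iff] at hz1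
  exact hz1 (ValuationSubring.mem_top _)

theorem Transcendental.sub_algebraMap {x : K} (hx : Transcendental ℂ x) (a : ℂ) :
    Transcendental ℂ (x - algebraMap ℂ K a) := fun h => hx (by
  simpa using h.add (isAlgebraic_algebraMap a))

theorem exists_place_pointAt_eq {x : K} (hx : Transcendental ℂ x)
    [Algebra.IsAlgebraic (xLine x) K] (p : OnePoint ℂ) :
    ∃ V : ValuationSubring K, IsPlace V ∧ pointAt x V = p := by
  induction p using OnePoint.rec with
  | infty =>
    obtain ⟨V, hV, h⟩ := exists_place_valuation_lt_one (z := x⁻¹) fun h => hx (by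
      simpa using h.inv)
    refine ⟨V, hV, (pointAt_eq_infty_iff hV).2 ?_⟩
    rw [map_inv₀] at h
    exact (inv_lt_one₀ (zero_lt_iff.2 (by simpa using (transcendental_ne_zero hx)))).1 h
  | coe a =>
    obtain ⟨V, hV, h⟩ := exists_place_valuation_lt_one (hx.sub_algebraMap a)
    exact ⟨V, hV, (pointAt_eq_coe_iff hV).2 h⟩

/-- The order of vanishing of a polynomial at a point of the projective line. -/
noncomputable def ordAt (p : OnePoint ℂ) (A : ℂ[X]) : ℤ :=
  p.elim (-(A.natDegree : ℤ)) fun a => (A.rootMultiplicity a : ℤ)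

/-- The standard uniformizer at a point of the projective line. -/
noncomputable def uniformizerAt (p : OnePoint ℂ) (x : K) : K :=
  p.elim x⁻¹ fun a => x - algebraMap ℂ K a

@[simp] theorem ordAt_infty (A : ℂ[X]) : ordAt ∞ A = -(A.natDegree : ℤ) := rfl

@[simp] theorem ordAt_coe (a : ℂ) (A : ℂ[X]) : ordAt a A = A.rootMultiplicity a := rfl

@[simp] theorem uniformizerAt_infty (x : K) : uniformizerAt ∞ x = x⁻¹ := rfl

@[simp] theorem uniformizerAt_coe (a : ℂ) (x : K) :
    uniformizerAt a x = x - algebraMap ℂ K a := rfl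

theorem uniformizerAt_mem_xLine (p : OnePoint ℂ) (x : K) : uniformizerAt p x ∈ xLine x := by
  induction p using OnePoint.rec with
  | infty => exact inv_mem self_mem_xLine
  | coe a => exact sub_mem self_mem_xLine (IntermediateField.algebraMap_mem _ a)

theorem uniformizerAt_ne_zero (p : OnePoint ℂ) {x : K} (hx : Transcendental ℂ x) :
    uniformizerAt p x ≠ 0 := by
  induction p using OnePoint.rec with
  | infty => exact inv_ne_zero (transcendental_ne_zero hx)
  | coe a => exact transcendental_ne_zero (hx.sub_algebraMap a)

theorem valuation_uniformizerAt_ne_zero {x : K} (hx : Transcendental ℂ x)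
    (V : ValuationSubring K) (p : OnePoint ℂ) : V.valuation (uniformizerAt p x) ≠ 0 := by
  simpa using uniformizerAt_ne_zero p hx

theorem valuation_sub_algebraMap_eq_one {x : K} {V : ValuationSubring K} (hV : IsPlace V)
    {a b : ℂ} (ha : V.valuation (x - algebraMap ℂ K a) < 1)
    (hab : a ≠ b) : V.valuation (x - algebraMap ℂ K b) = 1 := by
  have h1 : x - algebraMap ℂ K b = (x - algebraMap ℂ K a) + algebraMap ℂ K (a - b) := by
    rw [map_sub]; ring
  have h2 := valuation_algebraMap_eq_one hV.1 (sub_ne_zero.2 hab)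
  rw [h1, Valuation.map_add_eq_of_lt_right _ (by rwa [h2]), h2]

section

variable {x : K} [Algebra.IsAlgebraic (xLine x) K] {V : ValuationSubring K} (hV : IsPlace V)
include hV

theorem valuation_uniformizerAt_lt_one :
    V.valuation (uniformizerAt (pointAt x V) x) < 1 := by
  induction h : pointAt x V using OnePoint.rec with
  | infty =>
    rw [pointAt_eq_infty_iff hV] at h
    exact (by simpa using inv_lt_one_of_one_lt₀ h : V.valuation x⁻¹ < 1)
  | coe a => exact (pointAt_eq_coe_iff hV).1 h

/-- After factoring `A`, only the factors vanishing at the point contribute; at infinity every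
linear factor has the valuation of `x`. -/
theorem valuation_aeval {A : ℂ[X]} (hA : A ≠ 0) : V.valuation (aeval x A) =
    V.valuation (uniformizerAt (pointAt x V) x) ^ ordAt (pointAt x V) A := by
  induction h : pointAt x V using OnePoint.rec with
  | infty =>
    rw [pointAt_eq_infty_iff hV] at h
    have h1 : ∀ b : ℂ, V.valuation (x - algebraMap ℂ K b) = V.valuation x := fun b =>
      Valuation.map_sub_eq_of_lt_left _
        (lt_of_le_of_lt ((V.valuation_le_one_iff _).2 (hV.1 b)) h)
    change _ = V.valuation x⁻¹ ^ (-(A.natDegree : ℤ))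
    rw [valuation_aeval_eq_prod hV x hA, zpow_neg, zpow_natCast, map_inv₀, inv_pow, inv_inv,
      (IsAlgClosed.splits A).natDegree_eq_card_roots]
    simp [h1]
  | coe a =>
    have h' := (pointAt_eq_coe_iff hV).1 h
    change _ = V.valuation (x - algebraMap ℂ K a) ^ ((A.rootMultiplicity a : ℕ) : ℤ)
    obtain ⟨B, hAB, hB⟩ := exists_eq_pow_rootMultiplicity_mul_and_not_dvd A hA a
    have hB0 : B ≠ 0 := fun h0 => hB (h0 ▸ dvd_zero _)
    have h1 : V.valuation (aeval x B) = 1 := by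
      rw [valuation_aeval_eq_prod hV x hB0]
      refine Multiset.prod_eq_one fun c hc => ?_
      obtain ⟨b, hb, rfl⟩ := Multiset.mem_map.1 hc
      refine valuation_sub_algebraMap_eq_one hV h' ?_
      rintro rfl
      exact hB (dvd_iff_isRoot.2 ((mem_roots hB0).1 hb))
    conv_lhs => rw [hAB]
    rw [map_mul, map_mul, h1, mul_one, zpow_natCast, map_pow, map_pow]
    simp

end

/-- One exponent serves all places above `p`, although their value groups are not compared; its sign
then decides membership in each of these valuation rings, as used in `mem_iff_of_pointAt_eq`. -/
theorem exists_ord {x : K} (hx : Transcendental ℂ x) [Algebra.IsAlgebraic (xLine x) K]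
    (p : OnePoint ℂ) {g : K} (hg : g ∈ xLine x) (hg0 : g ≠ 0) :
    ∃ k : ℤ, ∀ V : ValuationSubring K, IsPlace V → pointAt x V = p →
      V.valuation g = V.valuation (uniformizerAt p x) ^ k := by
  obtain ⟨A, B, rfl⟩ := mem_xLine_iff.1 hg
  have hA : A ≠ 0 := by rintro rfl; simp at hg0
  have hB : B ≠ 0 := by rintro rfl; simp at hg0
  refine ⟨ordAt p A - ordAt p B, ?_⟩
  rintro V hV rfl
  rw [map_div₀, valuation_aeval hV hA, valuation_aeval hV hB,
    zpow_sub₀ (valuation_uniformizerAt_ne_zero hx _ _)]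

theorem mem_iff_of_pointAt_eq {x : K} (hx : Transcendental ℂ x) [Algebra.IsAlgebraic (xLine x) K]
    {V W : ValuationSubring K} (hV : IsPlace V) (hW : IsPlace W)
    (h : pointAt x V = pointAt x W) {g : K} (hg : g ∈ xLine x) : g ∈ V ↔ g ∈ W := by
  by_cases hg0 : g = 0
  · subst hg0; exact ⟨fun _ => zero_mem _, fun _ => zero_mem _⟩
  obtain ⟨k, hk⟩ := exists_ord hx (pointAt x V) hg hg0
  have h1 := hk V hV rfl
  have h2 := hk W hW h.symm
  have h3 := valuation_uniformizerAt_lt_one (x := x) hV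
  have h4 := valuation_uniformizerAt_lt_one (x := x) hW
  rw [← h] at h4
  rw [← V.valuation_le_one_iff, ← W.valuation_le_one_iff, h1, h2,
    zpow_le_one_iff_right_of_lt_one₀ (zero_lt_iff.2 (valuation_uniformizerAt_ne_zero hx _ _)) h3,
    zpow_le_one_iff_right_of_lt_one₀ (zero_lt_iff.2 (valuation_uniformizerAt_ne_zero hx _ _)) h4]

end Points

/-! ### Ramification of the level group over the `x`-line. -/

theorem valuation_le_valuation_sum {R Γ₀ ι : Type*} [Ring R] [LinearOrderedCommGroupWithZero Γ₀]
    (v : Valuation R Γ₀) (s : Finset ι) (t : ι → R)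
    (ht : ∀ i ∈ s, ∀ j ∈ s, i ≠ j → v (t i) ≠ 0 → v (t i) ≠ v (t j)) :
    ∀ i ∈ s, v (t i) ≤ v (∑ i ∈ s, t i) := by
  classical
  -- Terms with distinct nonzero values cannot cancel. The induction also carries that a nonzero
  -- value of the sum is attained by a term, in order to compare it with the next term.
  suffices h : (∀ i ∈ s, v (t i) ≤ v (∑ i ∈ s, t i)) ∧
      (v (∑ i ∈ s, t i) ≠ 0 → ∃ i ∈ s, v (t i) = v (∑ i ∈ s, t i)) from h.1
  induction s using Finset.induction_on with
  | empty => simp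
  | insert a s ha ih =>
    obtain ⟨ih1, ih2⟩ := ih fun i hi j hj =>
      ht i (Finset.mem_insert_of_mem hi) j (Finset.mem_insert_of_mem hj)
    rw [Finset.sum_insert ha]
    have hmax : v (t a + ∑ i ∈ s, t i) = max (v (t a)) (v (∑ i ∈ s, t i)) := by
      by_cases h0 : v (∑ i ∈ s, t i) = 0
      · by_cases h1 : v (t a) = 0
        · have := Valuation.map_add v (t a) (∑ i ∈ s, t i)
          rw [h0, h1, max_self] at this ⊢
          exact le_antisymm this zero_le
        · exact Valuation.map_add_of_distinct_val v (by rwa [h0])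
      · obtain ⟨i, hi, hi'⟩ := ih2 h0
        refine Valuation.map_add_of_distinct_val v ?_
        rw [← hi'] at h0 ⊢
        exact (ht i (Finset.mem_insert_of_mem hi) a (Finset.mem_insert_self a s)
          (by rintro rfl; exact ha hi) h0).symm
    rw [hmax]
    refine ⟨fun i hi => ?_, fun h0 => ?_⟩
    · rcases Finset.mem_insert.1 hi with rfl | hi
      · exact le_max_left _ _
      · exact (ih1 i hi).trans (le_max_right _ _)
    · rcases max_choice (v (t a)) (v (∑ i ∈ s, t i)) with h | h
      · exact ⟨a, Finset.mem_insert_self a s, h.symm⟩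
      · rw [h] at h0 ⊢
        obtain ⟨i, hi, hi'⟩ := ih2 h0
        exact ⟨i, Finset.mem_insert_of_mem hi, hi'⟩

section Ramification

variable {K : Type*} [Field K] [Algebra ℂ K] {n : ℕ} {f : ℂ[X]} {x y : K}

namespace IsSeparableCurve

variable (hc : IsSeparableCurve n f x y)
include hc

theorem isAlgebraic_xLine : Algebra.IsAlgebraic (xLine x) K :=
  have := hc.finiteDimensional_xLine
  Algebra.IsAlgebraic.of_finite _ _

theorem exists_eq_sum (z : K) : ∃ g : ℕ → K, (∀ i, g i ∈ xLine x) ∧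
    z = ∑ i ∈ Finset.range n, g i * y ^ i := by
  have hz : z ∈ Algebra.adjoin (xLine x) {y} := by
    rw [← IntermediateField.adjoin_simple_toSubalgebra_of_isAlgebraic
      hc.isIntegral_xLine.isAlgebraic, hc.adjoin_xLine_eq_top]
    exact Algebra.mem_top
  rw [Algebra.adjoin_singleton_eq_range_aeval] at hz
  obtain ⟨P, rfl⟩ := hz
  have hm := monic_X_pow_sub_C (⟨aeval x f, aeval_mem_xLine f⟩ : xLine x) hc.level_ne_zero
  set m : (xLine x)[X] := X ^ n - C ⟨aeval x f, aeval_mem_xLine f⟩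
  have hroot : aeval y m = 0 := by
    have h := minpoly.aeval (xLine x) y
    rw [hc.minpoly_xLine] at h
    exact h
  have hdeg : (P %ₘ m).natDegree < n := by
    have h := natDegree_modByMonic_lt P hm (by
      intro h1
      have h2 := natDegree_X_pow_sub_C (n := n) (r := (⟨aeval x f, aeval_mem_xLine f⟩ : xLine x))
      rw [show (X ^ n - C ⟨aeval x f, aeval_mem_xLine f⟩ : (xLine x)[X]) = 1 from h1,
        natDegree_one] at h2
      exact hc.level_ne_zero h2.symm)
    rwa [natDegree_X_pow_sub_C] at h
  refine ⟨fun i => ((P %ₘ m).coeff i : K), fun i => ((P %ₘ m).coeff i).2, ?_⟩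
  change aeval y P = _
  rw [← aeval_modByMonic_eq_self_of_root hroot, aeval_eq_sum_range' hdeg]
  exact Finset.sum_congr rfl fun i _ => Algebra.smul_def _ _

/-- Total ramification: where the order of `f` is prime to `n`, the level group fixes the place. -/
theorem smul_eq_of_isCoprime {V : ValuationSubring K} (hV : IsPlace V)
    (hcop : IsCoprime (n : ℤ) (ordAt (pointAt x V) f)) {σ : K ≃ₐ[ℂ] K}
    (hσ : σ ∈ levelGroup n x y) : σ • V = V := by
  have := hc.isAlgebraic_xLine
  set v := V.valuation
  have hlt := valuation_uniformizerAt_lt_one (x := x) hV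
  have hne := valuation_uniformizerAt_ne_zero hc.transcendental V (pointAt x V)
  have hyn : v y ^ n = v (uniformizerAt (pointAt x V) x) ^ ordAt (pointAt x V) f := by
    rw [← map_pow, hc.equation, valuation_aeval hV hc.separable.ne_zero]
  set e := ordAt (pointAt x V) f
  set t := v (uniformizerAt (pointAt x V) x)
  have hinj : Function.Injective fun k : ℤ => t ^ k :=
    zpow_right_injective₀ (zero_lt_iff.2 hne) hlt.ne
  -- Write `z = ∑ g i * y ^ i` with `g i ∈ ℂ(x)`. The nonzero terms have distinct values, so each
  -- lies in `V` when `z` does, and `τ` only multiplies each of them by a constant.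
  have key : ∀ τ ∈ levelGroup n x y, V ≤ τ⁻¹ • V := by
    intro τ hτ z hz
    rw [ValuationSubring.mem_pointwise_smul_iff_inv_smul_mem, inv_inv, AlgEquiv.smul_def]
    obtain ⟨g, hg, rfl⟩ := hc.exists_eq_sum z
    have hterm : ∀ i ∈ Finset.range n, v (g i * y ^ i) ≤ 1 := by
      intro i hi
      refine (valuation_le_valuation_sum v (Finset.range n) (fun i => g i * y ^ i) ?_ i hi).trans
        ((V.valuation_le_one_iff _).2 hz)
      clear hi i
      intro i hi j hj hij h0 heq
      have hi0 : g i ≠ 0 := by rintro h; apply h0; simp [h]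
      have hj0 : g j ≠ 0 := by rintro h; rw [heq] at h0; apply h0; simp [h]
      obtain ⟨k, hk⟩ := exists_ord hc.transcendental (pointAt x V) (hg i) hi0
      obtain ⟨l, hl⟩ := exists_ord hc.transcendental (pointAt x V) (hg j) hj0
      have hk' := hk V hV rfl
      have hl' := hl V hV rfl
      -- To stay with integral exponents, `n`-th powers are compared, as `y ^ n` has order `e`.
      -- Equal values force `n ∣ e * (i - j)`, hence `n ∣ i - j` and `i = j`.
      have hpow : ∀ (k : ℤ) (i : ℕ), (t ^ k * v y ^ i) ^ n = t ^ (k * n + e * i) := by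
        intro k i
        rw [mul_pow, ← pow_mul, mul_comm i n, pow_mul, hyn, zpow_add₀ hne, zpow_mul, zpow_mul,
          zpow_natCast, zpow_natCast]
      have h1 : t ^ (k * n + e * i) = t ^ (l * n + e * j) := by
        rw [← hpow, ← hpow, ← hk', ← hl']
        simpa only [map_mul, map_pow] using congrArg (· ^ n) heq
      have h2 : k * n + e * i = l * n + e * j := hinj h1
      have h3 : (n : ℤ) ∣ e * ((i : ℤ) - j) := ⟨l - k, by linarith⟩
      have h4 := hcop.dvd_of_dvd_mul_left h3
      obtain ⟨q, hq⟩ := h4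
      have hi' := Finset.mem_range.1 hi
      have hj' := Finset.mem_range.1 hj
      have : q = 0 := by
        rcases lt_trichotomy q 0 with h | h | h
        · nlinarith
        · exact h
        · nlinarith
      subst this
      omega
    obtain ⟨c, hcy⟩ := hc.exists_apply_y (hc.mem_levelGroup_iff.1 hτ)
    rw [map_sum]
    refine sum_mem fun i hi => ?_
    rw [map_mul, map_pow, hc.mem_xLine_iff_levelGroup.1 (hg i) τ hτ, hcy, mul_pow, ← map_pow,
      mul_left_comm]
    exact mul_mem (hV.1 _) ((V.valuation_le_one_iff _).1 (hterm i hi))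
  refine le_antisymm ?_ ?_
  · have h := key σ hσ
    have h2 : σ • V ≤ σ • σ⁻¹ • V := fun z hz => by
      rw [ValuationSubring.mem_pointwise_smul_iff_inv_smul_mem] at hz ⊢
      exact h hz
    rwa [smul_inv_smul] at h2
  · have h := key σ⁻¹ (inv_mem hσ)
    rwa [inv_inv] at h

/-- If `w ^ n` is congruent to a nonzero constant and `w` is an eigenvector of `σ` which fixes
the place, then its eigenvalue is `1`. -/
theorem eigenvalue_eq_one {V : ValuationSubring K} (hV : IsPlace V) {σ : K ≃ₐ[ℂ] K}
    (hσV : σ • V = V) {w : K} {c d : ℂ} (hd : d ≠ 0) (hw : V.valuation (w ^ n - algebraMap ℂ K d) < 1)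
    (hσw : σ w = algebraMap ℂ K c * w) : c = 1 := by
  have hne : (X ^ n - C d : ℂ[X]) ≠ 0 := (monic_X_pow_sub_C d hc.level_ne_zero).ne_zero
  have h1 : V.valuation (aeval w (X ^ n - C d : ℂ[X])) < 1 := by simpa using hw
  rw [valuation_aeval_eq_prod hV w hne] at h1
  obtain ⟨a, ha, ha1⟩ : ∃ a ∈ (X ^ n - C d : ℂ[X]).roots, V.valuation (w - algebraMap ℂ K a) < 1 := by
    by_contra! h
    refine absurd h1 (not_lt.2 (Multiset.one_le_prod_of_one_le ?_))
    intro u hu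
    obtain ⟨a, ha, rfl⟩ := Multiset.mem_map.1 hu
    exact h a ha
  have ha0 : a ≠ 0 := by
    rintro rfl
    rw [mem_roots hne] at ha
    simp [hc.level_ne_zero] at ha
    exact hd ha
  -- Here `w ≡ a` with `a ^ n = d`. Applying `σ`, which fixes `V`, gives `c * w ≡ a`, whereas
  -- multiplying by `c` gives `c * w ≡ c * a`; so the constant `a * (c - 1)` is a nonunit.
  have h2 : V.valuation (algebraMap ℂ K c * w - algebraMap ℂ K a) < 1 := by
    rw [← hσV, smul_valuation_lt_one_iff]
    rw [← hσw, map_sub, algEquiv_inv_apply_self, AlgEquiv.commutes]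
    exact ha1
  by_contra hc1
  have h3 : V.valuation (algebraMap ℂ K (a * (c - 1))) < 1 := by
    have h4 : algebraMap ℂ K (a * (c - 1)) = (algebraMap ℂ K c * w - algebraMap ℂ K a) -
        algebraMap ℂ K c * (w - algebraMap ℂ K a) := by
      rw [map_mul, map_sub, map_one]; ring
    rw [h4]
    refine lt_of_le_of_lt (Valuation.map_sub _ _ _) (max_lt h2 ?_)
    rw [map_mul]
    exact lt_of_le_of_lt (mul_le_of_le_one_left zero_le ((V.valuation_le_one_iff _).2 (hV.1 c))) ha1
  rw [valuation_algebraMap_eq_one hV.1 (mul_ne_zero ha0 (sub_ne_zero.2 hc1))] at h3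
  exact lt_irrefl _ h3

/-- Where `n` divides the order of `f`, the level group acts freely on the places. -/
theorem eq_one_of_smul_eq {V : ValuationSubring K} (hV : IsPlace V)
    (hdvd : (n : ℤ) ∣ ordAt (pointAt x V) f) (hn : 2 ≤ n) {σ : K ≃ₐ[ℂ] K}
    (hσ : σ ∈ levelGroup n x y) (hσV : σ • V = V) : σ = 1 := by
  have := hc.isAlgebraic_xLine
  have hσx := hc.mem_levelGroup_iff.1 hσ
  have hx0 := transcendental_ne_zero hc.transcendental
  obtain ⟨i, hi⟩ := hc.exists_apply_y hσx
  set c := Complex.exp (2 * Real.pi * Complex.I / n) ^ i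
  suffices h : c = 1 by
    refine hc.algEquiv_ext hσx ?_
    rw [hi, h, map_one, one_mul, AlgEquiv.one_apply]
  induction hp : pointAt x V using OnePoint.rec with
  | coe a =>
    have h1 := (pointAt_eq_coe_iff hV).1 hp
    rw [hp, ordAt_coe] at hdvd
    have h2 : f.rootMultiplicity a = 0 := by
      have h3 := rootMultiplicity_le_one_of_separable hc.separable a
      have h4 : n ∣ f.rootMultiplicity a := by exact_mod_cast hdvd
      by_contra h0
      have := Nat.le_of_dvd (Nat.pos_of_ne_zero h0) h4
      omega
    have h3 : f.eval a ≠ 0 := fun h =>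
      ((rootMultiplicity_pos hc.separable.ne_zero).2 h).ne' h2
    refine hc.eigenvalue_eq_one hV hσV h3 ?_ hi
    obtain ⟨B, hB⟩ : X - C a ∣ f - C (f.eval a) := dvd_iff_isRoot.2 (by simp)
    have h4 : y ^ n - algebraMap ℂ K (f.eval a) = (x - algebraMap ℂ K a) * aeval x B := by
      rw [hc.equation]
      simpa using congrArg (aeval x) hB
    rw [h4, map_mul]
    refine lt_of_le_of_lt (mul_le_of_le_one_right zero_le (valuation_aeval_le_one hV ?_ B)) h1
    by_contra hx
    rw [(pointAt_eq_infty_iff hV).2 (not_le.1 hx)] at hp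
    exact OnePoint.infty_ne_coe a hp
  | infty =>
    have h1 := (pointAt_eq_infty_iff hV).1 hp
    rw [hp, ordAt_infty, dvd_neg] at hdvd
    obtain ⟨m, hm⟩ : n ∣ f.natDegree := by exact_mod_cast hdvd
    -- At infinity `y` has a pole, so it is replaced by `y / x ^ m`, whose `n`-th power `f x / x ^
    -- deg f` is congruent to the leading coefficient.
    refine hc.eigenvalue_eq_one hV hσV (leadingCoeff_ne_zero.2 hc.separable.ne_zero)
      (w := y / x ^ m) ?_ (by rw [map_div₀, map_pow, hσx, hi, mul_div_assoc])
    have h2 : (y / x ^ m) ^ n - algebraMap ℂ K f.leadingCoeff =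
        aeval x f.eraseLead / x ^ f.natDegree := by
      have h3 := congrArg (aeval x) f.eraseLead_add_C_mul_X_pow
      simp only [map_add, map_mul, aeval_C, map_pow, aeval_X] at h3
      rw [div_pow, hc.equation, ← h3, ← pow_mul, mul_comm m n, ← hm, add_div,
        mul_div_cancel_right₀ _ (pow_ne_zero _ hx0), add_sub_cancel_right]
    rw [h2, map_div₀, map_pow]
    have hpos : 0 < V.valuation x ^ f.natDegree := pow_pos (zero_lt_one.trans h1) _
    rw [div_lt_one₀ hpos]
    by_cases h0 : f.eraseLead = 0
    · rw [h0, map_zero, map_zero]; exact hpos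
    have h3 := valuation_aeval (x := x) hV h0
    rw [hp, ordAt_infty, uniformizerAt_infty, map_inv₀, inv_zpow, zpow_neg, inv_inv,
      zpow_natCast] at h3
    rw [h3]
    exact pow_lt_pow_right₀ h1 ((eraseLead_natDegree_lt_or_eraseLead_eq_zero f).resolve_right h0)

end IsSeparableCurve

end Ramification

/-! ### Fixed points of Möbius transformations. -/

section Mobius

open Matrix

theorem GL_smul_eq_self_of_scalar {M : GL (Fin 2) ℂ} (h01 : M 0 1 = 0) (h10 : M 1 0 = 0)
    (h : M 0 0 = M 1 1) (p : OnePoint ℂ) : M • p = p := by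
  have hdet := M.det_ne_zero
  rw [det_fin_two] at hdet
  have h11 : M 1 1 ≠ 0 := by rintro h0; apply hdet; simp [h0, h01]
  induction p using OnePoint.rec with
  | infty => rw [OnePoint.smul_infty_eq_self_iff, h10]
  | coe k => rw [OnePoint.smul_some_eq_ite, h10, h01, h]; simp [h11]

theorem scalar_of_forall_GL_smul_eq_self {M : GL (Fin 2) ℂ} (h : ∀ p : OnePoint ℂ, M • p = p) :
    M 0 1 = 0 ∧ M 1 0 = 0 ∧ M 0 0 = M 1 1 := by
  have h1 := OnePoint.smul_infty_eq_self_iff.1 (h ∞)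
  have hdet := M.det_ne_zero
  rw [det_fin_two, h1, mul_zero, sub_zero] at hdet
  have h11 := right_ne_zero_of_mul hdet
  have h2 := h ((0 : ℂ) : OnePoint ℂ)
  have h3 := h ((1 : ℂ) : OnePoint ℂ)
  rw [OnePoint.smul_some_eq_ite] at h2 h3
  simp only [h1, mul_zero, zero_add, h11, if_false, mul_one, OnePoint.coe_eq_coe] at h2 h3
  rw [div_eq_zero_iff, or_iff_left h11] at h2
  rw [h2, add_zero, div_eq_one_iff_eq h11] at h3
  exact ⟨h2, h1, h3⟩

/-- The fixed points of a nontrivial Möbius transformation. -/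
theorem exists_fixedPoints_GL {M : GL (Fin 2) ℂ} (hM : ∃ p : OnePoint ℂ, M • p ≠ p) :
    ∃ p q : OnePoint ℂ, (∀ r : OnePoint ℂ, M • r = r ↔ r = p ∨ r = q) ∧
      (p = q → M.IsParabolic) := by
  by_cases hpar : M.IsParabolic
  · exact ⟨M.parabolicFixedPoint, M.parabolicFixedPoint, fun r => by
      rw [hpar.smul_eq_self_iff, or_self], fun _ => hpar⟩
  have hdisc : (M : Matrix (Fin 2) (Fin 2) ℂ).discr ≠ 0 := by
    intro h0
    refine hpar ⟨?_, h0⟩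
    rintro ⟨s, hs⟩
    obtain ⟨p, hp⟩ := hM
    refine hp (GL_smul_eq_self_of_scalar ?_ ?_ ?_ p) <;> rw [← hs] <;> simp
  rw [discr_fin_two, trace_fin_two, det_fin_two] at hdisc
  by_cases hc : M 1 0 = 0
  · have had : M 1 1 - M 0 0 ≠ 0 := by
      intro h0; apply hdisc; rw [hc]
      linear_combination (M 1 1 - M 0 0) * h0
    have hdet := M.det_ne_zero
    rw [det_fin_two, hc, mul_zero, sub_zero] at hdet
    have h11 := right_ne_zero_of_mul hdet
    refine ⟨∞, ((M 0 1 / (M 1 1 - M 0 0) : ℂ) : OnePoint ℂ), fun r => ?_,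
      fun h => absurd h (OnePoint.infty_ne_coe _)⟩
    induction r using OnePoint.rec with
    | infty => simp [OnePoint.smul_infty_eq_self_iff, hc]
    | coe k =>
      rw [OnePoint.smul_some_eq_ite]
      simp only [hc, zero_mul, zero_add, h11, if_false, OnePoint.coe_eq_coe, OnePoint.coe_ne_infty,
        false_or]
      rw [div_eq_iff h11, eq_div_iff had]
      constructor <;> intro h <;> linear_combination -h
  · obtain ⟨s, hs⟩ := IsAlgClosed.exists_pow_nat_eq
      ((M 0 0 + M 1 1) ^ 2 - 4 * (M 0 0 * M 1 1 - M 0 1 * M 1 0)) (n := 2) two_pos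
    have hs0 : s ≠ 0 := by rintro rfl; apply hdisc; rw [← hs]; simp
    refine ⟨(((M 0 0 - M 1 1 + s) / (2 * M 1 0) : ℂ) : OnePoint ℂ),
      (((M 0 0 - M 1 1 - s) / (2 * M 1 0) : ℂ) : OnePoint ℂ), fun r => ?_, fun h => ?_⟩
    · induction r using OnePoint.rec with
      | infty => simp [OnePoint.smul_infty_eq_self_iff, hc]
      | coe k =>
        rw [← GeneralLinearGroup.fixpointPolynomial_aeval_eq_zero_iff, OnePoint.coe_eq_coe,
          OnePoint.coe_eq_coe, eq_div_iff (by simpa using hc), eq_div_iff (by simpa using hc)]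
        simp only [GeneralLinearGroup.fixpointPolynomial, map_sub, map_mul, map_add, map_pow,
          aeval_X, aeval_C, Algebra.algebraMap_self_apply]
        have key : (k * (2 * M 1 0) - (M 0 0 - M 1 1 + s)) * (k * (2 * M 1 0) - (M 0 0 - M 1 1 - s))
            = 4 * M 1 0 * (M 1 0 * k ^ 2 + (M 1 1 - M 0 0) * k - M 0 1) := by
          linear_combination -hs
        constructor
        · intro h
          rw [h, mul_zero, mul_eq_zero, sub_eq_zero, sub_eq_zero] at key
          exact key
        · intro h
          rw [← sub_eq_zero, ← sub_eq_zero (a := k * (2 * M 1 0)), ← mul_eq_zero, key,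
            mul_eq_zero, or_iff_right (by simpa using hc)] at h
          exact h
    · rw [OnePoint.coe_eq_coe, div_left_inj' (by simpa using hc)] at h
      exact absurd (by linear_combination h / 2) hs0

/-- A nontrivial Möbius transformation of finite order has exactly two fixed points. -/
theorem exists_two_fixedPoints_GL {M : GL (Fin 2) ℂ} (hM : ∃ p : OnePoint ℂ, M • p ≠ p) {k : ℕ}
    (hk : k ≠ 0) (hMk : ∀ p : OnePoint ℂ, M ^ k • p = p) :
    ∃ p q : OnePoint ℂ, p ≠ q ∧ ∀ r : OnePoint ℂ, M • r = r ↔ r = p ∨ r = q := by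
  obtain ⟨p, q, h, hpq⟩ := exists_fixedPoints_GL hM
  refine ⟨p, q, fun heq => ?_, h⟩
  -- With only one fixed point, `M` and its power `M ^ k` would be parabolic; but `M ^ k` fixes both
  -- `∞` and `0`.
  have hpar := (hpq heq).pow hk
  have h1 := hpar.smul_eq_self_iff.1 (hMk ∞)
  have h2 := hpar.smul_eq_self_iff.1 (hMk ((0 : ℂ) : OnePoint ℂ))
  exact OnePoint.infty_ne_coe (0 : ℂ) (h1.trans h2.symm)

/-- The square of an upper triangular `A` is scalar, so the diagonal entries agree up to sign; if
they agreed, the off-diagonal entry would vanish and `A` would act trivially. -/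
theorem diag_of_involution_GL {A : GL (Fin 2) ℂ} (h10 : A 1 0 = 0)
    (hA : ∀ r : OnePoint ℂ, A • A • r = r) (hA' : ∃ r : OnePoint ℂ, A • r ≠ r) :
    A 0 0 = - A 1 1 := by
  have h := scalar_of_forall_GL_smul_eq_self (M := A * A) fun p => by rw [mul_smul]; exact hA p
  simp only [Units.val_mul, mul_apply, Fin.sum_univ_two, h10, mul_zero, add_zero, zero_mul,
    zero_add] at h
  obtain ⟨h1, -, h2⟩ := h
  have h3 : (A 0 0 - A 1 1) * (A 0 0 + A 1 1) = 0 := by linear_combination h2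
  rcases mul_eq_zero.1 h3 with h4 | h4
  · exfalso
    have hdet := A.det_ne_zero
    rw [det_fin_two, h10, mul_zero, sub_zero] at hdet
    have h5 : A 0 1 * (2 * A 1 1) = 0 := by linear_combination h1 - A 0 1 * h4
    have h11 := right_ne_zero_of_mul hdet
    rw [mul_eq_zero, or_iff_left (by simpa using h11)] at h5
    obtain ⟨r, hr⟩ := hA'
    exact hr (GL_smul_eq_self_of_scalar h5 h10 (sub_eq_zero.1 h4) r)
  · linear_combination h4

/-- Commuting Möbius involutions with a common fixed point are equal. -/
theorem eq_of_involutions_GL {A B : GL (Fin 2) ℂ} {p : OnePoint ℂ} (hAp : A • p = p)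
    (hBp : B • p = p) (hA : ∀ r : OnePoint ℂ, A • A • r = r) (hB : ∀ r : OnePoint ℂ, B • B • r = r)
    (hA' : ∃ r : OnePoint ℂ, A • r ≠ r) (hB' : ∃ r : OnePoint ℂ, B • r ≠ r)
    (hAB : ∀ r : OnePoint ℂ, A • B • r = B • A • r) (r : OnePoint ℂ) : A • r = B • r := by
  -- Conjugation by `P` moves the common fixed point to `∞` and makes both matrices upper
  -- triangular.
  obtain ⟨P, hP⟩ : ∃ P : GL (Fin 2) ℂ, P • ∞ = p := by
    induction p using OnePoint.rec with
    | infty => exact ⟨1, one_smul _ _⟩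
    | coe k =>
      refine ⟨GeneralLinearGroup.mkOfDetNeZero !![k, 1; 1, 0] (by simp [det_fin_two]), ?_⟩
      rw [OnePoint.smul_infty_eq_ite]
      simp [GeneralLinearGroup.mkOfDetNeZero]
  have hconj : ∀ (M : GL (Fin 2) ℂ) (r : OnePoint ℂ), (P⁻¹ * M * P) • r = P⁻¹ • M • P • r :=
    fun M r => by rw [mul_smul, mul_smul]
  have hinv : ∀ M : GL (Fin 2) ℂ, M • p = p → (∀ r : OnePoint ℂ, M • M • r = r) →
      (∃ r : OnePoint ℂ, M • r ≠ r) →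
      (P⁻¹ * M * P) 1 0 = 0 ∧ (P⁻¹ * M * P) 0 0 = - (P⁻¹ * M * P) 1 1 := by
    intro M h1 h2 h3
    have h10 : (P⁻¹ * M * P) 1 0 = 0 := by
      rw [← OnePoint.smul_infty_eq_self_iff, hconj, hP, h1, ← hP, inv_smul_smul]
    refine ⟨h10, diag_of_involution_GL h10 (fun r => ?_) ?_⟩
    · rw [hconj, hconj, smul_inv_smul, h2, inv_smul_smul]
    · obtain ⟨r, hr⟩ := h3
      refine ⟨P⁻¹ • r, ?_⟩
      rw [hconj, smul_inv_smul]
      exact fun h => hr (smul_left_cancel _ h)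
  obtain ⟨hA1, hA2⟩ := hinv A hAp hA hA'
  obtain ⟨hB1, hB2⟩ := hinv B hBp hB hB'
  set A' := P⁻¹ * A * P
  set B' := P⁻¹ * B * P
  have h10 : (A' * B') 1 0 = 0 := by
    simp [Units.val_mul, mul_apply, Fin.sum_univ_two, hA1, hB1]
  have hdiag : (A' * B') 0 0 = (A' * B') 1 1 := by
    simp [Units.val_mul, mul_apply, Fin.sum_univ_two, hA1, hB1, hA2, hB2]
  have hsq : ∀ r : OnePoint ℂ, (A' * B') ^ 2 • r = r := fun r => by
    have hcA : ∀ r : OnePoint ℂ, A' • r = P⁻¹ • A • P • r := hconj A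
    have hcB : ∀ r : OnePoint ℂ, B' • r = P⁻¹ • B • P • r := hconj B
    rw [sq, mul_smul, mul_smul A' B', mul_smul A' B', hcA, hcB, hcA, hcB]
    simp only [smul_inv_smul]
    rw [hAB (P • r), hB, hA, inv_smul_smul]
  -- The product has equal diagonal entries, so it is trivial or parabolic. Its square acts
  -- trivially, which gives a nontrivial product two fixed points, whereas a parabolic one has a
  -- single fixed point.
  have htriv : ∀ r : OnePoint ℂ, (A' * B') • r = r := by
    by_contra! hne
    obtain ⟨p', q', hpq, hfix⟩ := exists_two_fixedPoints_GL hne two_ne_zero hsq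
    have hpar : (A' * B').IsParabolic :=
      (GeneralLinearGroup.isParabolic_iff_of_upperTriangular h10).2 ⟨hdiag, fun h01 => by
        obtain ⟨r, hr⟩ := hne
        exact hr (GL_smul_eq_self_of_scalar h01 h10 hdiag r)⟩
    have h1 := hpar.smul_eq_self_iff.1 ((hfix p').2 (Or.inl rfl))
    have h2 := hpar.smul_eq_self_iff.1 ((hfix q').2 (Or.inr rfl))
    exact hpq (h1.trans h2.symm)
  have h := htriv (P⁻¹ • B • r)
  rw [mul_smul, hconj, hconj] at h
  simp only [smul_inv_smul] at h
  rw [hB] at h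
  exact smul_left_cancel _ h

end Mobius

/-! ### Möbius transforms of a function and generators of `ℂ(x)`. -/

section MobiusAutomorphisms

variable {K : Type*} [Field K] [Algebra ℂ K]

/-- The Möbius transform of a function. -/
noncomputable def mobius (M : GL (Fin 2) ℂ) (x : K) : K :=
  (algebraMap ℂ K (M 0 0) * x + algebraMap ℂ K (M 0 1)) /
    (algebraMap ℂ K (M 1 0) * x + algebraMap ℂ K (M 1 1))

theorem linear_ne_zero {x : K} (hx : Transcendental ℂ x) {c d : ℂ} (h : c ≠ 0 ∨ d ≠ 0) :
    algebraMap ℂ K c * x + algebraMap ℂ K d ≠ 0 := by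
  intro h0
  refine hx ⟨C c * X + C d, fun h1 => ?_, by simpa using h0⟩
  have h2 := congrArg (coeff · 0) h1
  have h3 := congrArg (coeff · 1) h1
  simp at h2 h3
  simp [h2, h3] at h

theorem GL_row_ne_zero (M : GL (Fin 2) ℂ) : M 1 0 ≠ 0 ∨ M 1 1 ≠ 0 := by
  by_contra! h
  have hdet := M.det_ne_zero
  rw [Matrix.det_fin_two, h.1, h.2] at hdet
  simp at hdet

theorem denom_mobius_ne_zero {x : K} (hx : Transcendental ℂ x) (M : GL (Fin 2) ℂ) :
    algebraMap ℂ K (M 1 0) * x + algebraMap ℂ K (M 1 1) ≠ 0 :=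
  linear_ne_zero hx (GL_row_ne_zero M)

theorem valuation_algebraMap_le_one {V : ValuationSubring K} (hV : IsPlace V) (c : ℂ) :
    V.valuation (algebraMap ℂ K c) ≤ 1 := (V.valuation_le_one_iff _).2 (hV.1 c)

theorem valuation_linear_at {x : K} {V : ValuationSubring K} (hV : IsPlace V) {k : ℂ}
    (hk : V.valuation (x - algebraMap ℂ K k) < 1) (c d : ℂ) :
    (c * k + d = 0 → V.valuation (algebraMap ℂ K c * x + algebraMap ℂ K d) < 1) ∧
    (c * k + d ≠ 0 → V.valuation (algebraMap ℂ K c * x + algebraMap ℂ K d) = 1) := by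
  have h1 : algebraMap ℂ K c * x + algebraMap ℂ K d =
      algebraMap ℂ K c * (x - algebraMap ℂ K k) + algebraMap ℂ K (c * k + d) := by
    rw [map_add, map_mul]; ring
  have h2 : V.valuation (algebraMap ℂ K c * (x - algebraMap ℂ K k)) < 1 := by
    rw [map_mul]
    exact lt_of_le_of_lt (mul_le_of_le_one_left zero_le (valuation_algebraMap_le_one hV c)) hk
  rw [h1]
  constructor
  · intro h; rw [h, map_zero, add_zero]; exact h2
  · intro h
    have h3 := valuation_algebraMap_eq_one hV.1 h
    rw [Valuation.map_add_eq_of_lt_right _ (by rwa [h3]), h3]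

theorem valuation_linear_infty {x : K} {V : ValuationSubring K} (hV : IsPlace V)
    (hx : 1 < V.valuation x) {c : ℂ} (hc : c ≠ 0) (d : ℂ) :
    V.valuation (algebraMap ℂ K c * x + algebraMap ℂ K d) = V.valuation x := by
  have h1 : V.valuation (algebraMap ℂ K c * x) = V.valuation x := by
    rw [map_mul, valuation_algebraMap_eq_one hV.1 hc, one_mul]
  rw [Valuation.map_add_eq_of_lt_left, h1]
  rw [h1]
  exact lt_of_le_of_lt (valuation_algebraMap_le_one hV d) hx

theorem pointAt_eq_infty_of_one_lt {x : K} {V : ValuationSubring K} (hV : IsPlace V)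
    (hx : 1 < V.valuation x) : pointAt x V = ∞ := by
  by_contra h
  obtain ⟨a, ha⟩ := OnePoint.ne_infty_iff_exists.1 h
  have h1 := (pointAt_eq_coe_iff hV).1 ha.symm
  rw [Valuation.map_sub_eq_of_lt_left _
    (lt_of_le_of_lt (valuation_algebraMap_le_one hV a) hx)] at h1
  exact lt_asymm hx h1

/-- This turns a substitution in the field into the action of `GL₂(ℂ)` on `ℙ¹`. Subtracting the
expected finite value leaves a constant multiple of `x - k`, or a constant if `x` has a pole, over
the denominator. -/
theorem pointAt_mobius {x : K} (hx : Transcendental ℂ x) [Algebra.IsAlgebraic (xLine x) K]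
    {V : ValuationSubring K} (hV : IsPlace V) (M : GL (Fin 2) ℂ) :
    pointAt (mobius M x) V = M • pointAt x V := by
  have hden := denom_mobius_ne_zero hx M
  have hdet := M.det_ne_zero
  rw [Matrix.det_fin_two] at hdet
  induction hp : pointAt x V using OnePoint.rec with
  | infty =>
    have hx1 := (pointAt_eq_infty_iff hV).1 hp
    rw [OnePoint.smul_infty_eq_ite]
    split_ifs with hc
    · apply pointAt_eq_infty_of_one_lt hV
      rw [hc, mul_zero, sub_zero] at hdet
      rw [mobius, hc, map_div₀, valuation_linear_infty hV hx1 (left_ne_zero_of_mul hdet), map_zero,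
        zero_mul, zero_add, valuation_algebraMap_eq_one hV.1 (right_ne_zero_of_mul hdet), div_one]
      exact hx1
    · rw [pointAt_eq_coe_iff hV]
      have hc' : algebraMap ℂ K (M 1 0) ≠ 0 := by simpa using hc
      have h1 : mobius M x - algebraMap ℂ K (M 0 0 / M 1 0) =
          algebraMap ℂ K ((M 0 1 * M 1 0 - M 0 0 * M 1 1) / M 1 0) /
            (algebraMap ℂ K (M 1 0) * x + algebraMap ℂ K (M 1 1)) := by
        rw [mobius, div_sub' hden]
        congr 1
        simp only [map_div₀, map_sub, map_mul]
        field_simp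
        ring
      rw [h1, map_div₀, valuation_linear_infty hV hx1 hc,
        div_lt_one₀ (zero_lt_one.trans hx1)]
      exact lt_of_le_of_lt (valuation_algebraMap_le_one hV _) hx1
  | coe k =>
    have hk := (pointAt_eq_coe_iff hV).1 hp
    rw [OnePoint.smul_some_eq_ite]
    split_ifs with hc
    · apply pointAt_eq_infty_of_one_lt hV
      have hn : M 0 0 * k + M 0 1 ≠ 0 := by
        intro hn
        rcases GL_row_ne_zero M with h | h
        · apply hdet
          have : M 1 0 * (M 0 0 * M 1 1 - M 0 1 * M 1 0) = 0 := by
            linear_combination (M 0 0 * M 1 0) * hc - M 1 0 ^ 2 * hn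
          exact (mul_eq_zero.1 this).resolve_left h
        · apply hdet
          have : M 1 1 * (M 0 0 * M 1 1 - M 0 1 * M 1 0) = 0 := by
            linear_combination (M 0 0 * M 1 1 - M 0 1 * M 1 0) * hc -
              k * M 1 0 * (M 0 0 * hc - M 1 0 * hn)
          exact (mul_eq_zero.1 this).resolve_left h
      have h1 := (valuation_linear_at hV hk (M 1 0) (M 1 1)).1 hc
      rw [mobius, map_div₀, (valuation_linear_at hV hk _ _).2 hn]
      exact (one_lt_div₀ (zero_lt_iff.2 (by simpa using hden))).2 h1
    · rw [pointAt_eq_coe_iff hV]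
      have h2 := (valuation_linear_at hV hk (M 1 0) (M 1 1)).2 hc
      have hc' : algebraMap ℂ K (M 1 0 * k + M 1 1) ≠ 0 :=
        (map_ne_zero (algebraMap ℂ K)).2 hc
      rw [map_add, map_mul] at hc'
      have h1 : mobius M x - algebraMap ℂ K ((M 0 0 * k + M 0 1) / (M 1 0 * k + M 1 1)) =
          algebraMap ℂ K ((M 0 0 * M 1 1 - M 0 1 * M 1 0) / (M 1 0 * k + M 1 1)) *
            (x - algebraMap ℂ K k) /
            (algebraMap ℂ K (M 1 0) * x + algebraMap ℂ K (M 1 1)) := by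
        rw [mobius, div_sub' hden]
        congr 1
        simp only [map_div₀, map_add, map_mul, map_sub]
        field_simp
        ring
      rw [h1, map_div₀, h2, div_one, map_mul]
      exact lt_of_le_of_lt (mul_le_of_le_one_left zero_le (valuation_algebraMap_le_one hV _)) hk

theorem mobius_mem_xLine (M : GL (Fin 2) ℂ) (x : K) : mobius M x ∈ xLine x :=
  div_mem (add_mem (mul_mem (IntermediateField.algebraMap_mem _ _) self_mem_xLine)
    (IntermediateField.algebraMap_mem _ _)) (add_mem (mul_mem
    (IntermediateField.algebraMap_mem _ _) self_mem_xLine) (IntermediateField.algebraMap_mem _ _))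

/-- A generator of `ℂ(x)` is a Möbius transform of `x`. -/
theorem exists_eq_mobius {x u : K} (hx : Transcendental ℂ x) (hu : u ∈ xLine x)
    (hxu : x ∈ xLine u) : ∃ M : GL (Fin 2) ℂ, u = mobius M x := by
  let e := RatFunc.algEquivOfTranscendental x hx
  set F : RatFunc ℂ := e.symm ⟨u, hu⟩ with hF
  have heF : (e F : K) = u := by rw [hF, AlgEquiv.apply_symm_apply]
  have htop : IntermediateField.adjoin ℂ {F} = ⊤ := by
    rw [← top_le_iff, ← RatFunc.adjoin_X, IntermediateField.adjoin_simple_le_iff]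
    obtain ⟨P, Q, hPQ⟩ := mem_xLine_iff.1 hxu
    rw [IntermediateField.mem_adjoin_simple_iff]
    refine ⟨P, Q, ?_⟩
    apply e.injective
    apply Subtype.ext
    have h1 : ∀ P : ℂ[X], ((e (aeval F P) : xLine x) : K) = aeval u P := by
      intro P
      rw [← heF]
      exact (aeval_algHom_apply ((xLine x).val.comp e.toAlgHom) F P).symm
    rw [map_div₀]
    push_cast
    rw [h1, h1, ← hPQ]
    exact RatFunc.algEquivOfTranscendental_X x hx
  -- The degree of `ℂ(X)` over `ℂ(F)` is the larger of the degrees of numerator and denominator;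
  -- here it is one.
  have hdeg := RatFunc.finrank_eq_max_natDegree F
  rw [htop, IntermediateField.finrank_top] at hdeg
  have h1 : F.num.natDegree ≤ 1 := by rw [hdeg]; exact le_max_left _ _
  have h2 : F.denom.natDegree ≤ 1 := by rw [hdeg]; exact le_max_right _ _
  obtain ⟨a, b, hab⟩ := exists_eq_X_add_C_of_natDegree_le_one h1
  obtain ⟨c, d, hcd⟩ := exists_eq_X_add_C_of_natDegree_le_one h2
  have hue : u = (algebraMap ℂ K a * x + algebraMap ℂ K b) /
      (algebraMap ℂ K c * x + algebraMap ℂ K d) := by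
    rw [← heF, RatFunc.algEquivOfTranscendental_apply, hab, hcd]
    simp
  -- With zero determinant `u` would be constant, and then `x ∈ ℂ(u)` would be algebraic.
  have hdet : a * d - b * c ≠ 0 := by
    intro h0
    have hnd : c ≠ 0 ∨ d ≠ 0 := by
      by_contra! h
      exact F.denom_ne_zero (by rw [hcd, h.1, h.2]; simp)
    have hden := linear_ne_zero hx hnd
    have hconst : ∃ k : ℂ, u = algebraMap ℂ K k := by
      by_cases hc : c = 0
      · have hd : d ≠ 0 := by simpa [hc] using hnd
        have ha : a = 0 := by simpa [hc, hd] using h0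
        exact ⟨b / d, by rw [hue, ha, hc]; simp⟩
      · refine ⟨a / c, ?_⟩
        have hc' : algebraMap ℂ K c ≠ 0 := by simpa using hc
        have h0' := congrArg (algebraMap ℂ K) h0
        rw [map_sub, map_mul, map_mul, map_zero] at h0'
        rw [hue, map_div₀, div_eq_div_iff hden hc']
        linear_combination -h0'
    obtain ⟨k, rfl⟩ := hconst
    refine hx ?_
    obtain ⟨A, B, hAB⟩ := mem_xLine_iff.1 hxu
    rw [hAB, aeval_algebraMap_apply, aeval_algebraMap_apply, ← map_div₀]
    exact isAlgebraic_algebraMap _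
  refine ⟨Matrix.GeneralLinearGroup.mkOfDetNeZero !![a, b; c, d]
    (by rwa [Matrix.det_fin_two_of]), ?_⟩
  simpa [mobius, Matrix.GeneralLinearGroup.mkOfDetNeZero] using hue

end MobiusAutomorphisms

/-! ### The action of the reduced group on `ℙ¹`. -/

section PointAction

variable {K : Type*} [Field K] [Algebra ℂ K] {n : ℕ} {f : ℂ[X]} {x y : K}

theorem smul_valuation_eq_iff (σ : K ≃ₐ[ℂ] K) (V : ValuationSubring K) {a b : K} (hb : b ≠ 0) :
    (σ • V).valuation a = (σ • V).valuation b ↔ V.valuation (σ⁻¹ a) = V.valuation (σ⁻¹ b) := by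
  have h := smul_valuation_eq_one_iff σ V (a / b)
  rw [map_div₀, map_div₀, map_div₀, div_eq_one_iff_eq (by simpa using hb),
    div_eq_one_iff_eq (by simpa using hb)] at h
  exact h

theorem algEquiv_mem_xLine {σ : K ≃ₐ[ℂ] K} (hσ : σ x ∈ xLine x) {g : K} (hg : g ∈ xLine x) :
    σ g ∈ xLine x := by
  obtain ⟨A, B, rfl⟩ := mem_xLine_iff.1 hg
  have h : ∀ A : ℂ[X], σ (aeval x A) ∈ xLine x := fun A => by
    rw [← aeval_algHom_apply]
    have h2 := aeval_algHom_apply (xLine x).val ⟨σ x, hσ⟩ A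
    exact h2 ▸ (aeval (⟨σ x, hσ⟩ : xLine x) A).2
  rw [map_div₀]
  exact div_mem (h A) (h B)

namespace IsSeparableCurve

variable (hc : IsSeparableCurve n f x y)
include hc

theorem transcendental_algEquiv (σ : K ≃ₐ[ℂ] K) : Transcendental ℂ (σ x) := fun h =>
  hc.transcendental (by simpa [algEquiv_inv_apply_self] using h.algHom (σ⁻¹ : K ≃ₐ[ℂ] K).toAlgHom)

theorem exists_mobius_of_mem_levelNormalizer {σ : K ≃ₐ[ℂ] K} (hσ : σ ∈ levelNormalizer n x y) :
    ∃ M : GL (Fin 2) ℂ, σ x = mobius M x := by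
  obtain ⟨h1, h2⟩ := hc.mem_levelNormalizer_iff.1 hσ
  refine exists_eq_mobius hc.transcendental h1 ?_
  obtain ⟨A, B, hAB⟩ := mem_xLine_iff.1 h2
  refine mem_xLine_iff.2 ⟨A, B, ?_⟩
  have h3 := congrArg σ hAB
  rw [algEquiv_apply_inv_self, map_div₀, ← aeval_algHom_apply, ← aeval_algHom_apply] at h3
  exact h3

theorem mem_levelNormalizer_of_mobius {σ : K ≃ₐ[ℂ] K} {M : GL (Fin 2) ℂ}
    (h : σ x = mobius M x) : σ ∈ levelNormalizer n x y := by
  refine hc.mem_levelNormalizer_iff.2 ⟨h ▸ mobius_mem_xLine M x, ?_⟩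
  have h1 := congrArg (σ⁻¹ : K ≃ₐ[ℂ] K) h
  rw [algEquiv_inv_apply_self] at h1
  have hz := hc.transcendental_algEquiv σ⁻¹
  set z := σ⁻¹ x
  have h2 : x = mobius M z := by simpa [mobius, z] using h1
  have hden := denom_mobius_ne_zero hz M
  rw [mobius, eq_div_iff hden] at h2
  have hdet := M.det_ne_zero
  rw [Matrix.det_fin_two] at hdet
  have hden' : algebraMap ℂ K (-M 1 0) * x + algebraMap ℂ K (M 0 0) ≠ 0 :=
    linear_ne_zero hc.transcendental (by
      by_contra! h
      apply hdet
      rw [h.2, neg_eq_zero.1 h.1]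
      ring)
  have h3 : z = (algebraMap ℂ K (M 1 1) * x - algebraMap ℂ K (M 0 1)) /
      (algebraMap ℂ K (-M 1 0) * x + algebraMap ℂ K (M 0 0)) := by
    rw [eq_div_iff hden', map_neg]
    linear_combination -h2
  rw [h3]
  exact div_mem (sub_mem (mul_mem (IntermediateField.algebraMap_mem _ _) self_mem_xLine)
    (IntermediateField.algebraMap_mem _ _)) (add_mem (mul_mem
    (IntermediateField.algebraMap_mem _ _) self_mem_xLine) (IntermediateField.algebraMap_mem _ _))

theorem exists_GL_pointAt_smul (σ : levelNormalizer n x y) : ∃ M : GL (Fin 2) ℂ,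
    ∀ V : ValuationSubring K, IsPlace V → pointAt x ((σ : K ≃ₐ[ℂ] K) • V) = M • pointAt x V := by
  have := hc.isAlgebraic_xLine
  obtain ⟨M, hM⟩ := hc.exists_mobius_of_mem_levelNormalizer (inv_mem σ.2)
  exact ⟨M, fun V hV => by rw [pointAt_smul, hM, pointAt_mobius hc.transcendental hV]⟩

theorem exists_pointAt_eq (p : OnePoint ℂ) :
    ∃ V : ValuationSubring K, IsPlace V ∧ pointAt x V = p :=
  have := hc.isAlgebraic_xLine
  exists_place_pointAt_eq hc.transcendental p

/-- The action of the normalizer of the level group on the projective line. -/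
noncomputable def pointAction : levelNormalizer n x y →* Equiv.Perm (OnePoint ℂ) :=
  -- The chosen matrices need not multiply compatibly; multiplicativity of the permutations is
  -- checked on values at places, which exhaust `ℙ¹`.
  MonoidHom.mk' (fun σ => MulAction.toPerm (hc.exists_GL_pointAt_smul σ).choose) fun σ τ => by
    ext p
    obtain ⟨V, hV, rfl⟩ := hc.exists_pointAt_eq p
    simp only [MulAction.toPerm_apply, Equiv.Perm.mul_apply]
    rw [← (hc.exists_GL_pointAt_smul (σ * τ)).choose_spec V hV,
      ← (hc.exists_GL_pointAt_smul τ).choose_spec V hV,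
      ← (hc.exists_GL_pointAt_smul σ).choose_spec _ (hV.smul _), Subgroup.coe_mul, mul_smul]

theorem pointAction_pointAt (σ : levelNormalizer n x y) {V : ValuationSubring K} (hV : IsPlace V) :
    hc.pointAction σ (pointAt x V) = pointAt x ((σ : K ≃ₐ[ℂ] K) • V) :=
  ((hc.exists_GL_pointAt_smul σ).choose_spec V hV).symm

theorem pointAction_eq_smul (σ : levelNormalizer n x y) :
    ∃ M : GL (Fin 2) ℂ, ∀ p, hc.pointAction σ p = M • p :=
  ⟨_, fun _ => rfl⟩

/-- The inverse appears because the value of `x` at `σ⁻¹ • V` is the value of `σ x` at `V`. -/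
theorem pointAction_of_mobius {σ : levelNormalizer n x y} {M : GL (Fin 2) ℂ}
    (h : (σ : K ≃ₐ[ℂ] K) x = mobius M x) (p : OnePoint ℂ) :
    hc.pointAction σ⁻¹ p = M • p := by
  have := hc.isAlgebraic_xLine
  obtain ⟨V, hV, rfl⟩ := hc.exists_pointAt_eq p
  rw [hc.pointAction_pointAt _ hV, pointAt_smul, InvMemClass.coe_inv, inv_inv, h,
    pointAt_mobius hc.transcendental hV]

theorem pointAction_eq_one_iff {σ : levelNormalizer n x y} :
    hc.pointAction σ = 1 ↔ (σ : K ≃ₐ[ℂ] K) ∈ levelGroup n x y := by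
  constructor
  · intro h
    rw [← inv_mem_iff, hc.mem_levelGroup_iff]
    obtain ⟨M, hM⟩ := hc.exists_mobius_of_mem_levelNormalizer (inv_mem σ.2)
    obtain ⟨h1, h2, h3⟩ := scalar_of_forall_GL_smul_eq_self (M := M) fun p => by
      rw [← hc.pointAction_of_mobius (σ := σ⁻¹) hM p, inv_inv, h, Equiv.Perm.one_apply]
    have h4 := denom_mobius_ne_zero hc.transcendental M
    rw [hM, mobius, h1, h2, h3]
    rw [h2, map_zero, zero_mul, zero_add] at h4
    simp only [map_zero, zero_mul, zero_add, add_zero]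
    exact mul_div_cancel_left₀ x h4
  · intro h
    ext p
    obtain ⟨V, hV, rfl⟩ := hc.exists_pointAt_eq p
    rw [hc.pointAction_pointAt _ hV, pointAt_smul,
      hc.mem_levelGroup_iff.1 (inv_mem h), Equiv.Perm.one_apply]

theorem ker_pointAction :
    hc.pointAction.ker = (levelGroup n x y).subgroupOf (levelNormalizer n x y) := by
  ext σ
  rw [MonoidHom.mem_ker, hc.pointAction_eq_one_iff, Subgroup.mem_subgroupOf]

/-- The reduced group is a group of permutations of the projective line. -/
noncomputable def reducedGroupEquiv : ReducedGroup n x y ≃* hc.pointAction.range :=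
  (QuotientGroup.quotientMulEquivOfEq hc.ker_pointAction.symm).trans
    (QuotientGroup.quotientKerEquivRange hc.pointAction)

/-- An element of the normalizer acts on the orders of `f` modulo `n` through a multiplier. -/
theorem exists_multiplier (σ : levelNormalizer n x y) :
    ∃ i : ℤ, ∀ p, (n : ℤ) ∣ ordAt p f - i * ordAt (hc.pointAction σ p) f := by
  have := hc.isAlgebraic_xLine
  obtain ⟨h1, h2⟩ := hc.mem_levelNormalizer_iff.1 σ.2
  obtain ⟨τ, hτ1, hτ2⟩ := hc.exists_levelGenerator
  have hτ : τ ∈ levelGroup n x y := hc.mem_levelGroup_iff.2 hτ1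
  have hconj : (σ : K ≃ₐ[ℂ] K)⁻¹ * τ * σ ∈ levelGroup n x y := by
    have := (Subgroup.mem_normalizer_iff.1 σ.2 ((σ : K ≃ₐ[ℂ] K)⁻¹ * τ * σ)).2
    exact this (by simpa only [mul_assoc, mul_inv_cancel_left, mul_inv_cancel, mul_one] using hτ)
  obtain ⟨i, hi⟩ := hc.exists_apply_y (hc.mem_levelGroup_iff.1 hconj)
  set ζ := Complex.exp (2 * Real.pi * Complex.I / n)
  have hi' : τ ((σ : K ≃ₐ[ℂ] K) y) = algebraMap ℂ K (ζ ^ i) * (σ : K ≃ₐ[ℂ] K) y := by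
    have h3 := congrArg (σ : K ≃ₐ[ℂ] K) hi
    rwa [AlgEquiv.mul_apply, AlgEquiv.mul_apply, algEquiv_apply_inv_self, map_mul,
      AlgEquiv.commutes] at h3
  have hy := hc.y_ne_zero
  have hζ : algebraMap ℂ K (ζ ^ i) ≠ 0 := by simp [ζ, Complex.exp_ne_zero]
  -- Both `σ y` and `y ^ i` are eigenvectors of the generator `τ` with the same eigenvalue, so their
  -- quotient lies in `ℂ(x)` and `σ (f x) = g ^ n * (f x) ^ i`. Comparing orders on both sides gives
  -- the congruence.
  set g : K := (σ : K ≃ₐ[ℂ] K) y / y ^ i with hg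
  have hτg : τ g = g := by
    rw [hg, map_div₀, hi', map_pow τ, hτ2, mul_pow, ← map_pow (algebraMap ℂ K)]
    exact mul_div_mul_left _ _ hζ
  have hgx : g ∈ xLine x := by
    rw [hc.mem_xLine_iff_levelGroup, hc.levelGroup_eq_zpowers hτ1 hτ2]
    have hle : Subgroup.zpowers τ ≤ MulAction.stabilizer (K ≃ₐ[ℂ] K) g :=
      (Subgroup.zpowers_le).2 hτg
    exact fun ρ hρ => hle hρ
  have hg0 : g ≠ 0 := by
    rw [hg]
    exact div_ne_zero (by simpa using hy) (pow_ne_zero _ hy)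
  have hfσ : aeval ((σ : K ≃ₐ[ℂ] K) x) f = g ^ n * aeval x f ^ i := by
    have h3 : aeval ((σ : K ≃ₐ[ℂ] K) x) f = (σ : K ≃ₐ[ℂ] K) (aeval x f) :=
      aeval_algHom_apply (σ : K ≃ₐ[ℂ] K).toAlgHom x f
    rw [h3, ← hc.equation, map_pow, ← pow_mul, mul_comm n i, pow_mul, ← mul_pow, hg,
      div_mul_cancel₀ _ (pow_ne_zero _ hy)]
  refine ⟨i, fun q => ?_⟩
  obtain ⟨W, hW, rfl⟩ := hc.exists_pointAt_eq q
  rw [hc.pointAction_pointAt _ hW]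
  have hV := hW.smul (σ : K ≃ₐ[ℂ] K)
  set V := (σ : K ≃ₐ[ℂ] K) • W with hVdef
  have hne : ∀ (U : ValuationSubring K) (p : OnePoint ℂ), U.valuation (uniformizerAt p x) ≠ 0 :=
    valuation_uniformizerAt_ne_zero hc.transcendental
  have hltV := valuation_uniformizerAt_lt_one (x := x) hV
  have hltW := valuation_uniformizerAt_lt_one (x := x) hW
  set tp := uniformizerAt (pointAt x V) x
  set tq := uniformizerAt (pointAt x W) x
  have htp0 : tp ≠ 0 := uniformizerAt_ne_zero _ hc.transcendental
  have htq0 : tq ≠ 0 := uniformizerAt_ne_zero _ hc.transcendental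
  have hinj : Function.Injective fun k : ℤ => V.valuation tp ^ k :=
    zpow_right_injective₀ (zero_lt_iff.2 (hne _ _)) hltV.ne
  have transport : ∀ {a b : K}, b ≠ 0 → W.valuation a = W.valuation b →
      V.valuation ((σ : K ≃ₐ[ℂ] K) a) = V.valuation ((σ : K ≃ₐ[ℂ] K) b) := by
    intro a b hb hab
    rw [hVdef, smul_valuation_eq_iff _ _ (by simpa using hb), algEquiv_inv_apply_self,
      algEquiv_inv_apply_self]
    exact hab
  -- The exponents `j` and `j'` of the transported uniformizers under `σ` and `σ⁻¹` satisfy `j * j'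
  -- = 1`, and `0 ≤ j`. Hence `j = 1` and `σ` preserves orders on `ℂ(x)`.
  obtain ⟨j, hj⟩ := exists_ord hc.transcendental (pointAt x V)
    (algEquiv_mem_xLine h1 (uniformizerAt_mem_xLine (pointAt x W) x)) (by simpa using htq0)
  have hj := hj V hV rfl
  obtain ⟨j', hj'⟩ := exists_ord hc.transcendental (pointAt x W)
    (algEquiv_mem_xLine h2 (uniformizerAt_mem_xLine (pointAt x V) x)) (by simpa using htp0)
  have hj' := hj' W hW rfl
  have hj0 : 0 ≤ j := by
    have h3 : V.valuation ((σ : K ≃ₐ[ℂ] K) tq) ≤ 1 := by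
      rw [hVdef, smul_valuation_le_one_iff, algEquiv_inv_apply_self]; exact hltW.le
    rw [hj] at h3
    exact (zpow_le_one_iff_right_of_lt_one₀ (zero_lt_iff.2 (hne _ _)) hltV).1 h3
  have hjj : j * j' = 1 := by
    have h3 := transport (zpow_ne_zero j' htq0) (hj'.trans (map_zpow₀ W.valuation tq j').symm)
    rw [algEquiv_apply_inv_self, map_zpow₀, map_zpow₀, hj, ← zpow_mul] at h3
    exact (hinj (by simpa using h3)).symm
  have hj1 : j = 1 := Int.eq_one_of_mul_eq_one_right hj0 hjj
  have hf0 := hc.separable.ne_zero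
  have h3 := valuation_aeval (x := x) hW hf0
  have h4 := transport (zpow_ne_zero _ htq0) (h3.trans (map_zpow₀ W.valuation tq _).symm)
  have h5 : (σ : K ≃ₐ[ℂ] K) (aeval x f) = aeval ((σ : K ≃ₐ[ℂ] K) x) f :=
      (aeval_algHom_apply (σ : K ≃ₐ[ℂ] K).toAlgHom x f).symm
  obtain ⟨k, hk⟩ := exists_ord hc.transcendental (pointAt x V) hgx hg0
  have hk := hk V hV rfl
  rw [h5, hfσ, map_zpow₀, map_zpow₀, hj, hj1, zpow_one, map_mul, map_pow, map_pow, hk,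
    valuation_aeval hV hf0, ← zpow_natCast, ← zpow_natCast, ← zpow_mul, ← zpow_mul,
    ← zpow_add₀ (hne _ _)] at h4
  have h6 := hinj h4
  exact ⟨k, by linarith⟩

end IsSeparableCurve

end PointAction

/-! ### Fibres over a fixed field as orbits of places. -/

section Fibres

variable {K : Type*} [Field K] [Algebra ℂ K]

/-- A valuation ring of `K` is chosen that contains `P` and has the maximal ideal of `P` among its
nonunits; the second condition prevents its contraction from exceeding `P`. -/
theorem exists_comap_eq {E : IntermediateField ℂ K} {P : ValuationSubring E} (hP : IsPlace P) :
    ∃ V : ValuationSubring K, IsPlace V ∧ V.comap (algebraMap E K) = P := by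
  let φ : P →+* K := (algebraMap E K).comp P.subtype
  have hφ : Function.Injective φ :=
    (algebraMap E K).injective.comp (fun a b h => Subtype.ext h)
  obtain ⟨V, hV1, hV2⟩ := Ideal.image_subset_nonunits_valuationSubring (A := φ.range)
    ((IsLocalRing.maximalIdeal P).map φ.rangeRestrict) (by
      have h := Ideal.map_isPrime_of_equiv (I := IsLocalRing.maximalIdeal P)
        (RingEquiv.ofBijective φ.rangeRestrict
          ⟨fun a b h => by
            have h2 := congrArg Subtype.val h
            exact hφ h2, φ.rangeRestrict_surjective⟩)
      exact h.ne_top)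
  have hle : ∀ e ∈ P, algebraMap E K e ∈ V := fun e he => hV1 ⟨⟨e, he⟩, rfl⟩
  have hnot : ∀ e ∉ P, algebraMap E K e ∉ V := by
    intro e he heV
    have he0 : e ≠ 0 := by rintro rfl; exact he (zero_mem _)
    have h1 : P.valuation e⁻¹ < 1 := by
      rw [map_inv₀]
      exact inv_lt_one_of_one_lt₀ (not_le.1 fun h => he ((P.valuation_le_one_iff e).1 h))
    have h2 : e⁻¹ ∈ P := (P.valuation_le_one_iff _).1 h1.le
    have h3 : (⟨e⁻¹, h2⟩ : P) ∈ IsLocalRing.maximalIdeal P :=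
      (P.valuation_lt_one_iff ⟨e⁻¹, h2⟩).2 h1
    have h4 : V.valuation (algebraMap E K e⁻¹) < 1 :=
      hV2 ⟨φ.rangeRestrict ⟨e⁻¹, h2⟩, Ideal.mem_map_of_mem _ h3, rfl⟩
    rw [valuation_lt_one_iff_inv _ (by simpa using he0), ← map_inv₀, inv_inv,
      ValuationSubring.valuation_le_one_iff] at h4
    exact h4 heV
  have hcomap : V.comap (algebraMap E K) = P := by
    ext e
    exact ⟨fun h => by_contra fun h2 => hnot e h2 h, hle e⟩
  refine ⟨V, ⟨fun c => hle _ (hP.1 c), fun h => hP.2 ?_⟩, hcomap⟩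
  rw [← hcomap, h]
  rfl

theorem isPlace_comap {E : IntermediateField ℂ K} [Algebra.IsAlgebraic E K]
    {V : ValuationSubring K} (hV : IsPlace V) : IsPlace (V.comap (algebraMap E K)) := by
  refine ⟨fun c => hV.1 c, fun h => hV.2 (eq_top_of_isAlgebraic (E := E) fun z hz => ?_)⟩
  have : (⟨z, hz⟩ : E) ∈ V.comap (algebraMap E K) := by rw [h]; trivial
  exact this

variable (G : Subgroup (K ≃ₐ[ℂ] K)) [Finite G]

theorem comap_eq_iff {V W : ValuationSubring K} (hV : IsPlace V) (hW : IsPlace W) :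
    V.comap (algebraMap (IntermediateField.fixedField G) K) =
      W.comap (algebraMap (IntermediateField.fixedField G) K) ↔ W ∈ MulAction.orbit G V := by
  constructor
  · intro h
    obtain ⟨σ, hσ, rfl⟩ := exists_smul_eq_of_mem_iff G hV hW fun z hz =>
      SetLike.ext_iff.1 h ⟨z, hz⟩
    exact ⟨⟨σ, hσ⟩, rfl⟩
  · rintro ⟨σ, rfl⟩
    ext ⟨z, hz⟩
    simp only [ValuationSubring.mem_comap]
    change z ∈ V ↔ z ∈ (σ : K ≃ₐ[ℂ] K) • V
    rw [ValuationSubring.mem_pointwise_smul_iff_inv_smul_mem, AlgEquiv.smul_def,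
      (IntermediateField.mem_fixedField_iff _ _).1 hz _ (inv_mem σ.2)]

theorem fibre_comap {V : ValuationSubring K} (hV : IsPlace V) :
    fibre (IntermediateField.fixedField G)
      (V.comap (algebraMap (IntermediateField.fixedField G) K)) = MulAction.orbit G V := by
  ext W
  constructor
  · rintro ⟨hW, h⟩
    exact (comap_eq_iff G hV hW).1 h.symm
  · rintro ⟨σ, rfl⟩
    have hW : IsPlace (σ • V) := hV.smul (σ : K ≃ₐ[ℂ] K)
    exact ⟨hW, ((comap_eq_iff G hV hW).2 ⟨σ, rfl⟩).symm⟩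

theorem encard_orbit_lt_iff {A : Type*} {α : Type*} [Group A] [Finite A] [MulAction A α] (a : α) :
    (MulAction.orbit A a).encard < (Nat.card A : ℕ∞) ↔ MulAction.stabilizer A a ≠ ⊥ := by
  have h1 := Subgroup.card_eq_card_quotient_mul_card_subgroup (MulAction.stabilizer A a)
  rw [Nat.card_congr (MulAction.orbitEquivQuotientStabilizer A a).symm] at h1
  have hfin : (MulAction.orbit A a).Finite := Set.finite_range _
  rw [← hfin.cast_ncard_eq, Nat.cast_lt, h1, ← Nat.card_coe_set_eq, Ne,
    ← Subgroup.card_eq_one]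
  have h2 : 0 < Nat.card (MulAction.orbit A a) :=
    Nat.pos_of_ne_zero fun h => by
      rw [h, zero_mul] at h1; exact Nat.card_pos.ne' h1
  have h3 : 0 < Nat.card (MulAction.stabilizer A a) := Nat.card_pos
  constructor
  · intro h h4; rw [h4, mul_one] at h; exact lt_irrefl _ h
  · intro h; nlinarith [show 2 ≤ Nat.card (MulAction.stabilizer A a) by omega]

/-- Fibres are orbits and the degree is the group order, so a fibre is too small exactly when its
points have nontrivial stabilizers. -/
theorem branchPoints_fixedField :
    branchPoints (IntermediateField.fixedField G) =
      (fun V => V.comap (algebraMap (IntermediateField.fixedField G) K)) ''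
        {V | IsPlace V ∧ MulAction.stabilizer G V ≠ ⊥} := by
  have hfin : Module.Finite (IntermediateField.fixedField G) K :=
    Module.finite_of_finrank_pos (by rw [finrank_fixedField_of_finite]; exact Nat.card_pos)
  ext P
  constructor
  · rintro ⟨hP, h⟩
    obtain ⟨V, hV, rfl⟩ := exists_comap_eq hP
    rw [fibre_comap G hV, finrank_fixedField_of_finite] at h
    exact ⟨V, ⟨hV, (encard_orbit_lt_iff V).1 h⟩, rfl⟩
  · rintro ⟨V, ⟨hV, h⟩, rfl⟩
    refine ⟨isPlace_comap hV, ?_⟩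
    rw [fibre_comap G hV, finrank_fixedField_of_finite]
    exact (encard_orbit_lt_iff V).2 h

end Fibres

/-! ### Branch points on `ℙ¹` and branch points of the two quotient maps. -/

section BranchSet

/-- The branch points of the `x`-coordinate on the curve `y ^ n = f x`. -/
def branchSet (n : ℕ) (f : ℂ[X]) : Set (OnePoint ℂ) := {p | ¬ (n : ℤ) ∣ ordAt p f}

theorem mem_branchSet {n : ℕ} {f : ℂ[X]} {p : OnePoint ℂ} :
    p ∈ branchSet n f ↔ ¬ (n : ℤ) ∣ ordAt p f := Iff.rfl

theorem rootMultiplicity_eq_one {f : ℂ[X]} (hf : f.Separable) {a : ℂ} (ha : f.IsRoot a) :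
    f.rootMultiplicity a = 1 :=
  le_antisymm (rootMultiplicity_le_one_of_separable hf a)
    ((rootMultiplicity_pos hf.ne_zero).2 ha)

theorem infty_mem_branchSet {n : ℕ} {f : ℂ[X]} : ∞ ∈ branchSet n f ↔ ¬ n ∣ f.natDegree := by
  rw [mem_branchSet, ordAt_infty, dvd_neg, Int.natCast_dvd_natCast]

theorem coe_mem_branchSet {n : ℕ} (hn : 2 ≤ n) {f : ℂ[X]} (hf : f.Separable) {a : ℂ} :
    (a : OnePoint ℂ) ∈ branchSet n f ↔ f.IsRoot a := by
  rw [mem_branchSet, ordAt_coe, Int.natCast_dvd_natCast]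
  by_cases ha : f.IsRoot a
  · rw [rootMultiplicity_eq_one hf ha, Nat.dvd_one]
    exact iff_of_true (by omega) ha
  · rw [rootMultiplicity_eq_zero ha]
    exact iff_of_false (by simp) ha

/-- The dichotomy between `n ∣ deg f` and `gcd (n, deg f) = 1` excludes partial ramification at
infinity; at a root the order is one anyway. -/
theorem isCoprime_of_mem_branchSet {n : ℕ} (hn : 2 ≤ n) {f : ℂ[X]} (hf : f.Separable)
    (h : n ∣ f.natDegree ∨ n.Coprime f.natDegree) {p : OnePoint ℂ} (hp : p ∈ branchSet n f) :
    IsCoprime (n : ℤ) (ordAt p f) := by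
  induction p using OnePoint.rec with
  | infty =>
    rw [ordAt_infty, IsCoprime.neg_right_iff, Nat.isCoprime_iff_coprime]
    exact h.resolve_left (infty_mem_branchSet.1 hp)
  | coe a =>
    rw [ordAt_coe, rootMultiplicity_eq_one hf ((coe_mem_branchSet hn hf).1 hp)]
    exact isCoprime_one_right

theorem branchSet_eq {n : ℕ} (hn : 2 ≤ n) {f : ℂ[X]} (hf : f.Separable) :
    branchSet n f = (fun a : ℂ => (a : OnePoint ℂ)) '' f.rootSet ℂ ∪
      {p | p = ∞ ∧ ¬ n ∣ f.natDegree} := by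
  ext p
  induction p using OnePoint.rec with
  | infty => simp [infty_mem_branchSet]
  | coe a => simp [coe_mem_branchSet hn hf, mem_rootSet, hf.ne_zero]

theorem finite_branchSet {n : ℕ} (hn : 2 ≤ n) {f : ℂ[X]} (hf : f.Separable) :
    (branchSet n f).Finite := by
  rw [branchSet_eq hn hf]
  exact ((rootSet_finite f ℂ).image _).union
    ((Set.finite_singleton ∞).subset fun p hp => hp.1)

open Classical in
theorem ncard_branchSet {n : ℕ} (hn : 2 ≤ n) {f : ℂ[X]} (hf : f.Separable) :
    (branchSet n f).ncard = f.natDegree + if n ∣ f.natDegree then 0 else 1 := by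
  have h1 : ((fun a : ℂ => (a : OnePoint ℂ)) '' f.rootSet ℂ).ncard = f.natDegree := by
    rw [Set.ncard_image_of_injective _ OnePoint.coe_injective, ← Nat.card_coe_set_eq,
      Nat.card_eq_fintype_card, card_rootSet_eq_natDegree hf (IsAlgClosed.splits _)]
  rw [branchSet_eq hn hf, Set.ncard_union_eq _ ((rootSet_finite f ℂ).image _)
    ((Set.finite_singleton ∞).subset fun p hp => hp.1), h1]
  · split_ifs with h <;> simp [h]
  · rw [Set.disjoint_left]
    rintro _ ⟨a, -, rfl⟩ ⟨h, -⟩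
    exact OnePoint.coe_ne_infty a h

/-- Used to count places of a fixed field by points or orbits on `ℙ¹`: representatives of the common
fibres map bijectively onto both images. -/
theorem encard_image_eq_of_iff {α β γ : Type*} {s : Set α} {f : α → β} {g : α → γ}
    (h : ∀ a ∈ s, ∀ b ∈ s, f a = f b ↔ g a = g b) : (f '' s).encard = (g '' s).encard := by
  classical
  obtain ⟨t, hts, ht⟩ := Set.SurjOn.exists_bijOn_subset (Set.surjOn_image f s)
  have hg : Set.BijOn g t (g '' s) := by
    refine ⟨fun a ha => ⟨a, hts ha, rfl⟩, fun a ha b hb hab => ?_, ?_⟩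
    · exact ht.injOn ha hb ((h a (hts ha) b (hts hb)).2 hab)
    · rintro _ ⟨a, ha, rfl⟩
      obtain ⟨b, hb, hab⟩ := ht.surjOn ⟨a, ha, rfl⟩
      exact ⟨b, hb, (h b (hts hb) a ha).1 hab⟩
  rw [← ht.image_eq, ← hg.image_eq, ht.injOn.encard_image, hg.injOn.encard_image]

namespace IsSeparableCurve

variable {K : Type*} [Field K] [Algebra ℂ K] {n : ℕ} {f : ℂ[X]} {x y : K}
  (hc : IsSeparableCurve n f x y)
include hc

theorem pointAction_mem_branchSet (σ : levelNormalizer n x y) {p : OnePoint ℂ}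
    (hp : p ∈ branchSet n f) : hc.pointAction σ p ∈ branchSet n f := by
  obtain ⟨i, hi⟩ := hc.exists_multiplier σ
  intro h
  exact hp ((Int.dvd_iff_dvd_of_dvd_sub (hi p)).2 (h.mul_left i))

theorem exists_levelGroup_smul_eq {V W : ValuationSubring K} (hV : IsPlace V) (hW : IsPlace W)
    (h : pointAt x V = pointAt x W) : ∃ σ ∈ levelGroup n x y, σ • V = W := by
  have := hc.isAlgebraic_xLine
  have := hc.finite_levelGroup
  refine exists_smul_eq_of_mem_iff _ hV hW fun z hz => ?_
  rw [hc.fixedField_levelGroup] at hz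
  exact mem_iff_of_pointAt_eq hc.transcendental hV hW h hz

theorem pointAt_levelGroup_smul {σ : K ≃ₐ[ℂ] K} (hσ : σ ∈ levelGroup n x y)
    (V : ValuationSubring K) : pointAt x (σ • V) = pointAt x V := by
  rw [pointAt_smul, hc.mem_levelGroup_iff.1 (inv_mem hσ)]

variable (hn : 2 ≤ n) (hdc : n ∣ f.natDegree ∨ n.Coprime f.natDegree)
include hn hdc

theorem stabilizer_levelGroup_ne_bot_iff {V : ValuationSubring K} (hV : IsPlace V) :
    MulAction.stabilizer (levelGroup n x y) V ≠ ⊥ ↔ pointAt x V ∈ branchSet n f := by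
  rw [Subgroup.ne_bot_iff_exists_ne_one]
  constructor
  · rintro ⟨⟨⟨σ, hσ⟩, hσV⟩, hne⟩ h
    exact hne (Subtype.ext (Subtype.ext (hc.eq_one_of_smul_eq hV h hn hσ hσV)))
  · intro h
    have := hc.finite_levelGroup
    have h2 : Nontrivial (levelGroup n x y) :=
      Finite.one_lt_card_iff_nontrivial.1 (by rw [hc.card_levelGroup]; omega)
    obtain ⟨σ, hσ⟩ := exists_ne (1 : levelGroup n x y)
    exact ⟨⟨σ, hc.smul_eq_of_isCoprime hV
      (isCoprime_of_mem_branchSet hn hc.separable hdc h) σ.2⟩, fun h3 =>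
      hσ (congrArg Subtype.val h3)⟩

theorem encard_branchPoints_xLine : (branchPoints (xLine x)).encard = (branchSet n f).encard := by
  have := hc.isAlgebraic_xLine
  have := hc.finite_levelGroup
  rw [← hc.fixedField_levelGroup, branchPoints_fixedField, encard_image_eq_of_iff (g := pointAt x)]
  · congr 1
    ext p
    constructor
    · rintro ⟨V, ⟨hV, h⟩, rfl⟩
      exact (hc.stabilizer_levelGroup_ne_bot_iff hn hdc hV).1 h
    · intro hp
      obtain ⟨V, hV, rfl⟩ := hc.exists_pointAt_eq p
      exact ⟨V, ⟨hV, (hc.stabilizer_levelGroup_ne_bot_iff hn hdc hV).2 hp⟩, rfl⟩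
  · rintro V ⟨hV, -⟩ W ⟨hW, -⟩
    rw [comap_eq_iff _ hV hW]
    constructor
    · rintro ⟨σ, rfl⟩
      exact (hc.pointAt_levelGroup_smul σ.2 V).symm
    · intro h
      obtain ⟨σ, hσ, rfl⟩ := hc.exists_levelGroup_smul_eq hV hW h
      exact ⟨⟨σ, hσ⟩, rfl⟩

/-- An element of `N` fixing `V` acts nontrivially on `ℙ¹` unless it lies in `H`, and `H` acts
freely off the branch set. Conversely, an element whose action fixes the point below `V` is
corrected by an element of `H` so that it fixes `V` itself. -/
theorem stabilizer_levelNormalizer_ne_bot_iff {V : ValuationSubring K} (hV : IsPlace V) :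
    MulAction.stabilizer (levelNormalizer n x y) V ≠ ⊥ ↔
      pointAt x V ∈ branchSet n f ∨
        MulAction.stabilizer hc.pointAction.range (pointAt x V) ≠ ⊥ := by
  constructor
  · intro h
    obtain ⟨⟨σ, hσV⟩, hne⟩ := Subgroup.ne_bot_iff_exists_ne_one.1 h
    have hσV' : (σ : K ≃ₐ[ℂ] K) • V = V := hσV
    rw [or_iff_not_imp_left]
    intro hB
    refine Subgroup.ne_bot_iff_exists_ne_one.2 ⟨⟨⟨hc.pointAction σ, σ, rfl⟩, ?_⟩, fun h1 => ?_⟩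
    · change hc.pointAction σ (pointAt x V) = pointAt x V
      rw [hc.pointAction_pointAt _ hV, hσV']
    · have h2 : hc.pointAction σ = 1 := congrArg Subtype.val (congrArg Subtype.val h1)
      have h3 := hc.pointAction_eq_one_iff.1 h2
      exact hne (Subtype.ext (Subtype.ext
        (hc.eq_one_of_smul_eq hV (not_not.1 hB) hn h3 hσV')))
  · rintro (h | h)
    · obtain ⟨⟨⟨σ, hσ⟩, hσV⟩, hne⟩ := Subgroup.ne_bot_iff_exists_ne_one.1
        ((hc.stabilizer_levelGroup_ne_bot_iff hn hdc hV).2 h)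
      refine Subgroup.ne_bot_iff_exists_ne_one.2
        ⟨⟨⟨σ, Subgroup.le_normalizer hσ⟩, hσV⟩, fun h1 => hne ?_⟩
      have h2 : σ = 1 := congrArg Subtype.val (congrArg Subtype.val h1)
      exact Subtype.ext (Subtype.ext h2)
    · obtain ⟨⟨⟨_, σ, rfl⟩, hσV⟩, hne⟩ := Subgroup.ne_bot_iff_exists_ne_one.1 h
      have hσV' : hc.pointAction σ (pointAt x V) = pointAt x V := hσV
      rw [hc.pointAction_pointAt _ hV] at hσV'
      obtain ⟨τ, hτ, hτV⟩ := hc.exists_levelGroup_smul_eq (hV.smul _) hV hσV'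
      have hτN : τ ∈ levelNormalizer n x y := Subgroup.le_normalizer hτ
      refine Subgroup.ne_bot_iff_exists_ne_one.2 ⟨⟨⟨τ, hτN⟩ * σ, ?_⟩, fun h1 => hne ?_⟩
      · change (τ * (σ : K ≃ₐ[ℂ] K)) • V = V
        rw [mul_smul, hτV]
      · have h2 : (⟨τ, hτN⟩ : levelNormalizer n x y) * σ = 1 := congrArg Subtype.val h1
        have h3 := congrArg hc.pointAction h2
        rw [map_mul, map_one, hc.pointAction_eq_one_iff.2 hτ, one_mul] at h3
        exact Subtype.ext (Subtype.ext h3)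

/-- If all branch points are exceptional, ramified places are those above exceptional points. As `H`
is transitive on places above a point, `N`-orbits of places correspond to orbits on `ℙ¹`. -/
theorem encard_branchPoints_quotientField [Finite (levelNormalizer n x y)]
    (hB : ∀ p ∈ branchSet n f, MulAction.stabilizer hc.pointAction.range p ≠ ⊥) :
    (branchPoints (quotientField n x y)).encard =
      ((MulAction.orbit hc.pointAction.range) ''
        {p : OnePoint ℂ | MulAction.stabilizer hc.pointAction.range p ≠ ⊥}).encard := by
  rw [quotientField, branchPoints_fixedField,
    encard_image_eq_of_iff (g := fun V => MulAction.orbit hc.pointAction.range (pointAt x V))]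
  · congr 1
    ext O
    constructor
    · rintro ⟨V, ⟨hV, h⟩, rfl⟩
      refine ⟨pointAt x V, ?_, rfl⟩
      rcases (hc.stabilizer_levelNormalizer_ne_bot_iff hn hdc hV).1 h with h | h
      exacts [hB _ h, h]
    · rintro ⟨p, hp, rfl⟩
      obtain ⟨V, hV, rfl⟩ := hc.exists_pointAt_eq p
      exact ⟨V, ⟨hV, (hc.stabilizer_levelNormalizer_ne_bot_iff hn hdc hV).2 (Or.inr hp)⟩, rfl⟩
  · rintro V ⟨hV, -⟩ W ⟨hW, -⟩
    rw [comap_eq_iff _ hV hW, eq_comm, MulAction.orbit_eq_iff]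
    constructor
    · rintro ⟨σ, rfl⟩
      exact ⟨⟨hc.pointAction σ, σ, rfl⟩, hc.pointAction_pointAt σ hV⟩
    · rintro ⟨⟨_, σ, rfl⟩, h⟩
      have h' : hc.pointAction σ (pointAt x V) = pointAt x W := h
      rw [hc.pointAction_pointAt _ hV] at h'
      obtain ⟨τ, hτ, rfl⟩ := hc.exists_levelGroup_smul_eq (hV.smul _) hW h'
      exact ⟨⟨τ, Subgroup.le_normalizer hτ⟩ * σ, mul_smul τ (σ : K ≃ₐ[ℂ] K) V⟩

omit hn hdc

theorem eq_one_of_fixes_three {g : Equiv.Perm (OnePoint ℂ)} (hg : g ∈ hc.pointAction.range)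
    {p q r : OnePoint ℂ} (hpq : p ≠ q) (hpr : p ≠ r) (hqr : q ≠ r) (hp : g p = p) (hq : g q = q)
    (hr : g r = r) : g = 1 := by
  obtain ⟨σ, rfl⟩ := hg
  obtain ⟨M, hM⟩ := hc.pointAction_eq_smul σ
  by_contra h
  obtain ⟨a, b, hab, -⟩ := exists_fixedPoints_GL (M := M) (by
    by_contra! h2
    exact h (Equiv.ext fun s => (hM s).trans (h2 s)))
  rw [hM] at hp hq hr
  rcases (hab p).1 hp with rfl | rfl <;> rcases (hab q).1 hq with rfl | rfl <;>
    rcases (hab r).1 hr with rfl | rfl <;> simp_all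

/-- A Möbius transformation is determined by its values at three points, so the group embeds into
the self-maps of the finite branch set. -/
theorem finite_range_pointAction (hn : 2 ≤ n) (h3 : 3 ≤ (branchSet n f).ncard) :
    Finite hc.pointAction.range := by
  have hfin := finite_branchSet hn hc.separable
  have := hfin.to_subtype
  obtain ⟨t, ht, ht3⟩ := Set.exists_subset_card_eq h3
  obtain ⟨a, b, c, hab, hac, hbc, rfl⟩ := Set.ncard_eq_three.1 ht3
  let F : hc.pointAction.range → (branchSet n f → branchSet n f) := fun g p =>
    ⟨g.1 p, by
      obtain ⟨σ, hσ⟩ := g.2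
      rw [← hσ]
      exact hc.pointAction_mem_branchSet σ p.2⟩
  refine Finite.of_injective F fun g h hgh => ?_
  have key : ∀ p ∈ branchSet n f, (g⁻¹ * h : hc.pointAction.range).1 p = p := fun p hp => by
    have h1 : g.1 p = h.1 p := congrArg Subtype.val (congrFun hgh ⟨p, hp⟩)
    change g.1⁻¹ (h.1 p) = p
    rw [← h1]
    exact g.1.symm_apply_apply p
  have h4 := hc.eq_one_of_fixes_three (g⁻¹ * h).2 hab hac hbc
    (key a (ht (by simp))) (key b (ht (by simp))) (key c (ht (by simp)))
  exact inv_mul_eq_one.1 (Subtype.ext h4)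

theorem finite_levelNormalizer [Finite hc.pointAction.range] :
    Finite (levelNormalizer n x y) := by
  have := hc.finite_levelGroup
  have h1 : Finite hc.pointAction.ker := by
    rw [hc.ker_pointAction]
    exact Finite.of_injective (fun σ => (⟨σ.1.1, σ.2⟩ : levelGroup n x y)) fun σ τ h =>
      by
        have h2 : (σ : levelNormalizer n x y).1 = τ.1.1 := by
          have h3 := congrArg Subtype.val h
          exact h3
        exact Subtype.ext (Subtype.ext h2)
  have h2 : Finite (levelNormalizer n x y ⧸ hc.pointAction.ker) :=
    Finite.of_equiv _ (QuotientGroup.quotientKerEquivRange hc.pointAction).symm.toEquiv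
  exact Finite.of_equiv _ (Subgroup.groupEquivQuotientProdSubgroup (s := hc.pointAction.ker)).symm

theorem exists_two_fixedPoints [Finite hc.pointAction.range] {g : Equiv.Perm (OnePoint ℂ)}
    (hg : g ∈ hc.pointAction.range) (hg1 : g ≠ 1) :
    ∃ p q : OnePoint ℂ, p ≠ q ∧ ∀ r, g r = r ↔ r = p ∨ r = q := by
  have hfin := isOfFinOrder_of_finite (⟨g, hg⟩ : hc.pointAction.range)
  obtain ⟨k, hk, hgk⟩ := isOfFinOrder_iff_pow_eq_one.1 hfin
  have hgk' : g ^ k = 1 := congrArg Subtype.val hgk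
  obtain ⟨σ, rfl⟩ := hg
  obtain ⟨M, hM⟩ := hc.pointAction_eq_smul σ
  have hpow : ∀ (k : ℕ) (p : OnePoint ℂ), (hc.pointAction σ ^ k) p = M ^ k • p := by
    intro k
    induction k with
    | zero => intro p; rw [pow_zero, pow_zero, one_smul, Equiv.Perm.one_apply]
    | succ k ih => intro p; rw [pow_succ, pow_succ, Equiv.Perm.mul_apply, mul_smul, ih, hM]
  obtain ⟨p, q, hpq, h⟩ := exists_two_fixedPoints_GL (M := M) (by
    by_contra! h2
    exact hg1 (Equiv.ext fun s => (hM s).trans (h2 s))) hk.ne' fun p => by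
      rw [← hpow, hgk', Equiv.Perm.one_apply]
  exact ⟨p, q, hpq, fun r => by rw [hM, h]⟩

end IsSeparableCurve

end BranchSet

/-! ### Finite groups whose nontrivial elements have two fixed points: Klein's orbit count. -/

section TwoFixedPoints

/-- An action in which every nontrivial element has exactly two fixed points and which has no
nonempty invariant set with at most two points. -/
structure IsPolyhedralAction (G Ω : Type*) [Group G] [MulAction G Ω] : Prop where
  exists_fixed : ∀ g : G, g ≠ 1 → ∃ p q : Ω, p ≠ q ∧ ∀ r : Ω, g • r = r ↔ r = p ∨ r = q
  three_le_ncard : ∀ S : Set Ω, S.Finite → S.Nonempty → (∀ g : G, ∀ p ∈ S, g • p ∈ S) →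
    3 ≤ S.ncard

/-- The points with nontrivial stabilizer. -/
def exceptionalPoints (G Ω : Type*) [Group G] [MulAction G Ω] : Set Ω :=
  {p | MulAction.stabilizer G p ≠ ⊥}

/-- With stabilizer orders `α, β, γ` the equation reads `1/α + 1/β + 1/γ = 1 + 2/N`. Its solutions
are `(2, 2, k)`, excluded by `3 ≤ c`, and `(2, 3, 3)`, `(2, 3, 4)`, `(2, 3, 5)`. -/
theorem sorted_orbit_sizes {N a b c : ℕ} (hN : 0 < N) (ha : a ∣ N) (hb : b ∣ N) (hc : c ∣ N)
    (h2a : 2 * a ≤ N) (h3 : 3 ≤ c) (hab : b ≤ a) (hbc : c ≤ b) (hsum : a + b + c = N + 2) :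
    (N = 12 ∧ a = 6 ∧ b = 4 ∧ c = 4) ∨ (N = 24 ∧ a = 12 ∧ b = 8 ∧ c = 6) ∨
      (N = 60 ∧ a = 30 ∧ b = 20 ∧ c = 12) := by
  obtain ⟨α, rfl⟩ := ha
  obtain ⟨β, hβ⟩ := hb
  obtain ⟨γ, hγ⟩ := hc
  have hα2 : α = 2 := by
    have h1 : 2 ≤ α := by nlinarith
    have h2 : α < 3 := by nlinarith
    omega
  subst hα2
  have hβ4 : β < 4 := by nlinarith
  have hβ2 : 2 ≤ β := by nlinarith
  interval_cases β
  · omega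
  · have hγ6 : γ < 6 := by
      by_contra! h
      have := Nat.mul_le_mul_left c h
      omega
    interval_cases γ <;> omega

variable {G Ω : Type*} [Group G] [MulAction G Ω]

theorem smul_mem_exceptionalPoints (g : G) {p : Ω} (hp : p ∈ exceptionalPoints G Ω) :
    g • p ∈ exceptionalPoints G Ω := by
  intro h
  rw [MulAction.stabilizer_smul_eq_stabilizer_map_conj] at h
  exact hp ((Subgroup.map_eq_bot_iff_of_injective _ (MulAut.conj g).injective).1 h)

theorem card_inf_stabilizer_smul (H : Subgroup G) [H.Normal] (g : G) (p : Ω) :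
    Nat.card (H ⊓ MulAction.stabilizer G (g • p) : Subgroup G) =
      Nat.card (H ⊓ MulAction.stabilizer G p : Subgroup G) := by
  have h : (H ⊓ MulAction.stabilizer G (g • p) : Subgroup G) =
      (H ⊓ MulAction.stabilizer G p).map (MulAut.conj g).toMonoidHom := by
    rw [Subgroup.map_inf_eq _ _ _ (MulAut.conj g).injective,
      ← MulAction.stabilizer_smul_eq_stabilizer_map_conj]
    congr 1
    exact (Subgroup.Normal.map_conj_eq H g).symm
  rw [h, Subgroup.card_map_of_injective (MulAut.conj g).injective]

/-- Regroups a count over exceptional points by orbits; these form an invariant set, so each orbit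
that occurs is summed completely. -/
theorem sum_image_orbit (F : Ω → ℤ) (hF : ∀ (g : G) p, F (g • p) = F p) {s : Finset Ω}
    (hs : (s : Set Ω) = exceptionalPoints G Ω) [DecidableEq (Set Ω)] (Φ : Set Ω → ℤ)
    (hΦ : ∀ p ∈ s, Φ (MulAction.orbit G p) = (MulAction.orbit G p).ncard * F p) :
    ∑ O ∈ s.image (MulAction.orbit G), Φ O = ∑ p ∈ s, F p := by
  refine Finset.sum_image' _ fun p hp => ?_
  rw [hΦ p hp]
  have h1 : ∀ q ∈ s.filter fun q => MulAction.orbit G q = MulAction.orbit G p, F q = F p := by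
    intro q hq
    obtain ⟨g, rfl⟩ := MulAction.orbit_eq_iff.1 (Finset.mem_filter.1 hq).2
    exact hF g p
  rw [Finset.sum_congr rfl h1, Finset.sum_const, nsmul_eq_mul, ← Set.ncard_coe_finset]
  congr 3
  ext q
  rw [Finset.coe_filter]
  change q ∈ _ ↔ q ∈ s ∧ _
  rw [MulAction.orbit_eq_iff]
  refine ⟨fun hq => ⟨?_, hq⟩, fun hq => hq.2⟩
  obtain ⟨g, rfl⟩ := hq
  rw [← Finset.mem_coe, hs] at hp ⊢
  exact smul_mem_exceptionalPoints g hp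

theorem ncard_orbit_mul_card_stabilizer [Finite G] (p : Ω) :
    (MulAction.orbit G p).ncard * Nat.card (MulAction.stabilizer G p) = Nat.card G := by
  rw [Subgroup.card_eq_card_quotient_mul_card_subgroup (MulAction.stabilizer G p),
    Nat.card_congr (MulAction.orbitEquivQuotientStabilizer G p).symm, Nat.card_coe_set_eq]

namespace IsPolyhedralAction

theorem eq_one_of_fixes_three (hG : IsPolyhedralAction G Ω) {g : G} {p q r : Ω} (hpq : p ≠ q) (hpr : p ≠ r) (hqr : q ≠ r)
    (hp : g • p = p) (hq : g • q = q) (hr : g • r = r) : g = 1 := by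
  by_contra h
  obtain ⟨a, b, -, hab⟩ := hG.exists_fixed g h
  rcases (hab p).1 hp with rfl | rfl <;> rcases (hab q).1 hq with rfl | rfl <;>
    rcases (hab r).1 hr with rfl | rfl <;> simp_all

variable [Finite G] (hG : IsPolyhedralAction G Ω)
include hG

theorem finite_exceptionalPoints : (exceptionalPoints G Ω).Finite := by
  have h : exceptionalPoints G Ω ⊆ ⋃ g : {g : G // g ≠ 1}, {p | g.1 • p = p} := by
    intro p hp
    obtain ⟨⟨g, hg⟩, hne⟩ := Subgroup.ne_bot_iff_exists_ne_one.1 hp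
    exact Set.mem_iUnion.2 ⟨⟨g, fun h => hne (Subtype.ext h)⟩, hg⟩
  refine (Set.finite_iUnion fun g => ?_).subset h
  obtain ⟨p, q, -, hpq⟩ := hG.exists_fixed g.1 g.2
  exact (Set.toFinite {p, q}).subset fun r hr => (hpq r).1 hr

/-- Counting the pairs of a nontrivial element of `H` and a fixed point of it. -/
theorem sum_card_inf_stabilizer (H : Subgroup G) {s : Finset Ω}
    (hs : (s : Set Ω) = exceptionalPoints G Ω) :
    ∑ p ∈ s, ((Nat.card (H ⊓ MulAction.stabilizer G p : Subgroup G) : ℤ) - 1) =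
      2 * ((Nat.card H : ℤ) - 1) := by
  classical
  cases nonempty_fintype G
  let t : Finset G := Finset.univ.filter fun g => g ∈ H ∧ g ≠ 1
  have hcard : ∀ H' : Subgroup G,
      ((Finset.univ.filter fun g => g ∈ H' ∧ g ≠ 1).card : ℤ) = (Nat.card H' : ℤ) - 1 := by
    intro H'
    have h1 : (Finset.univ.filter fun g => g ∈ H' ∧ g ≠ 1) =
        (Finset.univ.filter fun g => g ∈ H').erase 1 := by
      ext g; simp [and_comm]
    have h2 : (Finset.univ.filter fun g => g ∈ H').card = Nat.card H' := by
      rw [Nat.card_eq_fintype_card, Fintype.card_subtype]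
    have h3 : (1 : G) ∈ Finset.univ.filter fun g => g ∈ H' := by simp
    rw [h1, ← h2, ← Finset.card_erase_add_one h3]
    push_cast
    ring
  have h := Finset.sum_card_bipartiteAbove_eq_sum_card_bipartiteBelow (s := t) (t := s)
    (fun g p => g • p = p)
  have h1 : ∀ g ∈ t, (s.bipartiteAbove (fun g p => g • p = p) g).card = 2 := by
    intro g hg
    obtain ⟨p, q, hpq, hfix⟩ := hG.exists_fixed g (Finset.mem_filter.1 hg).2.2
    rw [← Finset.card_pair hpq]
    congr 1
    ext r
    rw [Finset.mem_bipartiteAbove, hfix, Finset.mem_insert, Finset.mem_singleton,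
      and_iff_right_iff_imp]
    intro hr
    rw [← Finset.mem_coe, hs]
    exact Subgroup.ne_bot_iff_exists_ne_one.2 ⟨⟨g, (hfix r).2 hr⟩, fun h =>
      (Finset.mem_filter.1 hg).2.2 (congrArg Subtype.val h)⟩
  rw [Finset.sum_congr rfl h1, Finset.sum_const] at h
  have h2 : ∀ p ∈ s, ((t.bipartiteBelow (fun g p => g • p = p) p).card : ℤ) =
      (Nat.card (H ⊓ MulAction.stabilizer G p : Subgroup G) : ℤ) - 1 := by
    intro p _
    rw [← hcard]
    congr 2
    ext g
    simp only [Finset.mem_bipartiteBelow, t, Finset.mem_filter, Finset.mem_univ, true_and,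
      Subgroup.mem_inf, MulAction.mem_stabilizer_iff]
    tauto
  rw [← Finset.sum_congr rfl h2, ← hcard H, ← Nat.cast_sum, ← h]
  simp [t, mul_comm]

theorem three_le_ncard_orbit (p : Ω) : 3 ≤ (MulAction.orbit G p).ncard :=
  hG.three_le_ncard _ (Set.finite_range _) ⟨p, MulAction.mem_orbit_self p⟩ fun g _ hq =>
    MulAction.mem_orbit_of_mem_orbit g hq

theorem nontrivial_of_point (p : Ω) : Nontrivial G := by
  have h1 := hG.three_le_ncard_orbit p
  have h2 := ncard_orbit_mul_card_stabilizer (G := G) p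
  have h3 : 0 < Nat.card G := Nat.card_pos
  refine Finite.one_lt_card_iff_nontrivial.1 ?_
  have h4 : 0 < Nat.card (MulAction.stabilizer G p) := Nat.card_pos
  nlinarith

/-- There are exactly three orbits of points with nontrivial stabilizer, and the orders are those
of the rotation groups of the regular polyhedra. -/
theorem exists_orbits [Nonempty Ω] : ∃ p q r : Ω, MulAction.orbit G p ≠ MulAction.orbit G q ∧
    MulAction.orbit G p ≠ MulAction.orbit G r ∧ MulAction.orbit G q ≠ MulAction.orbit G r ∧
    MulAction.orbit G '' exceptionalPoints G Ω =
      {MulAction.orbit G p, MulAction.orbit G q, MulAction.orbit G r} ∧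
    ((Nat.card G = 12 ∧ (MulAction.orbit G p).ncard = 6 ∧ (MulAction.orbit G q).ncard = 4 ∧
        (MulAction.orbit G r).ncard = 4) ∨
      (Nat.card G = 24 ∧ (MulAction.orbit G p).ncard = 12 ∧ (MulAction.orbit G q).ncard = 8 ∧
        (MulAction.orbit G r).ncard = 6) ∨
      (Nat.card G = 60 ∧ (MulAction.orbit G p).ncard = 30 ∧ (MulAction.orbit G q).ncard = 20 ∧
        (MulAction.orbit G r).ncard = 12)) := by
  classical
  have hfin := hG.finite_exceptionalPoints
  set s := hfin.toFinset with hs_def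
  have hs : (s : Set Ω) = exceptionalPoints G Ω := hfin.coe_toFinset
  have := hG.nontrivial_of_point (Classical.arbitrary Ω)
  have hN : 1 < Nat.card G := Finite.one_lt_card
  set N := Nat.card G
  set T := s.image (MulAction.orbit G) with hT
  have hTset : MulAction.orbit G '' exceptionalPoints G Ω = T := by
    rw [hT, Finset.coe_image, hs]
  -- The fixed-point count for the whole group: an orbit `O` has stabilizers of order `N / |O|` and
  -- contributes `|O| * (N / |O| - 1) = N - |O|`.
  have hsum : ∑ O ∈ T, ((N : ℤ) - O.ncard) = 2 * (N - 1) := by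
    have h1 := hG.sum_card_inf_stabilizer ⊤ hs
    rw [Subgroup.card_top] at h1
    rw [← h1]
    refine sum_image_orbit _ (fun g p => ?_) hs (fun O => (N : ℤ) - O.ncard) fun p _ => ?_
    · rw [card_inf_stabilizer_smul]
    · rw [top_inf_eq, mul_sub, mul_one, ← Nat.cast_mul, ncard_orbit_mul_card_stabilizer]
  have hO : ∀ O ∈ T, O.ncard ∣ N ∧ 3 ≤ O.ncard ∧ 2 * O.ncard ≤ N := by
    intro O hO
    obtain ⟨p, hp, rfl⟩ := Finset.mem_image.1 hO
    have h1 := ncard_orbit_mul_card_stabilizer (G := G) p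
    refine ⟨⟨_, h1.symm⟩, hG.three_le_ncard_orbit p, ?_⟩
    have hp' : p ∈ exceptionalPoints G Ω := hs ▸ hp
    have h2 : 1 < Nat.card (MulAction.stabilizer G p) := by
      rw [Finite.one_lt_card_iff_nontrivial]
      exact (Subgroup.nontrivial_iff_ne_bot _).2 hp'
    change _ * _ = N at h1
    rw [← h1]
    nlinarith [hG.three_le_ncard_orbit p]
  -- Each orbit contributes at least `N / 2` and at most `N - 3` to the total `2 * (N - 1)`, so
  -- there are fewer than four and more than two orbits.
  have hcard : T.card = 3 := by
    have h1 : ∑ O ∈ T, ((N : ℤ) - O.ncard) ≤ ∑ O ∈ T, ((N : ℤ) - 3) :=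
      Finset.sum_le_sum fun O h => by have := (hO O h).2.1; omega
    have h2 : ∑ O ∈ T, (N : ℤ) ≤ ∑ O ∈ T, 2 * ((N : ℤ) - O.ncard) :=
      Finset.sum_le_sum fun O h => by have := (hO O h).2.2; omega
    rw [← Finset.mul_sum] at h2
    rw [hsum] at h1 h2
    rw [Finset.sum_const, nsmul_eq_mul] at h1 h2
    have h3 : (T.card : ℤ) < 4 := by nlinarith
    have h4 : (2 : ℤ) < T.card := by
      by_contra! h
      nlinarith [show (0 : ℤ) ≤ T.card by positivity]
    omega
  have hsorted : ∃ p q r : Ω, MulAction.orbit G p ≠ MulAction.orbit G q ∧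
      MulAction.orbit G p ≠ MulAction.orbit G r ∧ MulAction.orbit G q ≠ MulAction.orbit G r ∧
      T = {MulAction.orbit G p, MulAction.orbit G q, MulAction.orbit G r} ∧
      (MulAction.orbit G q).ncard ≤ (MulAction.orbit G p).ncard ∧
      (MulAction.orbit G r).ncard ≤ (MulAction.orbit G q).ncard := by
    obtain ⟨A, B, C, hAB, hAC, hBC, hT3⟩ := Finset.card_eq_three.1 hcard
    have hmem : ∀ O ∈ T, ∃ p, MulAction.orbit G p = O := fun O h => by
      obtain ⟨p, -, hp⟩ := Finset.mem_image.1 h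
      exact ⟨p, hp⟩
    obtain ⟨a, rfl⟩ := hmem A (by simp [hT3])
    obtain ⟨b, rfl⟩ := hmem B (by simp [hT3])
    obtain ⟨c, rfl⟩ := hmem C (by simp [hT3])
    rcases le_total (MulAction.orbit G a).ncard (MulAction.orbit G b).ncard with h1 | h1 <;>
    rcases le_total (MulAction.orbit G a).ncard (MulAction.orbit G c).ncard with h2 | h2 <;>
    rcases le_total (MulAction.orbit G b).ncard (MulAction.orbit G c).ncard with h3 | h3
    · exact ⟨c, b, a, hBC.symm, hAC.symm, hAB.symm, by rw [hT3]; ext; simp; tauto, h3, h1⟩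
    · exact ⟨b, c, a, hBC, hAB.symm, hAC.symm, by rw [hT3]; ext; simp; tauto, h3, h2⟩
    · exact ⟨c, b, a, hBC.symm, hAC.symm, hAB.symm, by rw [hT3]; ext; simp; tauto, h3, h1⟩
    · exact ⟨b, a, c, hAB.symm, hBC, hAC, by rw [hT3]; ext; simp; tauto, h1, h2⟩
    · exact ⟨c, a, b, hAC.symm, hBC.symm, hAB, by rw [hT3]; ext; simp; tauto, h2, h1⟩
    · exact ⟨a, b, c, hAB, hAC, hBC, hT3, h1, h3⟩
    · exact ⟨a, c, b, hAC, hAB, hBC.symm, by rw [hT3]; ext; simp; tauto, h2, h3⟩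
    · exact ⟨a, b, c, hAB, hAC, hBC, hT3, h1, h3⟩
  obtain ⟨p, q, r, hpq, hpr, hqr, hT3, h1, h2⟩ := hsorted
  refine ⟨p, q, r, hpq, hpr, hqr, by rw [hTset, hT3]; simp, ?_⟩
  rw [hT3, Finset.sum_insert (by simp [hpq, hpr]), Finset.sum_insert (by simp [hqr]),
    Finset.sum_singleton] at hsum
  have hp := hO (MulAction.orbit G p) (by simp [hT3])
  have hq := hO (MulAction.orbit G q) (by simp [hT3])
  have hr := hO (MulAction.orbit G r) (by simp [hT3])
  exact sorted_orbit_sizes (by omega) hp.1 hq.1 hr.1 hp.2.2 hr.2.1 h1 h2 (by omega)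

end IsPolyhedralAction

end TwoFixedPoints

/-! ### Identification of the groups of order 12, 24 and 60. -/

section PolyhedralGroups

/-- The image has index two in the symmetric group, and the alternating group is the only such
subgroup. -/
theorem nonempty_mulEquiv_alternatingGroup {H X : Type*} [Group H] [Finite H] {k : ℕ}
    {φ : H →* Equiv.Perm X} (hφ : Function.Injective φ) (hX : Nat.card X = k) (hk : k ≠ 0)
    (hcard : Nat.card H * 2 = Nat.factorial k) : Nonempty (H ≃* alternatingGroup (Fin k)) := by
  have hfin : Finite X := Nat.finite_of_card_ne_zero (hX ▸ hk)
  let e : X ≃ Fin k := (Finite.equivFin X).trans (finCongr hX)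
  let ψ : H →* Equiv.Perm (Fin k) := e.permCongrHom.toMonoidHom.comp φ
  have hψ : Function.Injective ψ := e.permCongrHom.injective.comp hφ
  have h1 : Nat.card ψ.range = Nat.card H := Nat.card_congr (ψ.ofInjective hψ).symm.toEquiv
  have h2 := ψ.range.card_mul_index
  rw [h1, Nat.card_perm, Nat.card_fin, ← hcard] at h2
  have h3 := Equiv.Perm.eq_alternatingGroup_of_index_eq_two
    (Nat.eq_of_mul_eq_mul_left Nat.card_pos h2)
  exact ⟨(ψ.ofInjective hψ).trans (MulEquiv.subgroupCongr h3)⟩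

theorem nonempty_mulEquiv_perm {H X : Type*} [Group H] [Finite H] {k : ℕ}
    {φ : H →* Equiv.Perm X} (hφ : Function.Injective φ) (hX : Nat.card X = k) (hk : k ≠ 0)
    (hcard : Nat.card H = Nat.factorial k) : Nonempty (H ≃* Equiv.Perm (Fin k)) := by
  have hfin : Finite X := Nat.finite_of_card_ne_zero (hX ▸ hk)
  let e : X ≃ Fin k := (Finite.equivFin X).trans (finCongr hX)
  have h1 : Function.Bijective φ := (Nat.bijective_iff_injective_and_card φ).2
    ⟨hφ, by rw [hcard, Nat.card_perm, hX]⟩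
  exact ⟨(MulEquiv.ofBijective φ h1).trans e.permCongrHom⟩

/-- A simple group of order `60` is the alternating group on five letters. -/
theorem nonempty_mulEquiv_of_simple {H : Type*} [Group H] [Finite H] (hcard : Nat.card H = 60)
    (hsimple : ∀ N : Subgroup H, N.Normal → N = ⊥ ∨ N = ⊤) :
    Nonempty (H ≃* alternatingGroup (Fin 5)) := by
  have : Fact (Nat.Prime 2) := ⟨Nat.prime_two⟩
  obtain ⟨P⟩ : Nonempty (Sylow 2 H) := inferInstance
  have hP : Nat.card P = 4 := by
    rw [P.card_eq_multiplicity, hcard]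
    have : (60 : ℕ).factorization 2 = 2 := by
      rw [show 60 = 2 ^ 2 * 15 by norm_num, Nat.factorization_mul (by norm_num) (by norm_num),
        Nat.prime_two.factorization_pow, Finsupp.add_apply, Finsupp.single_eq_same,
        Nat.factorization_eq_zero_of_not_dvd (by norm_num)]
    rw [this]
    norm_num
  have hindex : P.index = 15 := by
    have := P.card_mul_index
    rw [hcard] at this
    change Nat.card P * _ = 60 at this
    rw [hP] at this
    omega
  have hdvd : Nat.card (Sylow 2 H) ∣ 15 := hindex ▸ P.card_dvd_index
  have hnormal : ∀ N : Subgroup H, N.Normal → Nat.card N = 1 ∨ Nat.card N = 60 := fun N hN => by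
    rcases hsimple N hN with rfl | rfl
    · simp
    · right; rw [Subgroup.card_top, hcard]
  have hne1 : Nat.card (Sylow 2 H) ≠ 1 := fun h => by
    rw [P.card_eq_index_normalizer, Subgroup.index_eq_one] at h
    have := hnormal P (Subgroup.normalizer_eq_top_iff.1 h)
    change Nat.card P = 1 ∨ Nat.card P = 60 at this
    omega
  -- With 15 Sylow 2-subgroups each would be self-normalizing, and being abelian of order four it
  -- would be central in its normalizer. Burnside's transfer theorem would then give a normal
  -- complement of order 15.
  have hne15 : Nat.card (Sylow 2 H) ≠ 15 := fun h => by
    have h1 : Subgroup.normalizer (P : Set H) = P := by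
      refine le_antisymm ?_ Subgroup.le_normalizer
      have h2 := (Subgroup.normalizer (P : Set H)).card_mul_index
      rw [← P.card_eq_index_normalizer, h, hcard] at h2
      refine (Subgroup.eq_of_le_of_card_ge Subgroup.le_normalizer ?_).ge
      change Nat.card (Subgroup.normalizer (P : Set H)) ≤ Nat.card (P : Subgroup H)
      omega
    have hcomm : ∀ a b : P, a * b = b * a :=
      (IsPGroup.isMulCommutative_of_card_eq_prime_sq (p := 2) (hP.trans (by norm_num))).is_comm.comm
    have h2 : Subgroup.normalizer (P : Set H) ≤ Subgroup.centralizer (P : Set H) := by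
      rw [h1]
      intro a ha b hb
      exact congrArg Subtype.val (hcomm ⟨b, hb⟩ ⟨a, ha⟩)
    have h3 := (MonoidHom.ker_transferSylow_isComplement' P h2).card_mul_card
    change _ * Nat.card P = _ at h3
    rw [hP, hcard] at h3
    have := hnormal (MonoidHom.transferSylow P h2).ker inferInstance
    omega
  have hker : (MulAction.toPermHom H (Sylow 2 H)).ker = ⊥ := by
    refine (hsimple _ inferInstance).resolve_right fun h => hne1 ?_
    have hsub : Subsingleton (Sylow 2 H) := ⟨fun Q R => by
      obtain ⟨g, rfl⟩ := MulAction.exists_smul_eq H Q R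
      have h1 : g ∈ (MulAction.toPermHom H (Sylow 2 H)).ker := by rw [h]; trivial
      exact (Equiv.ext_iff.1 (MonoidHom.mem_ker.1 h1) Q).symm⟩
    exact Nat.card_eq_one_iff_unique.2 ⟨hsub, inferInstance⟩
  have hinj := (MonoidHom.ker_eq_bot_iff _).1 hker
  -- The number divides 15; three is impossible because the conjugation action is faithful and `60 >
  -- 3!`.
  have h5 : Nat.card (Sylow 2 H) = 5 := by
    have h1 : Nat.card (Sylow 2 H) ∈ Nat.divisors 15 := by simpa using hdvd
    have h2 : Nat.divisors 15 = {1, 3, 5, 15} := by decide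
    rw [h2] at h1
    simp only [Finset.mem_insert, Finset.mem_singleton] at h1
    have h3 : Nat.card (Sylow 2 H) ≠ 3 := fun h => by
      have h4 := Nat.card_le_card_of_injective _ hinj
      rw [Nat.card_perm, hcard, h] at h4
      norm_num [Nat.factorial] at h4
    omega
  exact nonempty_mulEquiv_alternatingGroup hinj h5 (by norm_num) (by rw [hcard]; decide)

namespace IsPolyhedralAction

variable {G Ω : Type*} [Group G] [MulAction G Ω] (hG : IsPolyhedralAction G Ω)
include hG

/-- The common fixed points of a normal subgroup form an invariant set. It lies in the two-point
fixed set of `h`, so it must be empty. -/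
theorem not_fixes_of_normal {H : Subgroup G} (hH : H.Normal) {h : G} (hh : h ∈ H) (h1 : h ≠ 1)
    (p : Ω) : ∃ g ∈ H, g • p ≠ p := by
  by_contra! hp
  obtain ⟨a, b, -, hab⟩ := hG.exists_fixed h h1
  have hsub : {r : Ω | ∀ g ∈ H, g • r = r} ⊆ {a, b} := fun r hr => (hab r).1 (hr h hh)
  have h3 := hG.three_le_ncard {r : Ω | ∀ g ∈ H, g • r = r} ((Set.toFinite _).subset hsub)
    ⟨p, hp⟩ fun g r hr k hk => by
      rw [← mul_smul, show k * g = g * (g⁻¹ * k * g) by group, mul_smul,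
        hr _ (by simpa using hH.conj_mem k hk g⁻¹)]
  have h4 := Set.ncard_le_ncard hsub
  have h5 := Set.ncard_insert_le a {b}
  rw [Set.ncard_singleton] at h5
  omega

/-- Such a subgroup is cyclic, so it fixes the fixed points of a generator, contrary to
`not_fixes_of_normal`. -/
theorem not_prime_card_of_normal {H : Subgroup G} (hH : H.Normal) {p : ℕ} (hp : p.Prime) :
    Nat.card H ≠ p := by
  rintro rfl
  have : Fact (Nat.card H).Prime := ⟨hp⟩
  have : Finite H := Nat.finite_of_card_ne_zero hp.ne_zero
  have : Nontrivial H := Finite.one_lt_card_iff_nontrivial.1 hp.one_lt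
  obtain ⟨⟨h, hh⟩, h1⟩ := exists_ne (1 : H)
  have h1' : h ≠ 1 := fun h2 => h1 (Subtype.ext h2)
  obtain ⟨a, b, -, hab⟩ := hG.exists_fixed h h1'
  obtain ⟨g, hg, hga⟩ := hG.not_fixes_of_normal hH hh h1' a
  have h2 : (⟨g, hg⟩ : H) ∈ Subgroup.zpowers ⟨h, hh⟩ := mem_zpowers_of_prime_card rfl h1
  obtain ⟨k, hk⟩ := Subgroup.mem_zpowers_iff.1 h2
  have hk' : h ^ k = g := congrArg Subtype.val hk
  have h3 : h ∈ MulAction.stabilizer G a := (hab a).2 (Or.inl rfl)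
  exact hga (hk' ▸ zpow_mem h3 k)

variable [Finite G]

/-- There is an orbit of four points, and the action on it is faithful because an element fixing
three points is trivial. -/
theorem nonempty_mulEquiv_alternatingGroup_four [Nonempty Ω] (hcard : Nat.card G = 12) :
    Nonempty (G ≃* alternatingGroup (Fin 4)) := by
  obtain ⟨p, q, r, -, -, -, -, h⟩ := hG.exists_orbits
  have hr : (MulAction.orbit G r).ncard = 4 := by omega
  refine nonempty_mulEquiv_alternatingGroup (φ := MulAction.toPermHom G (MulAction.orbit G r))
    ((injective_iff_map_eq_one _).2 fun g hg => ?_) (by rw [Nat.card_coe_set_eq, hr])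
    (by norm_num) (by rw [hcard]; decide)
  have hfix : ∀ s ∈ MulAction.orbit G r, g • s = s := fun s hs =>
    congrArg Subtype.val (Equiv.ext_iff.1 hg ⟨s, hs⟩)
  obtain ⟨t, ht, ht3⟩ := Set.exists_subset_card_eq (show 3 ≤ _ by rw [hr]; norm_num)
  obtain ⟨a, b, c, hab, hac, hbc, rfl⟩ := Set.ncard_eq_three.1 ht3
  exact hG.eq_one_of_fixes_three hab hac hbc (hfix a (ht (by simp))) (hfix b (ht (by simp)))
    (hfix c (ht (by simp)))

/-- The group permutes its Sylow 3-subgroups. There are four, as a single one would be a normal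
subgroup of prime order, and the same prohibition disposes of the kernel. -/
theorem nonempty_mulEquiv_perm_four (hcard : Nat.card G = 24) :
    Nonempty (G ≃* Equiv.Perm (Fin 4)) := by
  have : Fact (Nat.Prime 3) := ⟨Nat.prime_three⟩
  have hP : ∀ P : Sylow 3 G, Nat.card P = 3 := fun P => by
    rw [P.card_eq_multiplicity, hcard]
    have : (24 : ℕ).factorization 3 = 1 := by
      rw [show 24 = 3 ^ 1 * 8 by norm_num, Nat.factorization_mul (by norm_num) (by norm_num),
        Nat.prime_three.factorization_pow, Finsupp.add_apply, Finsupp.single_eq_same,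
        Nat.factorization_eq_zero_of_not_dvd (by norm_num)]
    rw [this, pow_one]
  have h4 : Nat.card (Sylow 3 G) = 4 := by
    obtain ⟨P⟩ : Nonempty (Sylow 3 G) := inferInstance
    have hindex : P.index = 8 := by
      have := P.card_mul_index
      rw [hcard] at this
      change Nat.card P * _ = 24 at this
      rw [hP] at this
      omega
    have hdvd : Nat.card (Sylow 3 G) ∣ 8 := hindex ▸ P.card_dvd_index
    have hmod : Nat.card (Sylow 3 G) % 3 = 1 := card_sylow_modEq_one 3 G
    have h1 : Nat.card (Sylow 3 G) ≠ 1 := fun h => by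
      rw [P.card_eq_index_normalizer, Subgroup.index_eq_one] at h
      exact hG.not_prime_card_of_normal (Subgroup.normalizer_eq_top_iff.1 h) Nat.prime_three (hP P)
    have h2 : Nat.card (Sylow 3 G) ∈ Nat.divisors 8 := by simpa using hdvd
    have h3 : Nat.divisors 8 = {1, 2, 4, 8} := by decide
    rw [h3] at h2
    simp only [Finset.mem_insert, Finset.mem_singleton] at h2
    omega
  set K := (MulAction.toPermHom G (Sylow 3 G)).ker
  have hK : ∀ g ∈ K, ∀ P : Sylow 3 G, g • P = P := fun g hg P =>
    Equiv.ext_iff.1 (MonoidHom.mem_ker.1 hg) P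
  -- An element of order three in the kernel normalizes every Sylow 3-subgroup, hence generates each
  -- of them, which leaves only one.
  have h3 : ¬ 3 ∣ Nat.card K := fun h => by
    obtain ⟨⟨g, hgK⟩, hg⟩ := exists_prime_orderOf_dvd_card' 3 h
    rw [Subgroup.orderOf_mk] at hg
    have hzp : IsPGroup 3 (Subgroup.zpowers g) :=
      IsPGroup.of_card (n := 1) (by rw [Nat.card_zpowers, hg, pow_one])
    have heq : ∀ P : Sylow 3 G, Subgroup.zpowers g = P := fun P => by
      have h1 := (hzp.sylow_mem_fixedPoints_iff (Q := P)).1 fun k =>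
        hK _ (Subgroup.zpowers_le.2 hgK k.2) P
      refine Subgroup.eq_of_le_of_card_ge h1 ?_
      rw [hP, Nat.card_zpowers, hg]
    have hsub : Subsingleton (Sylow 3 G) := ⟨fun P Q => Sylow.ext ((heq P).symm.trans (heq Q))⟩
    rw [Nat.card_eq_one_iff_unique.2 ⟨hsub, inferInstance⟩] at h4
    omega
  -- The kernel lies in a Sylow normalizer, of order `24 / 4`. As 3 does not divide its order, the
  -- order is 1 or 2, and 2 is prime.
  have h6 : Nat.card K ∣ 6 := by
    obtain ⟨P⟩ : Nonempty (Sylow 3 G) := inferInstance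
    have h1 := (Subgroup.normalizer (P : Set G)).card_mul_index
    rw [← P.card_eq_index_normalizer, h4, hcard] at h1
    have h2 : K ≤ Subgroup.normalizer (P : Set G) := fun g hg =>
      Sylow.smul_eq_iff_mem_normalizer.1 (hK g hg P)
    have := Subgroup.card_dvd_of_le h2
    rwa [show Nat.card (Subgroup.normalizer (P : Set G)) = 6 by omega] at this
  have h1 : Nat.card K = 1 := by
    have h2 := hG.not_prime_card_of_normal (H := K) inferInstance Nat.prime_two
    have h7 : Nat.card K ∈ Nat.divisors 6 := by simpa using h6
    have h8 : Nat.divisors 6 = {1, 2, 3, 6} := by decide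
    rw [h8] at h7
    simp only [Finset.mem_insert, Finset.mem_singleton] at h7
    omega
  exact nonempty_mulEquiv_perm ((MonoidHom.ker_eq_bot_iff _).1 (Subgroup.card_eq_one.1 h1)) h4
    (by norm_num) (by rw [hcard]; decide)

/-- The group is simple by the fixed-point count for a normal subgroup `N`: the stabilizers have
prime order, so on each of the three orbits `N` contains either all of them or only the identity. -/
theorem nonempty_mulEquiv_alternatingGroup_five [Nonempty Ω] (hcard : Nat.card G = 60) :
    Nonempty (G ≃* alternatingGroup (Fin 5)) := by
  classical
  refine nonempty_mulEquiv_of_simple hcard fun N hN => ?_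
  obtain ⟨p, q, r, hpq, hpr, hqr, hT, h⟩ := hG.exists_orbits
  have hfin := hG.finite_exceptionalPoints
  have hs : (hfin.toFinset : Set Ω) = exceptionalPoints G Ω := hfin.coe_toFinset
  have hsum := hG.sum_card_inf_stabilizer N hs
  let F : Ω → ℤ := fun s => (Nat.card (N ⊓ MulAction.stabilizer G s : Subgroup G) : ℤ) - 1
  have hF : ∀ (g : G) s, F (g • s) = F s := fun g s => by
    simp only [F, card_inf_stabilizer_smul]
  -- The contribution of an orbit is read off at a chosen representative; invariance of `F` makes
  -- the choice irrelevant.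
  let Φ : Set Ω → ℤ := fun O => O.ncard * if h : ∃ s, MulAction.orbit G s = O
    then F h.choose else 0
  have hΦ : ∀ s, Φ (MulAction.orbit G s) = (MulAction.orbit G s).ncard * F s := fun s => by
    have h1 : ∃ s', MulAction.orbit G s' = MulAction.orbit G s := ⟨s, rfl⟩
    simp only [Φ, dif_pos h1]
    obtain ⟨g, hg⟩ := MulAction.orbit_eq_iff.1 h1.choose_spec
    rw [← hg]
    exact congrArg _ (hF g s)
  have himage : hfin.toFinset.image (MulAction.orbit G) =
      {MulAction.orbit G p, MulAction.orbit G q, MulAction.orbit G r} := by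
    rw [← Finset.coe_inj, Finset.coe_image, hs, hT]
    simp
  have h1 := sum_image_orbit F hF hs Φ fun s _ => hΦ s
  rw [himage, Finset.sum_insert (by simp [hpq, hpr]), Finset.sum_insert (by simp [hqr]),
    Finset.sum_singleton, hΦ, hΦ, hΦ, hsum] at h1
  have horder : ∀ (s : Ω) (k : ℕ), k.Prime → (MulAction.orbit G s).ncard * k = 60 →
      F s = 0 ∨ F s = k - 1 := by
    intro s k hk h2
    have h3 := ncard_orbit_mul_card_stabilizer (G := G) s
    rw [hcard, ← h2] at h3
    have h4 : Nat.card (MulAction.stabilizer G s) = k :=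
      Nat.eq_of_mul_eq_mul_left (Nat.pos_of_ne_zero fun h => by simp [h] at h2) h3
    have h5 := Subgroup.card_dvd_of_le (inf_le_right : N ⊓ MulAction.stabilizer G s ≤ _)
    rw [h4] at h5
    rcases (Nat.dvd_prime hk).1 h5 with h6 | h6
    · left; simp only [F, h6]; norm_num
    · right; simp only [F, h6]
  have hp : (MulAction.orbit G p).ncard = 30 := by omega
  have hq : (MulAction.orbit G q).ncard = 20 := by omega
  have hr : (MulAction.orbit G r).ncard = 12 := by omega
  have h2 := horder p 2 Nat.prime_two (by omega)
  have h3 := horder q 3 Nat.prime_three (by omega)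
  have h5 := horder r 5 Nat.prime_five (by omega)
  rw [hp, hq, hr] at h1
  have hdvd : Nat.card N ∣ 60 := hcard ▸ N.card_subgroup_dvd_card
  have h7 : Nat.card N ∈ Nat.divisors 60 := by simpa using hdvd
  have h8 : Nat.divisors 60 = {1, 2, 3, 4, 5, 6, 10, 12, 15, 20, 30, 60} := by decide
  rw [h8] at h7
  simp only [Finset.mem_insert, Finset.mem_singleton] at h7
  -- The count reads `2 * (|N| - 1) = 30 a + 20 b + 12 c` with `a ∈ {0, 1}`, `b ∈ {0, 2}`, `c ∈ {0,
  -- 4}`; only 1 and 60 among the divisors of 60 are of this form.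
  have h6 : Nat.card N = 1 ∨ Nat.card N = 60 := by
    push_cast at h1 h2 h3 h5
    omega
  rcases h6 with h6 | h6
  · exact Or.inl (Subgroup.card_eq_one.1 h6)
  · exact Or.inr (Subgroup.eq_top_of_card_eq N (h6.trans hcard.symm))

/-- The order of the group and of its nontrivial stabilizers. -/
theorem card_stabilizer_cases [Nonempty Ω] {s : Ω} (hs : s ∈ exceptionalPoints G Ω) :
    (Nat.card G = 12 ∧ ((MulAction.orbit G s).ncard = 6 ∨ (MulAction.orbit G s).ncard = 4)) ∨
    (Nat.card G = 24 ∧ ((MulAction.orbit G s).ncard = 12 ∨ (MulAction.orbit G s).ncard = 8 ∨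
      (MulAction.orbit G s).ncard = 6)) ∨
    (Nat.card G = 60 ∧ ((MulAction.orbit G s).ncard = 30 ∨ (MulAction.orbit G s).ncard = 20 ∨
      (MulAction.orbit G s).ncard = 12)) := by
  obtain ⟨p, q, r, -, -, -, hT, h⟩ := hG.exists_orbits
  have h1 : MulAction.orbit G s ∈ MulAction.orbit G '' exceptionalPoints G Ω := ⟨s, hs, rfl⟩
  rw [hT] at h1
  rcases h1 with h1 | h1 | h1 <;> rw [h1] <;> omega

end IsPolyhedralAction

end PolyhedralGroups

/-! ### Parity of the branch set and its position among the exceptional points. -/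

section BranchData

theorem even_ncard_of_involution {α : Type*} {s : Set α} (hs : s.Finite) {g : α → α}
    (hmem : ∀ a ∈ s, g a ∈ s) (hgg : ∀ a ∈ s, g (g a) = a) (hne : ∀ a ∈ s, g a ≠ a) :
    Even s.ncard := by
  have h := Finset.sum_involution (s := hs.toFinset) (f := fun _ => (1 : ZMod 2)) (fun a _ => g a)
    (fun _ _ => by decide) (fun a ha _ => hne a (hs.mem_toFinset.1 ha))
    (fun a ha => hs.mem_toFinset.2 (hmem a (hs.mem_toFinset.1 ha)))
    (fun a ha => hgg a (hs.mem_toFinset.1 ha))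
  rw [Finset.sum_const, nsmul_eq_mul, mul_one, ← Set.ncard_eq_toFinset_card s hs] at h
  exact (ZMod.natCast_eq_zero_iff_even).1 h

namespace IsSeparableCurve

variable {K : Type*} [Field K] [Algebra ℂ K] {n : ℕ} {f : ℂ[X]} {x y : K}
  (hc : IsSeparableCurve n f x y)
include hc

theorem eq_of_involutions {a b : Equiv.Perm (OnePoint ℂ)} (ha : a ∈ hc.pointAction.range)
    (hb : b ∈ hc.pointAction.range) (haa : a * a = 1) (hbb : b * b = 1) (ha1 : a ≠ 1) (hb1 : b ≠ 1)
    (hab : a * b = b * a) {p : OnePoint ℂ} (hap : a p = p) (hbp : b p = p) : a = b := by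
  obtain ⟨σ, rfl⟩ := ha
  obtain ⟨τ, rfl⟩ := hb
  obtain ⟨A, hA⟩ := hc.pointAction_eq_smul σ
  obtain ⟨B, hB⟩ := hc.pointAction_eq_smul τ
  refine Equiv.ext fun r => ?_
  rw [hA, hB]
  refine eq_of_involutions_GL (p := p) (by rwa [← hA]) (by rwa [← hB]) (fun r => ?_) (fun r => ?_)
    ?_ ?_ (fun r => ?_) r
  · rw [← hA, ← hA]; exact Equiv.ext_iff.1 haa r
  · rw [← hB, ← hB]; exact Equiv.ext_iff.1 hbb r
  · by_contra! h; exact ha1 (Equiv.ext fun r => (hA r).trans (h r))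
  · by_contra! h; exact hb1 (Equiv.ext fun r => (hB r).trans (h r))
  · rw [← hA, ← hB, ← hA, ← hB]; exact Equiv.ext_iff.1 hab r

theorem apply_mem_branchSet {g : Equiv.Perm (OnePoint ℂ)} (hg : g ∈ hc.pointAction.range)
    {p : OnePoint ℂ} (hp : p ∈ branchSet n f) : g p ∈ branchSet n f := by
  obtain ⟨σ, rfl⟩ := hg
  exact hc.pointAction_mem_branchSet σ hp

/-- On the branch points fixed by `a` the involution `b` acts freely, because distinct commuting
involutions share no fixed point; on the others `a` acts freely. -/
theorem even_ncard_branchSet (hn : 2 ≤ n) {a b : Equiv.Perm (OnePoint ℂ)}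
    (ha : a ∈ hc.pointAction.range) (hb : b ∈ hc.pointAction.range) (haa : a * a = 1)
    (hbb : b * b = 1) (ha1 : a ≠ 1) (hb1 : b ≠ 1) (hab : a * b = b * a) (hne : a ≠ b) :
    Even (branchSet n f).ncard := by
  have hfin := finite_branchSet hn hc.separable
  have haa' : ∀ p, a (a p) = p := Equiv.ext_iff.1 haa
  have hbb' : ∀ p, b (b p) = p := Equiv.ext_iff.1 hbb
  have hab' : ∀ p, a (b p) = b (a p) := Equiv.ext_iff.1 hab
  have h1 : Even {p ∈ branchSet n f | a p = p}.ncard :=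
    even_ncard_of_involution (g := b) (hfin.subset fun p hp => hp.1)
      (fun p hp => ⟨hc.apply_mem_branchSet hb hp.1, by rw [hab', hp.2]⟩) (fun p _ => hbb' p)
      fun p hp h => hne (hc.eq_of_involutions ha hb haa hbb ha1 hb1 hab hp.2 h)
  have h2 : Even {p ∈ branchSet n f | a p ≠ p}.ncard :=
    even_ncard_of_involution (g := a) (hfin.subset fun p hp => hp.1)
      (fun p hp => ⟨hc.apply_mem_branchSet ha hp.1, fun h => hp.2 (a.injective h)⟩)
      (fun p _ => haa' p) fun p hp => hp.2
  have h3 : {p ∈ branchSet n f | a p = p} ∪ {p ∈ branchSet n f | a p ≠ p} = branchSet n f := by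
    ext p
    simp only [Set.mem_union, Set.mem_ofPred_eq]
    tauto
  rw [← h3, Set.ncard_union_eq _ (hfin.subset fun p hp => hp.1) (hfin.subset fun p hp => hp.1)]
  · exact h1.add h2
  · exact Set.disjoint_left.2 fun p hp hp' => hp'.2 hp.2

/-- Parity decides whether `∞` is a branch point, and if it is, the multiplier congruence at two
branch points gives the divisibility. -/
theorem dvd_natDegree_add (hn : 2 ≤ n) (hdc : n ∣ f.natDegree ∨ n.Coprime f.natDegree)
    {a b : Equiv.Perm (OnePoint ℂ)}
    (ha : a ∈ hc.pointAction.range) (hb : b ∈ hc.pointAction.range) (haa : a * a = 1)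
    (hbb : b * b = 1) (ha1 : a ≠ 1) (hb1 : b ≠ 1) (hab : a * b = b * a) (hne : a ≠ b)
    {δ : ℕ} (hδ : δ ≤ 1) (heven : Even (f.natDegree + δ)) (hr : 2 ≤ f.natDegree) :
    n ∣ f.natDegree + δ ∧
      (branchPoints (xLine x)).encard = ((f.natDegree + δ : ℕ) : ℕ∞) := by
  have hfin := finite_branchSet hn hc.separable
  have hB := hc.even_ncard_branchSet hn ha hb haa hbb ha1 hb1 hab hne
  have hcard := ncard_branchSet hn hc.separable
  rw [hc.encard_branchPoints_xLine hn hdc, ← hfin.cast_ncard_eq, Nat.cast_inj]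
  by_cases hd : n ∣ f.natDegree
  · rw [if_pos hd] at hcard
    have h0 : δ = 0 := by
      rw [hcard, add_zero] at hB
      have h1 := (Nat.even_add.1 heven).1 hB
      obtain ⟨k, hk⟩ := h1
      omega
    rw [h0]
    exact ⟨hd, hcard⟩
  · rw [if_neg hd] at hcard
    have h0 : δ = 1 := by
      by_contra h
      have : δ = 0 := by omega
      subst this
      rw [hcard] at hB
      exact (Nat.even_add_one.1 hB) heven
    subst h0
    refine ⟨?_, hcard⟩
    -- The involutions `a` and `b` cannot both fix `∞`.
    obtain ⟨g, ⟨σ, rfl⟩, hg⟩ : ∃ g ∈ hc.pointAction.range, g ∞ ≠ ∞ := by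
      by_contra! h
      exact hne (hc.eq_of_involutions ha hb haa hbb ha1 hb1 hab (h a ha) (h b hb))
    have hinf : ∞ ∈ branchSet n f := infty_mem_branchSet.2 hd
    have hord : ∀ p ∈ branchSet n f, p ≠ ∞ → ordAt p f = 1 := by
      intro p hp hp'
      induction p using OnePoint.rec with
      | infty => exact absurd rfl hp'
      | coe c =>
        rw [ordAt_coe, rootMultiplicity_eq_one hc.separable
          ((coe_mem_branchSet hn hc.separable).1 hp), Nat.cast_one]
    obtain ⟨i, hi⟩ := hc.exists_multiplier σ
    have h1 := hi ∞
    rw [hord _ (hc.pointAction_mem_branchSet σ hinf) hg, ordAt_infty] at h1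
    -- At most two points are `∞` or sent to `∞`, while there are `deg f + 1 ≥ 3` branch points.
    obtain ⟨p, hp, hp1, hp2⟩ : ∃ p ∈ branchSet n f, p ≠ ∞ ∧ hc.pointAction σ p ≠ ∞ := by
      by_contra! h
      have hsub : branchSet n f ⊆ {∞, (hc.pointAction σ).symm ∞} := fun p hp => by
        by_cases hp1 : p = ∞
        · exact Or.inl hp1
        · exact Or.inr ((Equiv.eq_symm_apply _).2 (h p hp hp1))
      have h2 := Set.ncard_le_ncard hsub
      have h3 := Set.ncard_insert_le ∞ {(hc.pointAction σ).symm ∞}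
      rw [Set.ncard_singleton] at h3
      omega
    -- At `p` the congruence says `1 ≡ i`, at `∞` it says `-deg f ≡ i`; the difference is `deg f +
    -- 1`.
    have h2 := hi p
    rw [hord p hp hp1, hord _ (hc.pointAction_mem_branchSet σ hp) hp2] at h2
    have h3 := dvd_sub h2 h1
    rw [show (1 : ℤ) - i * 1 - (-(f.natDegree : ℤ) - i * 1) = ((f.natDegree + 1 : ℕ) : ℤ) by
      push_cast; ring] at h3
    exact Int.natCast_dvd_natCast.1 h3

theorem isPolyhedralAction [Finite hc.pointAction.range]
    (h : ∀ S : Set (OnePoint ℂ), S.Nonempty → S.Finite →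
      (∀ g ∈ hc.pointAction.range, ∀ p ∈ S, g p ∈ S) → 3 ≤ S.ncard) :
    IsPolyhedralAction hc.pointAction.range (OnePoint ℂ) where
  exists_fixed g hg := hc.exists_two_fixedPoints g.2 fun h => hg (Subtype.ext h)
  three_le_ncard S hS hne hinv := h S hne hS fun g hg p hp => hinv ⟨g, hg⟩ p hp

/-- A branch point with trivial stabilizer would have an orbit of full size. Its complement in the
branch set would be invariant and nonempty with at most two points, which is impossible. -/
theorem branchSet_subset_exceptionalPoints [Finite hc.pointAction.range] (hn : 2 ≤ n)
    (hG : IsPolyhedralAction hc.pointAction.range (OnePoint ℂ))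
    (hle : (branchSet n f).ncard ≤ Nat.card hc.pointAction.range + 2)
    (hne : (branchSet n f).ncard ≠ Nat.card hc.pointAction.range) :
    branchSet n f ⊆ exceptionalPoints hc.pointAction.range (OnePoint ℂ) := by
  intro p hp hbot
  have hfin := finite_branchSet hn hc.separable
  have h1 := ncard_orbit_mul_card_stabilizer (G := hc.pointAction.range) p
  rw [hbot, Subgroup.card_bot, mul_one] at h1
  have hsub : MulAction.orbit hc.pointAction.range p ⊆ branchSet n f := by
    rintro _ ⟨g, rfl⟩
    exact hc.apply_mem_branchSet g.2 hp
  have h2 := Set.ncard_sdiff_add_ncard_of_subset hsub hfin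
  have h3 := hG.three_le_ncard (branchSet n f \ MulAction.orbit hc.pointAction.range p)
    (hfin.subset Set.sdiff_subset) (Set.nonempty_of_ncard_ne_zero (by omega)) fun g q hq =>
      ⟨hc.apply_mem_branchSet g.2 hq.1, fun h => hq.2 (by
        rw [← MulAction.orbit_eq_iff] at h ⊢; rwa [MulAction.orbit_smul] at h)⟩
  omega

theorem encard_branchPoints_quotientField_eq_three [Finite hc.pointAction.range] (hn : 2 ≤ n)
    (hdc : n ∣ f.natDegree ∨ n.Coprime f.natDegree)
    (hG : IsPolyhedralAction hc.pointAction.range (OnePoint ℂ))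
    (hB : branchSet n f ⊆ exceptionalPoints hc.pointAction.range (OnePoint ℂ)) :
    (branchPoints (quotientField n x y)).encard = 3 := by
  have := hc.finite_levelNormalizer
  rw [hc.encard_branchPoints_quotientField hn hdc hB]
  obtain ⟨p, q, r, hpq, hpr, hqr, h, -⟩ := hG.exists_orbits
  change (MulAction.orbit hc.pointAction.range ''
    exceptionalPoints hc.pointAction.range (OnePoint ℂ)).encard = 3
  rw [h]
  exact Set.encard_eq_three.2 ⟨_, _, _, hpq, hpr, hqr, rfl⟩

end IsSeparableCurve

/-- Small unions of orbits of nontrivial stabilizers occur only for the tetrahedral group. -/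
theorem IsPolyhedralAction.card_eq_twelve {G Ω : Type*} [Group G] [MulAction G Ω] [Finite G]
    [Nonempty Ω] (hG : IsPolyhedralAction G Ω) {S : Set Ω} (hS : S.Finite) (hne : S.Nonempty)
    (hinv : ∀ g : G, ∀ p ∈ S, g • p ∈ S) (hcard : S.ncard = 4 ∨ S.ncard = 10) :
    Nat.card G = 12 := by
  -- In orders 24 and 60 every orbit has at least six points and none has ten. So a set of four
  -- points contains no orbit, and in a set of ten the complement of an orbit is nonempty with at
  -- most four points.
  have key : ∀ T : Set Ω, T ⊆ S → (∀ g : G, ∀ p ∈ T, g • p ∈ T) → ∀ p ∈ T,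
      (MulAction.orbit G p).ncard ≤ T.ncard ∧ (Nat.card G = 12 ∨ 6 ≤ (MulAction.orbit G p).ncard) ∧
      ((MulAction.orbit G p).ncard = 10 → Nat.card G = 12) := by
    intro T hT hTinv p hp
    refine ⟨Set.ncard_le_ncard (by rintro _ ⟨g, rfl⟩; exact hTinv g p hp) (hS.subset hT), ?_⟩
    by_cases hpe : p ∈ exceptionalPoints G Ω
    · have := hG.card_stabilizer_cases hpe
      omega
    · have h1 := ncard_orbit_mul_card_stabilizer (G := G) p
      rw [not_not.1 hpe, Subgroup.card_bot, mul_one] at h1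
      obtain ⟨_, _, _, -, -, -, -, h⟩ := hG.exists_orbits
      omega
  obtain ⟨p, hp⟩ := hne
  have h1 := key S subset_rfl hinv p hp
  have hsub : MulAction.orbit G p ⊆ S := by rintro _ ⟨g, rfl⟩; exact hinv g p hp
  have hinv' : ∀ g : G, ∀ q ∈ S \ MulAction.orbit G p, g • q ∈ S \ MulAction.orbit G p :=
    fun g q hq => ⟨hinv g q hq.1, fun h => hq.2 (by
        rw [← MulAction.orbit_eq_iff] at h ⊢; rwa [MulAction.orbit_smul] at h)⟩
  have h2 := Set.ncard_sdiff_add_ncard_of_subset hsub hS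
  by_cases hempty : (S \ MulAction.orbit G p).ncard = 0
  · omega
  · obtain ⟨q, hq⟩ := Set.nonempty_of_ncard_ne_zero hempty
    have h3 := key _ Set.sdiff_subset hinv' q hq
    omega

end BranchData

/-! ### Lifting Möbius symmetries of `f` to the curve. -/

section Lifting

variable {K : Type*} [Field K] [Algebra ℂ K]

/-- The polynomial `f`, as a form of degree `m`, is semi-invariant under the Möbius transformation
`M`. -/
def IsSemiInvariant (M : GL (Fin 2) ℂ) (f : ℂ[X]) (m : ℕ) (x : K) : Prop :=
  ∃ κ : ℂ, κ ≠ 0 ∧ aeval (mobius M x) f *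
    (algebraMap ℂ K (M 1 0) * x + algebraMap ℂ K (M 1 1)) ^ m = algebraMap ℂ K κ * aeval x f

theorem IsSemiInvariant.mul {M : GL (Fin 2) ℂ} {f g : ℂ[X]} {m k : ℕ} {x : K}
    (hf : IsSemiInvariant M f m x) (hg : IsSemiInvariant M g k x) :
    IsSemiInvariant M (f * g) (m + k) x := by
  obtain ⟨a, ha, hfa⟩ := hf
  obtain ⟨b, hb, hgb⟩ := hg
  refine ⟨a * b, mul_ne_zero ha hb, ?_⟩
  rw [map_mul, map_mul, map_mul, pow_add, mul_mul_mul_comm, hfa, hgb, mul_mul_mul_comm]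

theorem mobius_inverse {x : K} (hx : Transcendental ℂ x) (M : GL (Fin 2) ℂ) :
    x = (algebraMap ℂ K (M 1 1) * mobius M x - algebraMap ℂ K (M 0 1)) /
      (-algebraMap ℂ K (M 1 0) * mobius M x + algebraMap ℂ K (M 0 0)) := by
  have hden := denom_mobius_ne_zero hx M
  have hdet := M.det_ne_zero
  rw [Matrix.det_fin_two] at hdet
  have hm : mobius M x * (algebraMap ℂ K (M 1 0) * x + algebraMap ℂ K (M 1 1)) =
      algebraMap ℂ K (M 0 0) * x + algebraMap ℂ K (M 0 1) := div_mul_cancel₀ _ hden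
  have h1 : -algebraMap ℂ K (M 1 0) * mobius M x + algebraMap ℂ K (M 0 0) ≠ 0 := by
    intro h
    apply hdet
    apply (algebraMap ℂ K).injective
    rw [map_sub, map_mul, map_mul, map_zero]
    linear_combination (algebraMap ℂ K (M 1 0) * x + algebraMap ℂ K (M 1 1)) * h +
      algebraMap ℂ K (M 1 0) * hm
  rw [eq_div_iff h1]
  linear_combination -hm

theorem transcendental_mobius {x : K} (hx : Transcendental ℂ x) (M : GL (Fin 2) ℂ) :
    Transcendental ℂ (mobius M x) := by
  intro h
  apply hx
  rw [mobius_inverse hx M, div_eq_mul_inv]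
  have halg : ∀ c : ℂ, IsAlgebraic ℂ (algebraMap ℂ K c) := fun c => isAlgebraic_algebraMap c
  exact (((halg _).mul h).sub (halg _)).mul (((halg _).neg.mul h).add (halg _)).inv

/-- With `m = n * e`, the function `κ^(1/n) * y / (c x + d) ^ e` is an `n`-th root of `f` at the
transformed coordinate, and the two together again generate `K`. -/
theorem IsSeparableCurve.exists_lift {n : ℕ} {f : ℂ[X]} {x y : K} (hc : IsSeparableCurve n f x y)
    {M : GL (Fin 2) ℂ} {m : ℕ} (hM : IsSemiInvariant M f m x) (hnm : n ∣ m) :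
    MulAction.toPerm M ∈ hc.pointAction.range := by
  obtain ⟨κ, hκ, h⟩ := hM
  obtain ⟨e, rfl⟩ := hnm
  have hx := hc.transcendental
  have hden := denom_mobius_ne_zero hx M
  set d := algebraMap ℂ K (M 1 0) * x + algebraMap ℂ K (M 1 1) with hd
  obtain ⟨c, hcn⟩ := IsAlgClosed.exists_pow_nat_eq κ (Nat.pos_of_ne_zero hc.level_ne_zero)
  have hc0 : c ≠ 0 := by rintro rfl; exact hκ (hcn ▸ zero_pow hc.level_ne_zero)
  set y' := algebraMap ℂ K c * y / d ^ e with hy'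
  have hmem : ∀ c : ℂ, algebraMap ℂ K c ∈ IntermediateField.adjoin ℂ {mobius M x, y'} :=
    fun c => IntermediateField.algebraMap_mem _ c
  have hu : mobius M x ∈ IntermediateField.adjoin ℂ {mobius M x, y'} :=
    IntermediateField.subset_adjoin _ _ (by simp)
  have hv : y' ∈ IntermediateField.adjoin ℂ {mobius M x, y'} :=
    IntermediateField.subset_adjoin _ _ (by simp)
  have hxmem : x ∈ IntermediateField.adjoin ℂ {mobius M x, y'} := by
    have h1 := div_mem (sub_mem (mul_mem (hmem (M 1 1)) hu) (hmem (M 0 1)))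
      (add_mem (mul_mem (neg_mem (hmem (M 1 0))) hu) (hmem (M 0 0)))
    rwa [← mobius_inverse hx M] at h1
  have hdmem : d ∈ IntermediateField.adjoin ℂ {mobius M x, y'} :=
    add_mem (mul_mem (hmem _) hxmem) (hmem _)
  have hymem : y ∈ IntermediateField.adjoin ℂ {mobius M x, y'} := by
    have h1 : y = y' * d ^ e * (algebraMap ℂ K c)⁻¹ := by
      have : algebraMap ℂ K c ≠ 0 := by simpa using hc0
      rw [hy']
      field_simp
    rw [h1]
    exact mul_mem (mul_mem hv (pow_mem hdmem e)) (inv_mem (hmem c))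
  have heq : y' ^ n = aeval (mobius M x) f := by
    rw [hy', div_pow, mul_pow, ← map_pow, hcn, hc.equation, ← h, ← pow_mul, mul_comm e n]
    exact mul_div_cancel_right₀ _ (pow_ne_zero _ hden)
  obtain ⟨σ, hσ, -⟩ := hc.exists_algEquiv
    (hc.toIsCurveWithEquation.of_mem_adjoin (transcendental_mobius hx M) heq hxmem hymem)
  -- The automorphism with `σ x = M x` acts on points through the inverse of `M`, so `σ⁻¹` realizes
  -- `M`.
  exact ⟨⟨σ, hc.mem_levelNormalizer_of_mobius hσ⟩⁻¹,
    Equiv.ext fun p => hc.pointAction_of_mobius hσ p⟩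

end Lifting

/-! ### Regular differentials on the affine curve. -/

section Genus

variable {K : Type*} [Field K] [Algebra ℂ K]

/-- The differentials that are regular at a valuation ring. -/
noncomputable def regularDifferentials (V : ValuationSubring K) : Submodule ℂ (Ω[K⁄ℂ]) :=
  Submodule.span ℂ {ω | ∃ a ∈ V, ∃ b ∈ V, ω = a • KaehlerDifferential.D ℂ K b}

theorem smul_D_mem_regularDifferentials {V : ValuationSubring K} {a b : K} (ha : a ∈ V)
    (hb : b ∈ V) : a • KaehlerDifferential.D ℂ K b ∈ regularDifferentials V :=
  Submodule.subset_span ⟨a, ha, b, hb, rfl⟩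

theorem smul_mem_regularDifferentials {V : ValuationSubring K} {a : K} (ha : a ∈ V)
    {ω : Ω[K⁄ℂ]} (hω : ω ∈ regularDifferentials V) : a • ω ∈ regularDifferentials V := by
  induction hω using Submodule.span_induction with
  | mem ω h =>
    obtain ⟨b, hb, c, hc, rfl⟩ := h
    rw [smul_smul]
    exact smul_D_mem_regularDifferentials (mul_mem ha hb) hc
  | zero => rw [smul_zero]; exact zero_mem _
  | add ω η _ _ h1 h2 => rw [smul_add]; exact add_mem h1 h2
  | smul c ω _ h => rw [smul_comm]; exact Submodule.smul_mem _ c h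

theorem aeval_mem_of_isPlace {V : ValuationSubring K} (hV : IsPlace V) {x : K} (hx : x ∈ V)
    (A : ℂ[X]) : aeval x A ∈ V := by
  rw [aeval_eq_sum_range]
  refine sum_mem fun i _ => ?_
  rw [Algebra.smul_def]
  exact mul_mem (hV.1 _) (pow_mem hx i)

omit [Algebra ℂ K] in
theorem mem_of_pow_mem {V : ValuationSubring K} {y : K} {n : ℕ} (hn : n ≠ 0) (h : y ^ n ∈ V) :
    y ∈ V := by
  rw [← ValuationSubring.valuation_le_one_iff, map_pow] at h
  exact (V.valuation_le_one_iff y).1 ((pow_le_one_iff hn).1 h)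

theorem D_equation {n : ℕ} {f : ℂ[X]} {x y : K} (h : y ^ n = aeval x f) :
    ((n : K) * y ^ (n - 1)) • KaehlerDifferential.D ℂ K y =
      aeval x (derivative f) • KaehlerDifferential.D ℂ K x := by
  have h1 := congrArg (KaehlerDifferential.D ℂ K) h
  rw [Derivation.leibniz_pow, Derivation.map_aeval] at h1
  rw [← h1, mul_smul, ← Nat.cast_smul_eq_nsmul K]

/-- The differential `dx / y ^ (n - 1)` is regular at the places where `x` and `y` are regular. -/
theorem inv_smul_D_mem_regularDifferentials {n : ℕ} {f : ℂ[X]} {x y : K} (hn : n ≠ 0)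
    (hf : f.Separable) (h : y ^ n = aeval x f) (hy : y ≠ 0) {V : ValuationSubring K}
    (hV : IsPlace V) (hx : x ∈ V) :
    (y ^ (n - 1))⁻¹ • KaehlerDifferential.D ℂ K x ∈ regularDifferentials V := by
  obtain ⟨u, w, huw⟩ := hf
  have hyV : y ∈ V := mem_of_pow_mem hn (h ▸ aeval_mem_of_isPlace hV hx f)
  have h1 := D_equation h
  have h2 := congrArg (aeval x) huw
  rw [map_add, map_mul, map_mul, map_one, ← h] at h2
  have hyn : y ^ n = y ^ (n - 1) * y := by rw [← pow_succ, Nat.sub_add_cancel (by omega)]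
  have hy' : y ^ (n - 1) ≠ 0 := pow_ne_zero _ hy
  -- From `u f + w f' = 1` and `n y^(n-1) dy = f' dx` one gets `dx / y^(n-1) = u y dx + n w dy`,
  -- with regular coefficients.
  have h3 : (y ^ (n - 1))⁻¹ • KaehlerDifferential.D ℂ K x =
      (aeval x u * y) • KaehlerDifferential.D ℂ K x +
      (aeval x w * (n : K)) • KaehlerDifferential.D ℂ K y := by
    have h4 : (aeval x w * (n : K)) • KaehlerDifferential.D ℂ K y =
        ((y ^ (n - 1))⁻¹ * aeval x w * aeval x (derivative f)) • KaehlerDifferential.D ℂ K x := by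
      rw [mul_smul _ (aeval x (derivative f)), ← h1, smul_smul]
      congr 1
      field_simp
    rw [h4, ← add_smul]
    congr 1
    rw [hyn] at h2
    generalize y ^ (n - 1) = Y at *
    field_simp
    linear_combination -h2
  rw [h3]
  refine add_mem (smul_D_mem_regularDifferentials (mul_mem (aeval_mem_of_isPlace hV hx u) hyV) hx)
    (smul_D_mem_regularDifferentials (mul_mem (aeval_mem_of_isPlace hV hx w) ?_) hyV)
  exact natCast_mem V n

end Genus

/-! ### Two independent holomorphic differentials. -/

section GenusBound

variable {K : Type*} [Field K] [Algebra ℂ K] {n : ℕ} {f : ℂ[X]} {x y : K}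

theorem D_eq_zero_of_mem_adjoin {s : Set K} (h : ∀ a ∈ s, KaehlerDifferential.D ℂ K a = 0) {a : K}
    (ha : a ∈ IntermediateField.adjoin ℂ s) : KaehlerDifferential.D ℂ K a = 0 := by
  induction ha using IntermediateField.adjoin_induction with
  | mem a ha => exact h a ha
  | algebraMap c => exact Derivation.map_algebraMap _ c
  | add a b _ _ h1 h2 => rw [map_add, h1, h2, add_zero]
  | inv a _ h1 => rw [Derivation.leibniz_inv, h1, smul_zero]
  | mul a b _ _ h1 h2 => rw [Derivation.leibniz, h1, h2, smul_zero, smul_zero, add_zero]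

theorem algebraMap_smul_D (c : ℂ) (a : K) : KaehlerDifferential.D ℂ K (algebraMap ℂ K c * a) =
    algebraMap ℂ K c • KaehlerDifferential.D ℂ K a := by
  rw [Derivation.leibniz, Derivation.map_algebraMap, smul_zero, add_zero]

namespace IsSeparableCurve

variable (hc : IsSeparableCurve n f x y)
include hc

/-- If `dx = 0`, the equation gives `dy = 0`, so all differentials vanish; then `K` would be
unramified, hence algebraic, over `ℂ`. -/
theorem D_ne_zero : KaehlerDifferential.D ℂ K x ≠ 0 := by
  intro hx
  have hy : KaehlerDifferential.D ℂ K y = 0 := by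
    have h := D_equation hc.equation
    rw [hx, smul_zero] at h
    have : CharZero K := charZero_of_injective_algebraMap (algebraMap ℂ K).injective
    exact (smul_eq_zero.1 h).resolve_left
      (mul_ne_zero (Nat.cast_ne_zero.2 hc.level_ne_zero) (pow_ne_zero _ hc.y_ne_zero))
  have hD : ∀ a : K, KaehlerDifferential.D ℂ K a = 0 := fun a =>
    D_eq_zero_of_mem_adjoin (s := {x, y}) (by rintro _ (rfl | rfl) <;> assumption)
      (by rw [hc.generate]; trivial)
  have hsub : Subsingleton (Ω[K⁄ℂ]) := by
    rw [← Submodule.subsingleton_iff K, ← subsingleton_iff_bot_eq_top,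
      ← KaehlerDifferential.span_range_derivation, eq_comm, Submodule.span_eq_bot]
    rintro _ ⟨a, rfl⟩
    exact hD a
  have hess : Algebra.EssFiniteType ℂ K :=
    IntermediateField.fg_top_iff.1 (by classical exact ⟨{x, y}, by simpa using hc.generate⟩)
  have hunr : Algebra.FormallyUnramified ℂ K := ⟨hsub⟩
  have hsep := Algebra.FormallyUnramified.isSeparable ℂ K
  exact hc.transcendental (hsep.isAlgebraic.isAlgebraic x)

/-- If the curve has the automorphism `x ↦ ε / x` and `3 ≤ (n - 1) * e`, then `dx / y ^ (n - 1)` and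
`x dx / y ^ (n - 1)` are regular everywhere. -/
theorem smul_D_mem_holomorphicDifferentials {e : ℕ} {ε κ : ℂ} (hε : ε ≠ 0) (hκ : κ ≠ 0)
    (h : aeval (algebraMap ℂ K ε / x) f * x ^ (n * e) = algebraMap ℂ K κ * aeval x f)
    (he : 3 ≤ e * (n - 1)) {j : ℕ} (hj : j ≤ 1) :
    (x ^ j * (y ^ (n - 1))⁻¹) • KaehlerDifferential.D ℂ K x ∈ holomorphicDifferentials K := by
  have := hc.isAlgebraic_xLine
  simp only [holomorphicDifferentials, Submodule.mem_iInf]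
  intro V hV
  change _ ∈ regularDifferentials V
  by_cases hx : x ∈ V
  · rw [mul_smul]
    exact smul_mem_regularDifferentials (pow_mem hx j) (inv_smul_D_mem_regularDifferentials
      hc.level_ne_zero hc.separable hc.equation hc.y_ne_zero hV hx)
  have hx0 := transcendental_ne_zero hc.transcendental
  have hy0 := hc.y_ne_zero
  obtain ⟨c, hcn⟩ := IsAlgClosed.exists_pow_nat_eq κ (Nat.pos_of_ne_zero hc.level_ne_zero)
  have hc0 : c ≠ 0 := by rintro rfl; exact hκ (hcn ▸ zero_pow hc.level_ne_zero)
  have hc0' : algebraMap ℂ K c ≠ 0 := by simpa using hc0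
  have hε' : algebraMap ℂ K ε ≠ 0 := by simpa using hε
  -- The functions `z` and `w` satisfy the equation of the curve, and `z` is regular where `x` has a
  -- pole, so `dz / w ^ (n - 1)` is regular there.
  set z := algebraMap ℂ K ε / x with hz
  set w := algebraMap ℂ K c * y / x ^ e with hw
  have hw0 : w ≠ 0 := div_ne_zero (mul_ne_zero hc0' hy0) (pow_ne_zero _ hx0)
  have hz0 : z ≠ 0 := div_ne_zero hε' hx0
  have hzV : z ∈ V := by
    rw [hz, div_eq_mul_inv]
    exact mul_mem (hV.1 ε) ((V.mem_or_inv_mem x).resolve_left hx)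
  have heq : w ^ n = aeval z f := by
    rw [hw, div_pow, mul_pow, ← map_pow, hcn, hc.equation, ← h, ← pow_mul, mul_comm e n]
    exact mul_div_cancel_right₀ _ (pow_ne_zero _ hx0)
  have hreg := inv_smul_D_mem_regularDifferentials hc.level_ne_zero hc.separable heq hw0 hV hzV
  have hxz : x = algebraMap ℂ K ε * z⁻¹ := by rw [hz]; field_simp
  have hDx : KaehlerDifferential.D ℂ K x =
      (-algebraMap ℂ K ε * z⁻¹ ^ 2) • KaehlerDifferential.D ℂ K z := by
    conv_lhs => rw [hxz]
    rw [algebraMap_smul_D, Derivation.leibniz_inv, smul_smul, mul_neg, neg_mul]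
  -- Up to a constant, `x^j dx / y^(n-1)` is `z^k dz / w^(n-1)` with `k = e (n - 1) - 2 - j`; the
  -- bound `3 ≤ e (n - 1)` makes `k` nonnegative for `j ≤ 1`.
  obtain ⟨k, hk⟩ := Nat.exists_eq_add_of_le (show 2 + j ≤ e * (n - 1) by omega)
  have hy : (y ^ (n - 1))⁻¹ = algebraMap ℂ K c ^ (n - 1) * (w ^ (n - 1))⁻¹ *
      (x ^ (e * (n - 1)))⁻¹ := by
    rw [hw, pow_mul, div_pow, mul_pow]
    have h1 : y ^ (n - 1) ≠ 0 := pow_ne_zero _ hy0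
    have h2 : algebraMap ℂ K c ^ (n - 1) ≠ 0 := pow_ne_zero _ hc0'
    have h3 : (x ^ e) ^ (n - 1) ≠ 0 := pow_ne_zero _ (pow_ne_zero _ hx0)
    generalize y ^ (n - 1) = Y at *
    generalize algebraMap ℂ K c ^ (n - 1) = C at *
    generalize (x ^ e) ^ (n - 1) = X at *
    field_simp
  have key : (x ^ j * (y ^ (n - 1))⁻¹) • KaehlerDifferential.D ℂ K x =
      (-algebraMap ℂ K ε * algebraMap ℂ K c ^ (n - 1) * (algebraMap ℂ K ε⁻¹) ^ (2 + k) * z ^ k) •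
        ((w ^ (n - 1))⁻¹ • KaehlerDifferential.D ℂ K z) := by
    rw [hDx, hy, hk, smul_smul, smul_smul]
    congr 1
    have h3 : w ^ (n - 1) ≠ 0 := pow_ne_zero _ hw0
    generalize w ^ (n - 1) = W at *
    generalize algebraMap ℂ K c ^ (n - 1) = C at *
    rw [hz, map_inv₀]
    simp only [div_pow, pow_add, inv_pow, inv_div]
    field_simp
  rw [key]
  refine smul_mem_regularDifferentials (mul_mem (mul_mem (mul_mem (neg_mem (hV.1 ε))
    (pow_mem (hV.1 c) _)) (pow_mem (hV.1 _) _)) (pow_mem hzV k)) hreg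

theorem two_le_genus {e : ℕ} {ε κ : ℂ} (hε : ε ≠ 0) (hκ : κ ≠ 0)
    (h : aeval (algebraMap ℂ K ε / x) f * x ^ (n * e) = algebraMap ℂ K κ * aeval x f)
    (he : 3 ≤ e * (n - 1)) : 2 ≤ curveGenus K := by
  let ω (j : ℕ) (hj : j ≤ 1) : holomorphicDifferentials K :=
    ⟨(x ^ j * (y ^ (n - 1))⁻¹) • KaehlerDifferential.D ℂ K x,
      hc.smul_D_mem_holomorphicDifferentials hε hκ h he hj⟩
  have hω : LinearIndependent ℂ ![ω 0 zero_le_one, ω 1 le_rfl] := by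
    rw [LinearIndependent.pair_iff]
    intro s t hst
    have h1 := congrArg Subtype.val hst
    have h2 : ((algebraMap ℂ K t * x + algebraMap ℂ K s) * (y ^ (n - 1))⁻¹) •
        KaehlerDifferential.D ℂ K x = 0 := by
      have hsm : ∀ (c : ℂ) (a : K), c • (a • KaehlerDifferential.D ℂ K x) =
          (algebraMap ℂ K c * a) • KaehlerDifferential.D ℂ K x := fun c a => by
        rw [mul_smul, algebraMap_smul]
      refine Eq.trans ?_ h1
      simp only [ω, Submodule.coe_add, Submodule.coe_smul, pow_zero,
        pow_one, hsm, ← add_smul]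
      congr 1
      ring
    have h3 := (smul_eq_zero.1 h2).resolve_right hc.D_ne_zero
    by_contra hne
    refine mul_ne_zero (linear_ne_zero hc.transcendental ?_)
      (inv_ne_zero (pow_ne_zero _ hc.y_ne_zero)) h3
    by_contra! h4
    exact hne ⟨h4.2, h4.1⟩
  simpa [curveGenus] using hω.cardinal_lift_le_rank

end IsSeparableCurve

end GenusBound

/-! ### Separability and coprimality of the listed polynomials. -/

section Polynomials

theorem isCoprime_of_eval {f g : ℂ[X]} (h : ∀ a, f.eval a = 0 → g.eval a = 0 → False) :
    IsCoprime f g := by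
  rw [isCoprime_iff_aeval_ne_zero_of_isAlgClosed ℂ ℂ]
  intro a
  by_contra! h1
  exact h a (by simpa [coe_aeval_eq_eval] using h1.1) (by simpa [coe_aeval_eq_eval] using h1.2)

theorem IsCoprime.eval_ne_zero {f g : ℂ[X]} (h : IsCoprime f g) {a : ℂ} (hf : f.eval a = 0) :
    g.eval a ≠ 0 := by
  obtain ⟨u, v, huv⟩ := h
  intro hg
  have := congrArg (eval a) huv
  simp [hf, hg] at this

/-- At a multiple root `a` the chain rule and separability of `h` force `k * a ^ (k - 1) = 0`, so `a
= 0`, which is not a root. -/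
theorem Polynomial.Separable.comp_X_pow {h : ℂ[X]} (hh : h.Separable) (h0 : h.eval 0 ≠ 0) {k : ℕ}
    (hk : k ≠ 0) : (h.comp (X ^ k)).Separable := by
  refine isCoprime_of_eval fun a h1 h2 => ?_
  rw [eval_comp, eval_pow, eval_X] at h1
  have h3 := IsCoprime.eval_ne_zero hh h1
  rw [derivative_comp, eval_mul, eval_comp, derivative_X_pow, eval_pow, eval_X] at h2
  have h4 := (mul_eq_zero.1 h2).resolve_right h3
  have h5 : a = 0 := by
    simp only [eval_mul, eval_C, eval_pow, eval_X, mul_eq_zero, Nat.cast_eq_zero, hk, false_or] at h4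
    exact eq_zero_of_pow_eq_zero h4
  rw [h5, zero_pow hk] at h1
  exact h0 h1

theorem IsCoprime.comp_X_pow {f g : ℂ[X]} (h : IsCoprime f g) (k : ℕ) :
    IsCoprime (f.comp (X ^ k)) (g.comp (X ^ k)) :=
  h.map (compRingHom (X ^ k))

theorem isCoprime_X_of_eval_ne_zero {f : ℂ[X]} (h : f.eval 0 ≠ 0) : IsCoprime X f :=
  isCoprime_of_eval fun a h1 h2 => h (by rw [eval_X] at h1; rwa [h1] at h2)

theorem sqrt_three_mul_I_sq : (Complex.I * (Real.sqrt 3 : ℂ)) ^ 2 = -3 := by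
  rw [mul_pow, Complex.I_sq, ← Complex.ofReal_pow, Real.sq_sqrt (by norm_num)]
  norm_num

/-- Up to a factor `X`, the listed polynomials are polynomials in a power of `X`; separability and
coprimality thereby reduce to Bézout identities of low degree. -/
theorem p4_eq : p4 = (X ^ 2 + C (2 * (Complex.I * (Real.sqrt 3 : ℂ))) * X + 1 : ℂ[X]).comp
    (X ^ 2) := by
  simp [p4]
  ring

theorem r4_eq : r4 = (X ^ 3 - 33 * X ^ 2 - 33 * X + 1 : ℂ[X]).comp (X ^ 4) := by
  simp [r4]
  ring

theorem s4_eq : s4 = (X ^ 2 + 14 * X + 1 : ℂ[X]).comp (X ^ 4) := by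
  simp [s4]
  ring

theorem t4_eq : t4 = X * (X - 1 : ℂ[X]).comp (X ^ 4) := by
  simp [t4]

theorem r5_eq : r5 = (X ^ 4 - 228 * X ^ 3 + 494 * X ^ 2 + 228 * X + 1 : ℂ[X]).comp (X ^ 5) := by
  simp [r5]
  ring

theorem s5_eq : s5 = X * (X ^ 2 + 11 * X - 1 : ℂ[X]).comp (X ^ 5) := by
  simp [s5]
  ring

theorem t5_eq : t5 = (X ^ 6 + 522 * X ^ 5 - 10005 * X ^ 4 - 10005 * X ^ 2 - 522 * X + 1 :
    ℂ[X]).comp (X ^ 5) := by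
  simp [t5]
  ring

theorem separable_p4 : p4.Separable := by
  rw [p4_eq]
  refine Separable.comp_X_pow (isCoprime_of_eval fun u h1 h2 => ?_) (by simp) (by norm_num)
  have hw := sqrt_three_mul_I_sq
  generalize Complex.I * (Real.sqrt 3 : ℂ) = w at *
  simp at h1 h2
  -- The derivative gives `u = -w`, where the quadratic takes the value `1 - w² = 4`.
  have : (4 : ℂ) = 0 := by linear_combination h1 - (u + w) / 2 * h2 + hw
  norm_num at this

theorem separable_r4 : r4.Separable := by
  rw [r4_eq]
  refine Separable.comp_X_pow (isCoprime_of_eval fun u h1 h2 => ?_) (by simp) (by norm_num)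
  simp at h1 h2
  refine one_ne_zero (α := ℂ) ?_
  -- The coefficients are those of a Bézout identity for the cubic and its derivative, evaluated at
  -- `u`; the later certificates are of the same kind.
  linear_combination (247/2304 + (-11/2304) * u) * h1 +
    (-187/6912 + (-23/432) * u + (11/6912) * u ^ 2) * h2

theorem separable_s4 : s4.Separable := by
  rw [s4_eq]
  refine Separable.comp_X_pow (isCoprime_of_eval fun u h1 h2 => ?_) (by simp) (by norm_num)
  simp at h1 h2
  refine one_ne_zero (α := ℂ) ?_
  linear_combination (-1/48) * h1 + (7/96 + (1/96) * u) * h2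

theorem separable_t4 : t4.Separable := by
  rw [t4_eq]
  refine separable_X.mul (Separable.comp_X_pow (isCoprime_of_eval fun u h1 h2 => ?_) (by simp)
    (by norm_num)) (isCoprime_X_of_eval_ne_zero (by simp))
  simp at h2

theorem separable_r5 : r5.Separable := by
  rw [r5_eq]
  refine Separable.comp_X_pow (isCoprime_of_eval fun u h1 h2 => ?_) (by simp) (by norm_num)
  simp at h1 h2
  refine one_ne_zero (α := ℂ) ?_
  linear_combination
    (-12039/312500 + (11381/468750) * u + (-133/937500) * u ^ 2) * h1 +
    (17081/3750000 + (70051/3750000) * u + (-30343/3750000) * u ^ 2 +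
      (133/3750000) * u ^ 3) * h2

theorem separable_s5 : s5.Separable := by
  rw [s5_eq]
  refine separable_X.mul (Separable.comp_X_pow (isCoprime_of_eval fun u h1 h2 => ?_) (by simp)
    (by norm_num)) (isCoprime_X_of_eval_ne_zero (by simp))
  simp at h1 h2
  refine one_ne_zero (α := ℂ) ?_
  linear_combination (-4/125) * h1 + (11/125 + (2/125) * u) * h2

theorem separable_t5 : t5.Separable := by
  rw [t5_eq]
  refine Separable.comp_X_pow (isCoprime_of_eval fun u h1 h2 => ?_) (by simp) (by norm_num)
  simp at h1 h2
  refine one_ne_zero (α := ℂ) ?_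
  linear_combination
    (1497581651/11718750000 + (-231274681/35156250000) * u + (2986915639/11718750000) * u ^ 2 +
      (-583384039/35156250000) * u ^ 3 + (-55883/1464843750) * u ^ 4) * h1 +
    (-352454081/210937500000 + (-373566341/5859375000) * u + (173263081/105468750000) * u ^ 2 +
      (-1119718507/17578125000) * u ^ 3 + (700067743/210937500000) * u ^ 4 +
      (55883/8789062500) * u ^ 5) * h2

theorem isCoprime_t4_p4 : IsCoprime t4 p4 := by
  refine isCoprime_of_eval fun u h1 h2 => ?_
  have hw := sqrt_three_mul_I_sq
  rw [p4_eq] at h2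
  generalize Complex.I * (Real.sqrt 3 : ℂ) = w at *
  simp [t4] at h1 h2
  rcases h1 with rfl | h1
  · simp at h2
  · have : (4 : ℂ) = 0 := by
      -- From `u⁴ = 1` the quartic becomes `w u² = -1`, and squaring gives `-3 = 1`.
      linear_combination (-(w * u ^ 2 - 1) / 2) * (h2 - h1) + u ^ 4 * hw - 3 * h1
    norm_num at this

theorem isCoprime_r4_s4 : IsCoprime r4 s4 := by
  rw [r4_eq, s4_eq]
  refine IsCoprime.comp_X_pow (isCoprime_of_eval fun u h1 h2 => ?_) 4
  simp at h1 h2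
  refine one_ne_zero (α := ℂ) ?_
  linear_combination (181/576 + (13/576) * u) * h1 +
    (395/576 + (215/288) * u + (-13/576) * u ^ 2) * h2

theorem isCoprime_r4_t4 : IsCoprime r4 t4 := by
  rw [r4_eq, t4_eq]
  refine (isCoprime_X_of_eval_ne_zero (by simp)).symm.mul_right
    (IsCoprime.comp_X_pow (isCoprime_of_eval fun u h1 h2 => ?_) 4)
  simp at h1 h2
  refine one_ne_zero (α := ℂ) ?_
  linear_combination (-1/64) * h1 + (-65/64 + (-1/2) * u + (1/64) * u ^ 2) * h2

theorem isCoprime_s4_t4 : IsCoprime s4 t4 := by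
  rw [s4_eq, t4_eq]
  refine (isCoprime_X_of_eval_ne_zero (by simp)).symm.mul_right
    (IsCoprime.comp_X_pow (isCoprime_of_eval fun u h1 h2 => ?_) 4)
  simp at h1 h2
  refine one_ne_zero (α := ℂ) ?_
  linear_combination (1/16) * h1 + (-15/16 + (-1/16) * u) * h2

theorem isCoprime_r5_s5 : IsCoprime r5 s5 := by
  rw [r5_eq, s5_eq]
  refine (isCoprime_X_of_eval_ne_zero (by simp)).symm.mul_right
    (IsCoprime.comp_X_pow (isCoprime_of_eval fun u h1 h2 => ?_) 5)
  simp at h1 h2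
  refine one_ne_zero (α := ℂ) ?_
  linear_combination (122/3125 + (11/3125) * u) * h1 +
    (-3003/3125 + (-5206/3125) * u + (2507/3125) * u ^ 2 + (-11/3125) * u ^ 3) * h2

theorem isCoprime_r5_t5 : IsCoprime r5 t5 := by
  rw [r5_eq, t5_eq]
  refine IsCoprime.comp_X_pow (isCoprime_of_eval fun u h1 h2 => ?_) 5
  simp at h1 h2
  refine one_ne_zero (α := ℂ) ?_
  linear_combination
    (316810441/468750000 + (20237705983/1406250000) * u + (-2158102/29296875) * u ^ 2 +
      (10118554411/703125000) * u ^ 3 + (-117284191/156250000) * u ^ 4 +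
      (-2022161/1406250000) * u ^ 5) * h1 +
    (151939559/468750000 + (1001301767/1406250000) * u + (-153687677/468750000) * u ^ 2 +
      (2022161/1406250000) * u ^ 3) * h2

theorem isCoprime_s5_t5 : IsCoprime s5 t5 := by
  rw [s5_eq, t5_eq]
  refine (isCoprime_X_of_eval_ne_zero (by simp)).mul_left
    (IsCoprime.comp_X_pow (isCoprime_of_eval fun u h1 h2 => ?_) 5)
  simp at h1 h2
  refine one_ne_zero (α := ℂ) ?_
  linear_combination
    (-1968252/1953125 + (-13755842/1953125) * u + (-1224871/1953125) * u ^ 2 +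
      (-13582603/1953125) * u ^ 3 + (712131/1953125) * u ^ 4 + (1364/1953125) * u ^ 5) * h1 +
    (-15127/1953125 + (-1364/1953125) * u) * h2

open Classical in
/-- A monic separable polynomial which is the dehomogenization of a form of degree `m` without
multiple factors. -/
structure IsReducedForm (f : ℂ[X]) (m : ℕ) : Prop where
  monic : f.Monic
  separable : f.Separable
  -- The extra `1` is a simple zero of the form at infinity. For the forms in question an inversion
  -- exchanges `0` and `∞`, so it is present exactly when `f` vanishes at `0`.
  natDegree_add : f.natDegree + (if f.eval 0 = 0 then 1 else 0) = m

theorem IsReducedForm.mul {f g : ℂ[X]} {a b : ℕ} (hf : IsReducedForm f a) (hg : IsReducedForm g b)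
    (h : IsCoprime f g) : IsReducedForm (f * g) (a + b) := by
  classical
  refine ⟨hf.monic.mul hg.monic, hf.separable.mul hg.separable h, ?_⟩
  rw [hf.monic.natDegree_mul hg.monic, ← hf.natDegree_add, ← hg.natDegree_add]
  by_cases hf0 : f.eval 0 = 0
  · have hg0 := IsCoprime.eval_ne_zero h hf0
    simp only [eval_mul, hf0, hg0, zero_mul, if_true, if_false]
    ring
  · by_cases hg0 : g.eval 0 = 0
    · simp only [eval_mul, hf0, hg0, mul_zero, if_true, if_false]
      ring
    · simp [eval_mul, hf0, hg0]

theorem isReducedForm_p4 : IsReducedForm p4 4 := by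
  have h : p4.natDegree = 4 := by unfold p4; compute_degree!
  refine ⟨by unfold p4; monicity!, separable_p4, by simp [h]; simp [p4]⟩

theorem isReducedForm_r4 : IsReducedForm r4 12 := by
  have h : r4.natDegree = 12 := by unfold r4; compute_degree!
  refine ⟨by unfold r4; monicity!, separable_r4, by simp [h]; simp [r4]⟩

theorem isReducedForm_s4 : IsReducedForm s4 8 := by
  have h : s4.natDegree = 8 := by unfold s4; compute_degree!
  refine ⟨by unfold s4; monicity!, separable_s4, by simp [h]; simp [s4]⟩

theorem isReducedForm_t4 : IsReducedForm t4 6 := by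
  have h : t4 = X ^ 5 - X := by unfold t4; ring
  have h1 : t4.natDegree = 5 := by rw [h]; compute_degree!
  refine ⟨by rw [h]; monicity!, separable_t4, by simp [h1]; simp [t4]⟩

theorem isReducedForm_r5 : IsReducedForm r5 20 := by
  have h : r5.natDegree = 20 := by unfold r5; compute_degree!
  refine ⟨by unfold r5; monicity!, separable_r5, by simp [h]; simp [r5]⟩

theorem isReducedForm_s5 : IsReducedForm s5 12 := by
  have h : s5 = X ^ 11 + 11 * X ^ 6 - X := by unfold s5; ring
  have h1 : s5.natDegree = 11 := by rw [h]; compute_degree!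
  refine ⟨by rw [h]; monicity!, separable_s5, by simp [h1]; simp [s5]⟩

theorem isReducedForm_t5 : IsReducedForm t5 30 := by
  have h : t5.natDegree = 30 := by unfold t5; compute_degree!
  refine ⟨by unfold t5; monicity!, separable_t5, by simp [h]; simp [t5]⟩

end Polynomials

/-! ### Semi-invariance under rotations, inversions and the polyhedral generators. -/

section SemiInvariance

variable {K : Type*} [Field K] [Algebra ℂ K]

/-- The invertible matrix with the given entries. -/
noncomputable def glMk (a b c d : ℂ) (h : a * d - b * c ≠ 0) : GL (Fin 2) ℂ :=
  Matrix.GeneralLinearGroup.mkOfDetNeZero !![a, b; c, d] (by rwa [Matrix.det_fin_two_of])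

section Entries

variable {a b c d : ℂ} (h : a * d - b * c ≠ 0)

@[simp] theorem glMk_zero_zero : glMk a b c d h 0 0 = a := rfl

@[simp] theorem glMk_zero_one : glMk a b c d h 0 1 = b := rfl

@[simp] theorem glMk_one_zero : glMk a b c d h 1 0 = c := rfl

@[simp] theorem glMk_one_one : glMk a b c d h 1 1 = d := rfl

end Entries

theorem isSemiInvariant_glMk {a b c d : ℂ} (h : a * d - b * c ≠ 0) {f : ℂ[X]} {m : ℕ} {x : K}
    {κ : ℂ} (hκ : κ ≠ 0) (heq : aeval ((algebraMap ℂ K a * x + algebraMap ℂ K b) /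
      (algebraMap ℂ K c * x + algebraMap ℂ K d)) f *
      (algebraMap ℂ K c * x + algebraMap ℂ K d) ^ m = algebraMap ℂ K κ * aeval x f) :
    IsSemiInvariant (glMk a b c d h) f m x := ⟨κ, hκ, heq⟩

variable {N D : K} (hD : D ≠ 0)

theorem aeval_p4 (x : K) : aeval x p4 = x ^ 4 +
    2 * (algebraMap ℂ K Complex.I * algebraMap ℂ K (Real.sqrt 3 : ℂ)) * x ^ 2 + 1 := by
  simp [p4, map_ofNat, mul_assoc]

theorem aeval_r4 (x : K) : aeval x r4 = x ^ 12 - 33 * x ^ 8 - 33 * x ^ 4 + 1 := by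
  simp [r4, map_ofNat]

theorem aeval_s4 (x : K) : aeval x s4 = x ^ 8 + 14 * x ^ 4 + 1 := by
  simp [s4, map_ofNat]

theorem aeval_t4 (x : K) : aeval x t4 = x * (x ^ 4 - 1) := by
  simp [t4]

theorem aeval_r5 (x : K) :
    aeval x r5 = x ^ 20 - 228 * x ^ 15 + 494 * x ^ 10 + 228 * x ^ 5 + 1 := by
  simp [r5, map_ofNat]

theorem aeval_s5 (x : K) : aeval x s5 = x * (x ^ 10 + 11 * x ^ 5 - 1) := by
  simp [s5, map_ofNat]

theorem aeval_t5 (x : K) : aeval x t5 =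
    x ^ 30 + 522 * x ^ 25 - 10005 * x ^ 20 - 10005 * x ^ 10 - 522 * x ^ 5 + 1 := by
  simp [t5, map_ofNat]

include hD

theorem aeval_div_p4 : aeval (N / D) p4 * D ^ 4 = N ^ 4 +
    2 * (algebraMap ℂ K Complex.I * algebraMap ℂ K (Real.sqrt 3 : ℂ)) * N ^ 2 * D ^ 2 + D ^ 4 := by
  rw [aeval_p4]; field_simp

theorem aeval_div_r4 : aeval (N / D) r4 * D ^ 12 =
    N ^ 12 - 33 * N ^ 8 * D ^ 4 - 33 * N ^ 4 * D ^ 8 + D ^ 12 := by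
  rw [aeval_r4]; field_simp

theorem aeval_div_s4 : aeval (N / D) s4 * D ^ 8 = N ^ 8 + 14 * N ^ 4 * D ^ 4 + D ^ 8 := by
  rw [aeval_s4]; field_simp

theorem aeval_div_t4 : aeval (N / D) t4 * D ^ 6 = N * D * (N ^ 4 - D ^ 4) := by
  rw [aeval_t4]; field_simp

theorem aeval_div_r5 : aeval (N / D) r5 * D ^ 20 = N ^ 20 - 228 * N ^ 15 * D ^ 5 +
    494 * N ^ 10 * D ^ 10 + 228 * N ^ 5 * D ^ 15 + D ^ 20 := by
  rw [aeval_r5]; field_simp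

theorem aeval_div_s5 : aeval (N / D) s5 * D ^ 12 =
    N * D * (N ^ 10 + 11 * N ^ 5 * D ^ 5 - D ^ 10) := by
  rw [aeval_s5]; field_simp

theorem aeval_div_t5 : aeval (N / D) t5 * D ^ 30 = N ^ 30 + 522 * N ^ 25 * D ^ 5 -
    10005 * N ^ 20 * D ^ 10 - 10005 * N ^ 10 * D ^ 20 - 522 * N ^ 5 * D ^ 25 + D ^ 30 := by
  rw [aeval_t5]; field_simp

omit hD

/-- The rotation `x ↦ ζ x`. -/
noncomputable def rotationGL (ζ : ℂ) (hζ : ζ ≠ 0) : GL (Fin 2) ℂ :=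
  glMk ζ 0 0 1 (by simpa using hζ)

/-- The map `x ↦ ε / x`. -/
noncomputable def inversionGL (ε : ℂ) (hε : ε ≠ 0) : GL (Fin 2) ℂ :=
  glMk 0 ε 1 0 (by simpa using hε)

/-- The map `x ↦ (x + i) / (x - i)` of order three. -/
noncomputable def octahedralGL : GL (Fin 2) ℂ :=
  glMk 1 Complex.I 1 (-Complex.I) (by
    intro h
    apply Complex.I_ne_zero
    linear_combination (-1 / 2) * h)

theorem goldenRatio_sq_complex : (Real.goldenRatio : ℂ) ^ 2 = Real.goldenRatio + 1 := by
  rw [← Complex.ofReal_pow, Real.goldenRatio_sq]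
  norm_num

theorem goldenRatio_add_two_ne_zero : (Real.goldenRatio : ℂ) + 2 ≠ 0 := by
  have h := Real.goldenRatio_pos
  have h1 : Real.goldenRatio + 2 ≠ 0 := by positivity
  exact_mod_cast h1

/-- The map `x ↦ (1 - φ x) / (x + φ)` with the golden ratio `φ`. -/
noncomputable def icosahedralGL : GL (Fin 2) ℂ :=
  glMk (-Real.goldenRatio) 1 1 Real.goldenRatio (by
    intro h
    apply goldenRatio_add_two_ne_zero
    linear_combination -h - goldenRatio_sq_complex)

section Rotations

variable {ζ : ℂ} (hζ : ζ ≠ 0) (x : K)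

theorem isSemiInvariant_rotation {f : ℂ[X]} {m : ℕ} {κ : ℂ} (hκ : κ ≠ 0)
    (h : aeval (algebraMap ℂ K ζ * x) f = algebraMap ℂ K κ * aeval x f) :
    IsSemiInvariant (rotationGL ζ hζ) f m x :=
  isSemiInvariant_glMk _ hκ (by simpa using h)

theorem isSemiInvariant_inversion {f : ℂ[X]} {m : ℕ} {ε κ : ℂ} (hε : ε ≠ 0) (hκ : κ ≠ 0)
    (h : aeval (algebraMap ℂ K ε / x) f * x ^ m = algebraMap ℂ K κ * aeval x f) :
    IsSemiInvariant (inversionGL ε hε) f m x :=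
  isSemiInvariant_glMk _ hκ (by simpa using h)

theorem rotation_p4 : IsSemiInvariant (rotationGL (-1) (by simp)) p4 4 x :=
  isSemiInvariant_rotation _ x one_ne_zero (by
    rw [aeval_p4, aeval_p4, map_neg, map_one]; ring)

theorem rotation_t4' : IsSemiInvariant (rotationGL (-1) (by simp)) t4 6 x :=
  isSemiInvariant_rotation _ x (neg_ne_zero.2 one_ne_zero) (by
    rw [aeval_t4, aeval_t4, map_neg, map_one]; ring)

theorem algebraMap_I_sq : algebraMap ℂ K Complex.I ^ 2 = -1 := by
  rw [← map_pow, Complex.I_sq, map_neg, map_one]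

theorem algebraMap_I_pow_four : algebraMap ℂ K Complex.I ^ 4 = 1 := by
  rw [← map_pow, Complex.I_pow_four, map_one]

theorem rotation_r4 : IsSemiInvariant (rotationGL Complex.I Complex.I_ne_zero) r4 12 x :=
  isSemiInvariant_rotation _ x one_ne_zero (by
    rw [aeval_r4, aeval_r4, map_one]
    have h := algebraMap_I_pow_four (K := K)
    generalize algebraMap ℂ K Complex.I = i at *
    linear_combination ((i ^ 8 + i ^ 4 + 1) * x ^ 12 - 33 * (i ^ 4 + 1) * x ^ 8 - 33 * x ^ 4) * h)

theorem rotation_s4 : IsSemiInvariant (rotationGL Complex.I Complex.I_ne_zero) s4 8 x :=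
  isSemiInvariant_rotation _ x one_ne_zero (by
    rw [aeval_s4, aeval_s4, map_one]
    have h := algebraMap_I_pow_four (K := K)
    generalize algebraMap ℂ K Complex.I = i at *
    linear_combination ((i ^ 4 + 1) * x ^ 8 + 14 * x ^ 4) * h)

theorem rotation_t4 : IsSemiInvariant (rotationGL Complex.I Complex.I_ne_zero) t4 6 x :=
  isSemiInvariant_rotation _ x Complex.I_ne_zero (by
    rw [aeval_t4, aeval_t4]
    have h := algebraMap_I_pow_four (K := K)
    generalize algebraMap ℂ K Complex.I = i at *
    linear_combination (i * x ^ 5) * h)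

theorem rotation_r5 (h5 : ζ ^ 5 = 1) : IsSemiInvariant (rotationGL ζ hζ) r5 20 x :=
  isSemiInvariant_rotation _ x one_ne_zero (by
    have h : algebraMap ℂ K ζ ^ 5 = 1 := by rw [← map_pow, h5, map_one]
    have h1 : (algebraMap ℂ K ζ * x) ^ 5 = x ^ 5 := by rw [mul_pow, h, one_mul]
    have h2 : ∀ z : K, aeval z r5 = (z ^ 5) ^ 4 - 228 * (z ^ 5) ^ 3 + 494 * (z ^ 5) ^ 2 +
        228 * z ^ 5 + 1 := fun z => by rw [aeval_r5]; ring
    rw [h2, h2, h1, map_one, one_mul])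

theorem rotation_s5 (h5 : ζ ^ 5 = 1) : IsSemiInvariant (rotationGL ζ hζ) s5 12 x :=
  isSemiInvariant_rotation _ x hζ (by
    have h : algebraMap ℂ K ζ ^ 5 = 1 := by rw [← map_pow, h5, map_one]
    have h1 : (algebraMap ℂ K ζ * x) ^ 5 = x ^ 5 := by rw [mul_pow, h, one_mul]
    have h2 : ∀ z : K, aeval z s5 = z * ((z ^ 5) ^ 2 + 11 * z ^ 5 - 1) :=
      fun z => by rw [aeval_s5]; ring
    rw [h2, h2, h1, mul_assoc])

theorem rotation_t5 (h5 : ζ ^ 5 = 1) : IsSemiInvariant (rotationGL ζ hζ) t5 30 x :=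
  isSemiInvariant_rotation _ x one_ne_zero (by
    have h : algebraMap ℂ K ζ ^ 5 = 1 := by rw [← map_pow, h5, map_one]
    have h1 : (algebraMap ℂ K ζ * x) ^ 5 = x ^ 5 := by rw [mul_pow, h, one_mul]
    have h2 : ∀ z : K, aeval z t5 = (z ^ 5) ^ 6 + 522 * (z ^ 5) ^ 5 - 10005 * (z ^ 5) ^ 4 -
        10005 * (z ^ 5) ^ 2 - 522 * z ^ 5 + 1 := fun z => by rw [aeval_t5]; ring
    rw [h2, h2, h1, map_one, one_mul])

end Rotations

section Inversions

variable {x : K} (hx : x ≠ 0)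
include hx

theorem inversion_p4 : IsSemiInvariant (inversionGL 1 (by simp)) p4 4 x :=
  isSemiInvariant_inversion x _ one_ne_zero (by
    rw [aeval_div_p4 hx, aeval_p4, map_one]; ring)

theorem inversion_r4 : IsSemiInvariant (inversionGL 1 (by simp)) r4 12 x :=
  isSemiInvariant_inversion x _ one_ne_zero (by
    rw [aeval_div_r4 hx, aeval_r4, map_one]; ring)

theorem inversion_s4 : IsSemiInvariant (inversionGL 1 (by simp)) s4 8 x :=
  isSemiInvariant_inversion x _ one_ne_zero (by
    rw [aeval_div_s4 hx, aeval_s4, map_one]; ring)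

theorem inversion_t4 : IsSemiInvariant (inversionGL 1 (by simp)) t4 6 x :=
  isSemiInvariant_inversion x _ (neg_ne_zero.2 one_ne_zero) (by
    rw [aeval_div_t4 hx, aeval_t4, map_neg, map_one]; ring)

theorem inversion_r5 : IsSemiInvariant (inversionGL (-1) (by simp)) r5 20 x :=
  isSemiInvariant_inversion x _ one_ne_zero (by
    rw [aeval_div_r5 hx, aeval_r5, map_neg, map_one]; ring)

theorem inversion_s5 : IsSemiInvariant (inversionGL (-1) (by simp)) s5 12 x :=
  isSemiInvariant_inversion x _ one_ne_zero (by
    rw [aeval_div_s5 hx, aeval_s5, map_neg, map_one]; ring)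

theorem inversion_t5 : IsSemiInvariant (inversionGL (-1) (by simp)) t5 30 x :=
  isSemiInvariant_inversion x _ one_ne_zero (by
    rw [aeval_div_t5 hx, aeval_t5, map_neg, map_one]; ring)

end Inversions

section Octahedral

variable {x : K}

theorem isSemiInvariant_octahedral {f : ℂ[X]} {m : ℕ} {κ : ℂ} (hκ : κ ≠ 0)
    (h : aeval ((x + algebraMap ℂ K Complex.I) / (x - algebraMap ℂ K Complex.I)) f *
      (x - algebraMap ℂ K Complex.I) ^ m = algebraMap ℂ K κ * aeval x f) :
    IsSemiInvariant octahedralGL f m x :=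
  isSemiInvariant_glMk _ hκ (by simpa [sub_eq_add_neg] using h)

variable (hx : Transcendental ℂ x)
include hx

theorem octahedral_p4 : IsSemiInvariant octahedralGL p4 4 x := by
  -- With `w = i√3` this is `2 (1 + w)`, and `(1 + w) (1 - w) = 4`.
  have hκ : 2 + 2 * (Complex.I * (Real.sqrt 3 : ℂ)) ≠ 0 := fun h => by
    have h1 := sqrt_three_mul_I_sq
    generalize Complex.I * (Real.sqrt 3 : ℂ) = w at *
    have : (4 : ℂ) = 0 := by linear_combination (1 - w) / 2 * h + h1
    norm_num at this
  refine isSemiInvariant_octahedral hκ ?_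
  have hi := algebraMap_I_sq (K := K)
  have hw : (algebraMap ℂ K Complex.I * algebraMap ℂ K (Real.sqrt 3 : ℂ)) ^ 2 = -3 := by
    rw [← map_mul, ← map_pow, sqrt_three_mul_I_sq, map_neg, map_ofNat]
  rw [aeval_div_p4 (transcendental_ne_zero (hx.sub_algebraMap _)), aeval_p4, map_add, map_mul,
    map_mul, map_ofNat]
  generalize algebraMap ℂ K Complex.I * algebraMap ℂ K (Real.sqrt 3 : ℂ) = w at *
  generalize algebraMap ℂ K Complex.I = i at *
  linear_combination (12 * x ^ 2 + 2 * (i ^ 2 - 1) +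
    2 * w * (i ^ 2 - 1 - 2 * x ^ 2)) * hi - 4 * x ^ 2 * hw

theorem octahedral_t4 : IsSemiInvariant octahedralGL t4 6 x := by
  refine isSemiInvariant_octahedral (κ := 8 * Complex.I) (by simp) ?_
  have hi := algebraMap_I_sq (K := K)
  rw [aeval_div_t4 (transcendental_ne_zero (hx.sub_algebraMap _)), aeval_t4, map_mul, map_ofNat]
  generalize algebraMap ℂ K Complex.I = i at *
  linear_combination (-8 * i * x * (i ^ 2 - 1)) * hi

theorem octahedral_s4 : IsSemiInvariant octahedralGL s4 8 x := by
  refine isSemiInvariant_octahedral (κ := 16) (by norm_num) ?_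
  have hi := algebraMap_I_sq (K := K)
  rw [aeval_div_s4 (transcendental_ne_zero (hx.sub_algebraMap _)), aeval_s4, map_ofNat]
  generalize algebraMap ℂ K Complex.I = i at *
  -- The form is a polynomial in `N² + D²` and `N D`, which become `2 (x² - 1)` and `x² + 1`; this
  -- avoids expanding eighth powers.
  have h1 : (x + i) ^ 2 + (x - i) ^ 2 = 2 * x ^ 2 - 2 := by linear_combination 2 * hi
  have h2 : (x + i) * (x - i) = x ^ 2 + 1 := by linear_combination -hi
  have h3 : ∀ N D : K, N ^ 8 + 14 * N ^ 4 * D ^ 4 + D ^ 8 =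
      ((N ^ 2 + D ^ 2) ^ 2 - 2 * (N * D) ^ 2) ^ 2 + 12 * (N * D) ^ 4 := fun N D => by ring
  rw [h3, h1, h2]
  ring

theorem octahedral_r4 : IsSemiInvariant octahedralGL r4 12 x := by
  refine isSemiInvariant_octahedral (κ := -64) (by norm_num) ?_
  have hi := algebraMap_I_sq (K := K)
  rw [aeval_div_r4 (transcendental_ne_zero (hx.sub_algebraMap _)), aeval_r4, map_neg, map_ofNat]
  generalize algebraMap ℂ K Complex.I = i at *
  have h1 : (x + i) ^ 2 + (x - i) ^ 2 = 2 * x ^ 2 - 2 := by linear_combination 2 * hi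
  have h2 : (x + i) * (x - i) = x ^ 2 + 1 := by linear_combination -hi
  have h3 : ∀ N D : K, N ^ 12 - 33 * N ^ 8 * D ^ 4 - 33 * N ^ 4 * D ^ 8 + D ^ 12 =
      ((N ^ 2 + D ^ 2) ^ 2 - 2 * (N * D) ^ 2) * (((N ^ 2 + D ^ 2) ^ 2 - 2 * (N * D) ^ 2) ^ 2 -
        36 * (N * D) ^ 4) := fun N D => by ring
  rw [h3, h1, h2]
  ring

end Octahedral

section Icosahedral

variable {x : K}

theorem isSemiInvariant_icosahedral {f : ℂ[X]} {m : ℕ} {κ : ℂ} (hκ : κ ≠ 0)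
    (h : aeval ((-algebraMap ℂ K Real.goldenRatio * x + 1) / (x + algebraMap ℂ K Real.goldenRatio))
      f * (x + algebraMap ℂ K Real.goldenRatio) ^ m = algebraMap ℂ K κ * aeval x f) :
    IsSemiInvariant icosahedralGL f m x :=
  isSemiInvariant_glMk _ hκ (by simpa using h)

theorem goldenRatio_ne_zero_complex : (Real.goldenRatio : ℂ) ≠ 0 := by
  exact_mod_cast Real.goldenRatio_ne_zero

theorem algebraMap_goldenRatio_sq : algebraMap ℂ K Real.goldenRatio ^ 2 =
    algebraMap ℂ K Real.goldenRatio + 1 := by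
  rw [← map_pow, goldenRatio_sq_complex, map_add, map_one]

variable (hx : Transcendental ℂ x)
include hx

theorem icosahedral_denom_ne_zero : x + algebraMap ℂ K Real.goldenRatio ≠ 0 := by
  have h := linear_ne_zero hx (c := 1) (d := Real.goldenRatio) (Or.inl one_ne_zero)
  rwa [map_one, one_mul] at h

theorem icosahedral_s5 : IsSemiInvariant icosahedralGL s5 12 x := by
  refine isSemiInvariant_icosahedral (κ := 125 * Real.goldenRatio ^ 6)
    (mul_ne_zero (by norm_num) (pow_ne_zero _ goldenRatio_ne_zero_complex)) ?_
  rw [aeval_div_s5 (icosahedral_denom_ne_zero hx), aeval_s5, map_mul, map_pow, map_ofNat]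
  have hφ := algebraMap_goldenRatio_sq (K := K)
  generalize algebraMap ℂ K Real.goldenRatio = φ at *
  -- Up to the factor `N D`, the form is a polynomial in `N² - D²` and `N D`. These become `φ` and
  -- `-φ` times polynomials in `x` over `ℤ`, so the powers of `φ` collect into the constant.
  have h1 : (-φ * x + 1) ^ 2 - (x + φ) ^ 2 = φ * (x ^ 2 - 1 - 4 * x) := by
    linear_combination (x ^ 2 - 1) * hφ
  have h2 : (-φ * x + 1) * (x + φ) = -φ * (x ^ 2 - 1 + x) := by linear_combination -x * hφ
  have h3 : ∀ N D : K, N * D * (N ^ 10 + 11 * N ^ 5 * D ^ 5 - D ^ 10) =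
      N * D * ((N ^ 2 - D ^ 2) ^ 5 + 5 * (N ^ 2 - D ^ 2) ^ 3 * (N * D) ^ 2 +
        5 * (N ^ 2 - D ^ 2) * (N * D) ^ 4 + 11 * (N * D) ^ 5) := fun N D => by ring
  rw [h3, h1, h2]
  ring

theorem icosahedral_r5 : IsSemiInvariant icosahedralGL r5 20 x := by
  refine isSemiInvariant_icosahedral (κ := 3125 * Real.goldenRatio ^ 10)
    (mul_ne_zero (by norm_num) (pow_ne_zero _ goldenRatio_ne_zero_complex)) ?_
  rw [aeval_div_r5 (icosahedral_denom_ne_zero hx), aeval_r5, map_mul, map_pow, map_ofNat]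
  have hφ := algebraMap_goldenRatio_sq (K := K)
  generalize algebraMap ℂ K Real.goldenRatio = φ at *
  have h1 : (-φ * x + 1) ^ 2 - (x + φ) ^ 2 = φ * (x ^ 2 - 1 - 4 * x) := by
    linear_combination (x ^ 2 - 1) * hφ
  have h2 : (-φ * x + 1) * (x + φ) = -φ * (x ^ 2 - 1 + x) := by linear_combination -x * hφ
  have h3 : ∀ N D : K, N ^ 20 - 228 * N ^ 15 * D ^ 5 + 494 * N ^ 10 * D ^ 10 +
      228 * N ^ 5 * D ^ 15 + D ^ 20 =
      ((N ^ 2 - D ^ 2) ^ 5 + 5 * (N ^ 2 - D ^ 2) ^ 3 * (N * D) ^ 2 +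
        5 * (N ^ 2 - D ^ 2) * (N * D) ^ 4) ^ 2 -
      228 * ((N ^ 2 - D ^ 2) ^ 5 + 5 * (N ^ 2 - D ^ 2) ^ 3 * (N * D) ^ 2 +
        5 * (N ^ 2 - D ^ 2) * (N * D) ^ 4) * (N * D) ^ 5 + 496 * (N * D) ^ 10 :=
    fun N D => by ring
  rw [h3, h1, h2]
  ring

theorem icosahedral_t5 : IsSemiInvariant icosahedralGL t5 30 x := by
  refine isSemiInvariant_icosahedral
    (κ := -78125 * ((Real.goldenRatio + 2) * Real.goldenRatio ^ 14))
    (mul_ne_zero (by norm_num) (mul_ne_zero goldenRatio_add_two_ne_zero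
      (pow_ne_zero _ goldenRatio_ne_zero_complex))) ?_
  rw [aeval_div_t5 (icosahedral_denom_ne_zero hx), aeval_t5, map_mul, map_mul, map_pow, map_add,
    map_neg, map_ofNat, map_ofNat]
  have hφ := algebraMap_goldenRatio_sq (K := K)
  generalize algebraMap ℂ K Real.goldenRatio = φ at *
  have h1 : (-φ * x + 1) ^ 2 - (x + φ) ^ 2 = φ * (x ^ 2 - 1 - 4 * x) := by
    linear_combination (x ^ 2 - 1) * hφ
  have h2 : (-φ * x + 1) * (x + φ) = -φ * (x ^ 2 - 1 + x) := by linear_combination -x * hφ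
  -- Besides `N² - D²` and `N D`, this form involves the factor `N² + D²`, which accounts for `φ +
  -- 2` in the constant.
  have h4 : (-φ * x + 1) ^ 2 + (x + φ) ^ 2 = (φ + 2) * (x ^ 2 + 1) := by
    linear_combination (x ^ 2 + 1) * hφ
  have h3 : ∀ N D : K, N ^ 30 + 522 * N ^ 25 * D ^ 5 - 10005 * N ^ 20 * D ^ 10 -
      10005 * N ^ 10 * D ^ 20 - 522 * N ^ 5 * D ^ 25 + D ^ 30 = (N ^ 2 + D ^ 2) *
      (((N ^ 2 - D ^ 2) ^ 4 + 3 * (N ^ 2 - D ^ 2) ^ 2 * (N * D) ^ 2 + (N * D) ^ 4) *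
      (((N ^ 2 - D ^ 2) ^ 5 + 5 * (N ^ 2 - D ^ 2) ^ 3 * (N * D) ^ 2 +
        5 * (N ^ 2 - D ^ 2) * (N * D) ^ 4) ^ 2 +
      522 * ((N ^ 2 - D ^ 2) ^ 5 + 5 * (N ^ 2 - D ^ 2) ^ 3 * (N * D) ^ 2 +
        5 * (N ^ 2 - D ^ 2) * (N * D) ^ 4) * (N * D) ^ 5 - 10004 * (N * D) ^ 10)) :=
    fun N D => by ring
  rw [h3, h1, h2, h4]
  ring

end Icosahedral

end SemiInvariance

/-! ### Exclusion of small invariant sets and determination of the order. -/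

section SmallSets

theorem rotationGL_smul_coe {ζ : ℂ} (hζ : ζ ≠ 0) (z : ℂ) :
    rotationGL ζ hζ • (z : OnePoint ℂ) = ((ζ * z : ℂ) : OnePoint ℂ) := by
  simp [rotationGL, OnePoint.smul_some_eq_ite]

theorem octahedralGL_smul_coe {z : ℂ} (hz : z - Complex.I ≠ 0) :
    octahedralGL • (z : OnePoint ℂ) = (((z + Complex.I) / (z - Complex.I) : ℂ) : OnePoint ℂ) := by
  rw [octahedralGL, OnePoint.smul_some_eq_ite]
  simp only [glMk_zero_zero, glMk_zero_one, glMk_one_zero, glMk_one_one, one_mul,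
    ← sub_eq_add_neg, if_neg hz]

theorem octahedralGL_smul_infty : octahedralGL • (∞ : OnePoint ℂ) = ((1 : ℂ) : OnePoint ℂ) := by
  simp [octahedralGL, OnePoint.smul_infty_eq_ite]

theorem octahedralGL_smul_I : octahedralGL • (Complex.I : OnePoint ℂ) = ∞ := by
  simp [octahedralGL, OnePoint.smul_some_eq_ite]

/-- The quadratic is `1 - i` times the fixed-point equation `z² - (1 + i) z - i = 0` of the map
itself, whose square, being its inverse, has the same fixed points. -/
theorem octahedralGL_smul_smul_eq {p : OnePoint ℂ} (h : octahedralGL • octahedralGL • p = p) :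
    ∃ z : ℂ, p = z ∧ (1 - Complex.I) * z ^ 2 - 2 * z - (1 + Complex.I) = 0 := by
  have hI := Complex.I_sq
  have h1I : (1 : ℂ) - Complex.I ≠ 0 := fun h => by
    have : (2 : ℂ) = 0 := by linear_combination (1 + Complex.I) * h + hI
    norm_num at this
  induction p using OnePoint.rec with
  | infty =>
    rw [octahedralGL_smul_infty, octahedralGL_smul_coe h1I] at h
    exact absurd h (OnePoint.coe_ne_infty _)
  | coe z =>
    by_cases hz : z - Complex.I = 0
    · rw [sub_eq_zero.1 hz, octahedralGL_smul_I, octahedralGL_smul_infty, OnePoint.coe_eq_coe] at h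
      exact absurd (sub_eq_zero.2 h) h1I
    · rw [octahedralGL_smul_coe hz] at h
      by_cases hw : (z + Complex.I) / (z - Complex.I) - Complex.I = 0
      · rw [sub_eq_zero.1 hw, octahedralGL_smul_I] at h
        exact absurd h (OnePoint.infty_ne_coe _)
      · rw [octahedralGL_smul_coe hw, OnePoint.coe_eq_coe, div_eq_iff hw] at h
        refine ⟨z, rfl, ?_⟩
        field_simp at h
        linear_combination -h - (1 + z) * hI

theorem smul_smul_eq_of_ncard_lt_three {G Ω : Type*} [Group G] [MulAction G Ω] {S : Set Ω}
    (hS : S.Finite) (hcard : S.ncard < 3) {g : G} (hg : ∀ p ∈ S, g • p ∈ S) {p : Ω} (hp : p ∈ S) :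
    g • g • p = p := by
  by_contra h
  have h1 : p ≠ g • p := fun h1 => h (by rw [← h1, ← h1])
  have h2 : g • p ≠ g • g • p := fun h2 => h1 (MulAction.injective g h2)
  have h3 : ({p, g • p, g • g • p} : Set Ω).ncard = 3 :=
    Set.ncard_eq_three.2 ⟨_, _, _, h1, Ne.symm h, h2, rfl⟩
  have h4 : ({p, g • p, g • g • p} : Set Ω) ⊆ S := by
    rintro _ (rfl | rfl | rfl)
    exacts [hp, hg _ hp, hg _ (hg _ hp)]
  have := Set.ncard_le_ncard h4 hS
  omega

/-- In a smaller set, a point `z` and its image `-z` would both be fixed by the square of the map of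
order three. The two quadratics force `z = 0`, which is not a solution. -/
theorem three_le_ncard_of_octahedral {S : Set (OnePoint ℂ)} (hS : S.Finite) (hne : S.Nonempty)
    (h1 : ∀ p ∈ S, rotationGL (-1) (by simp) • p ∈ S) (h2 : ∀ p ∈ S, octahedralGL • p ∈ S) :
    3 ≤ S.ncard := by
  by_contra! hcard
  obtain ⟨p, hp⟩ := hne
  obtain ⟨z, rfl, hz⟩ := octahedralGL_smul_smul_eq
    (smul_smul_eq_of_ncard_lt_three hS hcard h2 hp)
  obtain ⟨w, hw, hw'⟩ := octahedralGL_smul_smul_eq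
    (smul_smul_eq_of_ncard_lt_three hS hcard h2 (h1 _ hp))
  rw [rotationGL_smul_coe, OnePoint.coe_eq_coe] at hw
  subst hw
  have hz0 : z = 0 := by linear_combination (1 / 4) * (hw' - hz)
  subst hz0
  have : (2 : ℂ) = 0 := by linear_combination (-(1 - Complex.I)) * hz + Complex.I_sq
  norm_num at this

/-- In a smaller set every point is fixed by `z ↦ ζ² z`, hence is `0` or `∞`; but the icosahedral
map sends these to `1/φ` and `-φ`. -/
theorem three_le_ncard_of_icosahedral {S : Set (OnePoint ℂ)} (hS : S.Finite) (hne : S.Nonempty)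
    {ζ : ℂ} (hζ : ζ ≠ 0) (hζ2 : ζ ^ 2 ≠ 1) (h1 : ∀ p ∈ S, rotationGL ζ hζ • p ∈ S)
    (h2 : ∀ p ∈ S, icosahedralGL • p ∈ S) : 3 ≤ S.ncard := by
  by_contra! hcard
  have key : ∀ z : ℂ, (z : OnePoint ℂ) ∈ S → z = 0 := fun z hz => by
    have h := smul_smul_eq_of_ncard_lt_three hS hcard h1 hz
    rw [rotationGL_smul_coe, rotationGL_smul_coe, OnePoint.coe_eq_coe] at h
    refine (mul_eq_zero.1 (show (ζ ^ 2 - 1) * z = 0 by linear_combination h)).resolve_left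
      (sub_ne_zero.2 hζ2)
  have hφ := goldenRatio_ne_zero_complex
  obtain ⟨p, hp⟩ := hne
  have hp2 := h2 p hp
  induction p using OnePoint.rec with
  | infty =>
    have h : icosahedralGL • (∞ : OnePoint ℂ) = ((-Real.goldenRatio : ℂ) : OnePoint ℂ) := by
      simp [icosahedralGL, OnePoint.smul_infty_eq_ite]
    rw [h] at hp2
    exact hφ (neg_eq_zero.1 (key _ hp2))
  | coe z =>
    rw [key z hp] at hp2
    have h : icosahedralGL • ((0 : ℂ) : OnePoint ℂ) =
        ((1 / Real.goldenRatio : ℂ) : OnePoint ℂ) := by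
      rw [icosahedralGL, OnePoint.smul_some_eq_ite]
      simp only [glMk_zero_zero, glMk_zero_one, glMk_one_zero, glMk_one_one, mul_zero, zero_add,
        if_neg hφ]
    rw [h] at hp2
    exact one_div_ne_zero hφ (key _ hp2)

theorem dvd_card_stabilizer_of_rotation {G : Subgroup (Equiv.Perm (OnePoint ℂ))} [Finite G] {ζ : ℂ}
    {k : ℕ} (hk : IsPrimitiveRoot ζ k) (hζ : ζ ≠ 0)
    (hmem : MulAction.toPerm (rotationGL ζ hζ) ∈ G) :
    k ∣ Nat.card (MulAction.stabilizer G ((0 : ℂ) : OnePoint ℂ)) := by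
  set g : G := ⟨MulAction.toPerm (rotationGL ζ hζ), hmem⟩
  have hg : ∀ z : ℂ, g • (z : OnePoint ℂ) = ((ζ * z : ℂ) : OnePoint ℂ) :=
    rotationGL_smul_coe hζ
  have hgk : ∀ (j : ℕ) (z : ℂ), g ^ j • (z : OnePoint ℂ) = ((ζ ^ j * z : ℂ) : OnePoint ℂ) := by
    intro j
    induction j with
    | zero => simp
    | succ j ih => intro z; rw [pow_succ, mul_smul, hg, ih, pow_succ, mul_assoc]
  have hstab : g ∈ MulAction.stabilizer G ((0 : ℂ) : OnePoint ℂ) := by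
    rw [MulAction.mem_stabilizer_iff, hg, mul_zero]
  have h1 := orderOf_dvd_natCard
    (⟨g, hstab⟩ : MulAction.stabilizer G ((0 : ℂ) : OnePoint ℂ))
  rw [Subgroup.orderOf_mk] at h1
  have h2 := hgk (orderOf g) 1
  rw [pow_orderOf_eq_one, one_smul, mul_one, OnePoint.coe_eq_coe] at h2
  exact (hk.dvd_of_pow_eq_one _ h2.symm).trans h1

/-- The nontrivial stabilizers have orders 2, 3 in the group of order 12, then 2, 3, 4 for order 24
and 2, 3, 5 for order 60. -/
theorem IsPolyhedralAction.card_eq_of_dvd_stabilizer {G Ω : Type*} [Group G] [MulAction G Ω]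
    [Finite G] [Nonempty Ω] (hG : IsPolyhedralAction G Ω) {p : Ω} :
    (4 ∣ Nat.card (MulAction.stabilizer G p) → Nat.card G = 24) ∧
      (5 ∣ Nat.card (MulAction.stabilizer G p) → Nat.card G = 60) := by
  have key : ∀ k, 2 ≤ k → k ∣ Nat.card (MulAction.stabilizer G p) →
      p ∈ exceptionalPoints G Ω := by
    intro k hk hdvd h
    rw [h, Subgroup.card_bot] at hdvd
    have := Nat.le_of_dvd one_pos hdvd
    omega
  have h1 := ncard_orbit_mul_card_stabilizer (G := G) p
  constructor <;> rintro ⟨k, hk⟩ <;> rw [hk] at h1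
  · rcases hG.card_stabilizer_cases (key 4 (by norm_num) ⟨k, hk⟩) with
      ⟨h, h2 | h2⟩ | ⟨h, h2 | h2 | h2⟩ | ⟨h, h2 | h2 | h2⟩ <;> rw [h, h2] at h1 <;> omega
  · rcases hG.card_stabilizer_cases (key 5 (by norm_num) ⟨k, hk⟩) with
      ⟨h, h2 | h2⟩ | ⟨h, h2 | h2 | h2⟩ | ⟨h, h2 | h2 | h2⟩ <;> rw [h, h2] at h1 <;> omega

end SmallSets

/-! ### The listed polynomials as forms with polyhedral symmetry. -/

section Forms

variable {K : Type*} [Field K] [Algebra ℂ K]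

/-- A reduced form with the symmetries of the tetrahedron. -/
structure IsTetrahedralForm (f : ℂ[X]) (m : ℕ) (x : K) : Prop extends IsReducedForm f m where
  rotation : IsSemiInvariant (rotationGL (-1) (by simp)) f m x
  octahedral : IsSemiInvariant octahedralGL f m x
  inversion : IsSemiInvariant (inversionGL 1 (by simp)) f m x

/-- A reduced form with the symmetries of the octahedron. -/
structure IsOctahedralForm (f : ℂ[X]) (m : ℕ) (x : K) : Prop extends IsTetrahedralForm f m x where
  rotation_I : IsSemiInvariant (rotationGL Complex.I Complex.I_ne_zero) f m x

/-- A fifth root of unity. -/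
noncomputable def zetaFive : ℂ := Complex.exp (2 * Real.pi * Complex.I / (5 : ℕ))

theorem isPrimitiveRoot_zetaFive : IsPrimitiveRoot zetaFive 5 :=
  Complex.isPrimitiveRoot_exp 5 (by norm_num)

theorem zetaFive_ne_zero : zetaFive ≠ 0 := Complex.exp_ne_zero _

/-- A reduced form with the symmetries of the icosahedron. -/
structure IsIcosahedralForm (f : ℂ[X]) (m : ℕ) (x : K) : Prop extends IsReducedForm f m where
  rotation : IsSemiInvariant (rotationGL zetaFive zetaFive_ne_zero) f m x
  icosahedral : IsSemiInvariant icosahedralGL f m x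
  inversion : IsSemiInvariant (inversionGL (-1) (by simp)) f m x

theorem IsTetrahedralForm.mul {f g : ℂ[X]} {a b : ℕ} {x : K} (hf : IsTetrahedralForm f a x)
    (hg : IsTetrahedralForm g b x) (h : IsCoprime f g) : IsTetrahedralForm (f * g) (a + b) x :=
  ⟨hf.toIsReducedForm.mul hg.toIsReducedForm h, hf.rotation.mul hg.rotation,
    hf.octahedral.mul hg.octahedral, hf.inversion.mul hg.inversion⟩

theorem IsOctahedralForm.mul {f g : ℂ[X]} {a b : ℕ} {x : K} (hf : IsOctahedralForm f a x)
    (hg : IsOctahedralForm g b x) (h : IsCoprime f g) : IsOctahedralForm (f * g) (a + b) x :=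
  ⟨hf.toIsTetrahedralForm.mul hg.toIsTetrahedralForm h, hf.rotation_I.mul hg.rotation_I⟩

theorem IsIcosahedralForm.mul {f g : ℂ[X]} {a b : ℕ} {x : K} (hf : IsIcosahedralForm f a x)
    (hg : IsIcosahedralForm g b x) (h : IsCoprime f g) : IsIcosahedralForm (f * g) (a + b) x :=
  ⟨hf.toIsReducedForm.mul hg.toIsReducedForm h, hf.rotation.mul hg.rotation,
    hf.icosahedral.mul hg.icosahedral, hf.inversion.mul hg.inversion⟩

theorem eval_zero_of_dvd {f : ℂ[X]} (h : t4 ∣ f ∨ s5 ∣ f) : f.eval 0 = 0 := by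
  rcases h with ⟨g, rfl⟩ | ⟨g, rfl⟩ <;> simp [t4, s5]

/-- Identifies `delta` with the zero at infinity: `t4` and `s5` vanish at `0`, and the hypothesis
supplies the converse. -/
theorem IsReducedForm.natDegree_add_delta {f : ℂ[X]} {m : ℕ} (hf : IsReducedForm f m)
    (h : f.eval 0 = 0 → t4 ∣ f ∨ s5 ∣ f) : f.natDegree + delta f = m := by
  rw [← hf.natDegree_add, delta]
  congr 1
  by_cases h1 : t4 ∣ f ∨ s5 ∣ f
  · rw [if_pos h1, if_pos (eval_zero_of_dvd h1)]
  · rw [if_neg h1, if_neg (mt h h1)]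

variable {x : K} (hx : Transcendental ℂ x)
include hx

theorem isTetrahedralForm_p4 : IsTetrahedralForm p4 4 x :=
  ⟨isReducedForm_p4, rotation_p4 x, octahedral_p4 hx, inversion_p4 (transcendental_ne_zero hx)⟩

theorem isOctahedralForm_t4 : IsOctahedralForm t4 6 x :=
  ⟨⟨isReducedForm_t4, rotation_t4' x, octahedral_t4 hx, inversion_t4 (transcendental_ne_zero hx)⟩,
    rotation_t4 x⟩

theorem isOctahedralForm_r4 : IsOctahedralForm r4 12 x :=
  ⟨⟨isReducedForm_r4, isSemiInvariant_rotation _ x one_ne_zero (by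
    rw [aeval_r4, aeval_r4, map_neg, map_one]; ring), octahedral_r4 hx,
    inversion_r4 (transcendental_ne_zero hx)⟩, rotation_r4 x⟩

theorem isOctahedralForm_s4 : IsOctahedralForm s4 8 x :=
  ⟨⟨isReducedForm_s4, isSemiInvariant_rotation _ x one_ne_zero (by
    rw [aeval_s4, aeval_s4, map_neg, map_one]; ring), octahedral_s4 hx,
    inversion_s4 (transcendental_ne_zero hx)⟩, rotation_s4 x⟩

theorem isIcosahedralForm_r5 : IsIcosahedralForm r5 20 x :=
  ⟨isReducedForm_r5, rotation_r5 _ x isPrimitiveRoot_zetaFive.pow_eq_one, icosahedral_r5 hx,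
    inversion_r5 (transcendental_ne_zero hx)⟩

theorem isIcosahedralForm_s5 : IsIcosahedralForm s5 12 x :=
  ⟨isReducedForm_s5, rotation_s5 _ x isPrimitiveRoot_zetaFive.pow_eq_one, icosahedral_s5 hx,
    inversion_s5 (transcendental_ne_zero hx)⟩

theorem isIcosahedralForm_t5 : IsIcosahedralForm t5 30 x :=
  ⟨isReducedForm_t5, rotation_t5 _ x isPrimitiveRoot_zetaFive.pow_eq_one, icosahedral_t5 hx,
    inversion_t5 (transcendental_ne_zero hx)⟩

theorem exists_tetrahedralForm {f : ℂ[X]} (hf : f ∈ listA4) : ∃ m, IsTetrahedralForm f m x ∧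
    f.natDegree + delta f = m ∧ (m = 4 ∧ f = p4 ∨ m = 10) := by
  rcases hf with rfl | rfl
  · exact ⟨4, isTetrahedralForm_p4 hx, isReducedForm_p4.natDegree_add_delta (by simp [p4]),
      Or.inl ⟨rfl, rfl⟩⟩
  · have h := (isOctahedralForm_t4 hx).toIsTetrahedralForm.mul (isTetrahedralForm_p4 hx)
      isCoprime_t4_p4
    exact ⟨10, h, h.natDegree_add_delta fun _ => Or.inl (dvd_mul_right _ _), Or.inr rfl⟩

/-- The degrees are the sums of distinct numbers among 12, 8 and 6, the sizes of the exceptional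
orbits of the octahedral group. -/
theorem exists_octahedralForm {f : ℂ[X]} (hf : f ∈ listS4) : ∃ m, IsOctahedralForm f m x ∧
    f.natDegree + delta f = m ∧ (m = 12 ∨ m = 8 ∨ m = 6 ∨ m = 20 ∨ m = 18 ∨ m = 14 ∨ m = 26) := by
  have hr := isOctahedralForm_r4 hx
  have hs := isOctahedralForm_s4 hx
  have ht := isOctahedralForm_t4 hx
  have hrs := hr.mul hs isCoprime_r4_s4
  have hrt := hr.mul ht isCoprime_r4_t4
  have hst := hs.mul ht isCoprime_s4_t4
  have hrst := hrs.mul ht (isCoprime_r4_t4.mul_left isCoprime_s4_t4)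
  rcases hf with rfl | rfl | rfl | rfl | rfl | rfl | rfl
  · exact ⟨12, hr, hr.natDegree_add_delta (by simp [r4]), by norm_num⟩
  · exact ⟨8, hs, hs.natDegree_add_delta (by simp [s4]), by norm_num⟩
  · exact ⟨6, ht, ht.natDegree_add_delta fun _ => Or.inl dvd_rfl, by norm_num⟩
  · exact ⟨20, hrs, hrs.natDegree_add_delta (by simp [r4, s4]), by norm_num⟩
  · exact ⟨18, hrt, hrt.natDegree_add_delta fun _ => Or.inl (dvd_mul_left _ _), by norm_num⟩
  · exact ⟨14, hst, hst.natDegree_add_delta fun _ => Or.inl (dvd_mul_left _ _), by norm_num⟩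
  · exact ⟨26, hrst, hrst.natDegree_add_delta fun _ => Or.inl (dvd_mul_left _ _), by norm_num⟩

theorem exists_icosahedralForm {f : ℂ[X]} (hf : f ∈ listA5) : ∃ m, IsIcosahedralForm f m x ∧
    f.natDegree + delta f = m ∧
    (m = 20 ∨ m = 12 ∨ m = 30 ∨ m = 32 ∨ m = 50 ∨ m = 42 ∨ m = 62) := by
  have hr := isIcosahedralForm_r5 hx
  have hs := isIcosahedralForm_s5 hx
  have ht := isIcosahedralForm_t5 hx
  have hrs := hr.mul hs isCoprime_r5_s5
  have hrt := hr.mul ht isCoprime_r5_t5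
  have hst := hs.mul ht isCoprime_s5_t5
  have hrst := hrs.mul ht (isCoprime_r5_t5.mul_left isCoprime_s5_t5)
  rcases hf with rfl | rfl | rfl | rfl | rfl | rfl | rfl
  · exact ⟨20, hr, hr.natDegree_add_delta (by simp [r5]), by norm_num⟩
  · exact ⟨12, hs, hs.natDegree_add_delta fun _ => Or.inr dvd_rfl, by norm_num⟩
  · exact ⟨30, ht, ht.natDegree_add_delta (by simp [t5]), by norm_num⟩
  · exact ⟨32, hrs, hrs.natDegree_add_delta fun _ => Or.inr (dvd_mul_left _ _), by norm_num⟩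
  · exact ⟨50, hrt, hrt.natDegree_add_delta (by simp [r5, t5]), by norm_num⟩
  · exact ⟨42, hst, hst.natDegree_add_delta fun _ => Or.inr (dvd_mul_right _ _), by norm_num⟩
  · exact ⟨62, hrst, hrst.natDegree_add_delta fun _ => Or.inr
      ((dvd_mul_left _ _).mul_right _), by norm_num⟩

end Forms

/-! ### The curves of the lists and the two directions of the theorem. -/

section ExceptionalCurves

variable {K : Type*} [Field K] [Algebra ℂ K] {n m : ℕ} {f : ℂ[X]} {x y : K}

/-- The degree of `f` is `m` or `m - 1`, and `m - 1` is prime to `m`. -/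
theorem IsReducedForm.divides_or_coprime (hf : IsReducedForm f m) (hnm : n ∣ m) :
    n ∣ f.natDegree ∨ n.Coprime f.natDegree := by
  have h := hf.natDegree_add
  split_ifs at h
  · refine Or.inr (Nat.Coprime.coprime_dvd_left hnm ?_)
    rw [← h, Nat.coprime_self_add_left]
    exact Nat.coprime_one_left _
  · exact Or.inl (by rwa [← h, add_zero] at hnm)

theorem IsReducedForm.ncard_branchSet (hf : IsReducedForm f m) (hn : 2 ≤ n) (hnm : n ∣ m) :
    (branchSet n f).ncard = m := by
  classical
  rw [_root_.ncard_branchSet hn hf.separable]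
  have h := hf.natDegree_add
  split_ifs at h with h0
  · rw [if_neg, h]
    intro h1
    rw [← h] at hnm
    have := Nat.le_of_dvd one_pos ((Nat.dvd_add_right h1).1 hnm)
    omega
  · rw [if_pos, h]
    rwa [← h, add_zero] at hnm

theorem IsReducedForm.isSeparableCurve (hf : IsReducedForm f m) (hc : IsCurveWithEquation n f x y)
    (hn : 2 ≤ n) (hm : 2 ≤ m) : IsSeparableCurve n f x y :=
  ⟨hc, by omega, hf.separable, by have := hf.natDegree_add; split_ifs at this <;> omega⟩

theorem IsReducedForm.isPreSuperelliptic (hf : IsReducedForm f m) (hc : IsCurveWithEquation n f x y)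
    (hn : 2 ≤ n) (hnm : n ∣ m) (hm : 4 ≤ m) (hmn : ¬ (n = 2 ∧ m = 4)) {ε : ℂ} (hε : ε ≠ 0)
    (hinv : IsSemiInvariant (inversionGL ε hε) f m x) : IsPreSuperelliptic n f x y := by
  refine ⟨hc, hn, hf.monic, hf.separable, hf.divides_or_coprime hnm, ?_⟩
  obtain ⟨κ, hκ, h⟩ := hinv
  obtain ⟨e, rfl⟩ := hnm
  refine (hf.isSeparableCurve hc hn (by omega)).two_le_genus (e := e) hε hκ
    (by simpa [mobius, inversionGL] using h) ?_
  -- For `n * e ≥ 4` the bound `3 ≤ e * (n - 1)` fails only if `n = e = 2`, the excluded curve of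
  -- genus one.
  obtain ⟨k, rfl⟩ := Nat.exists_eq_add_of_le hn
  rw [show 2 + k - 1 = k + 1 by omega]
  rcases Nat.lt_or_ge e 3 with he | he
  · interval_cases e <;> omega
  · nlinarith

/-- The group `G` contains a Klein four-group. -/
def HasKleinSubgroup (G : Type*) [Group G] : Prop :=
  ∃ a b : G, a * a = 1 ∧ b * b = 1 ∧ a ≠ 1 ∧ b ≠ 1 ∧ a * b = b * a ∧ a ≠ b

theorem HasKleinSubgroup.map {G H : Type*} [Group G] [Group H] (h : HasKleinSubgroup G)
    {φ : G →* H} (hφ : Function.Injective φ) : HasKleinSubgroup H := by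
  obtain ⟨a, b, h1, h2, h3, h4, h5, h6⟩ := h
  refine ⟨φ a, φ b, ?_, ?_, ?_, ?_, ?_, hφ.ne h6⟩
  · rw [← map_mul, h1, map_one]
  · rw [← map_mul, h2, map_one]
  · rwa [Ne, map_eq_one_iff φ hφ]
  · rwa [Ne, map_eq_one_iff φ hφ]
  · rw [← map_mul, h5, map_mul]

theorem hasKleinSubgroup_alternatingGroup_four : HasKleinSubgroup (alternatingGroup (Fin 4)) :=
  ⟨⟨Equiv.swap 0 1 * Equiv.swap 2 3, Equiv.Perm.mem_alternatingGroup.2 (by decide)⟩,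
    ⟨Equiv.swap 0 2 * Equiv.swap 1 3, Equiv.Perm.mem_alternatingGroup.2 (by decide)⟩,
    by decide, by decide, by decide, by decide, by decide, by decide⟩

theorem hasKleinSubgroup_perm_four : HasKleinSubgroup (Equiv.Perm (Fin 4)) :=
  hasKleinSubgroup_alternatingGroup_four.map (φ := (alternatingGroup (Fin 4)).subtype)
    Subtype.val_injective

theorem hasKleinSubgroup_alternatingGroup_five : HasKleinSubgroup (alternatingGroup (Fin 5)) :=
  ⟨⟨Equiv.swap 0 1 * Equiv.swap 2 3, Equiv.Perm.mem_alternatingGroup.2 (by decide)⟩,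
    ⟨Equiv.swap 0 2 * Equiv.swap 1 3, Equiv.Perm.mem_alternatingGroup.2 (by decide)⟩,
    by decide, by decide, by decide, by decide, by decide, by decide⟩

theorem IsSeparableCurve.dvd_natDegree_add_delta (hc : IsSeparableCurve n f x y) (hn : 2 ≤ n)
    (hdc : n ∣ f.natDegree ∨ n.Coprime f.natDegree)
    (hK : HasKleinSubgroup (ReducedGroup n x y)) (heven : Even (f.natDegree + delta f))
    (hr : 2 ≤ f.natDegree) : n ∣ f.natDegree + delta f ∧
      (branchPoints (xLine x)).encard = ((f.natDegree + delta f : ℕ) : ℕ∞) := by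
  obtain ⟨⟨a, ha⟩, ⟨b, hb⟩, h1, h2, h3, h4, h5, h6⟩ :=
    hK.map (φ := hc.reducedGroupEquiv.toMonoidHom) hc.reducedGroupEquiv.injective
  simp only [Subtype.ext_iff, ne_eq, Subgroup.coe_mul, Subgroup.coe_one] at h1 h2 h3 h4 h5 h6
  refine hc.dvd_natDegree_add hn hdc ha hb h1 h2 h3 h4 h5 h6 ?_ heven hr
  unfold delta
  split_ifs <;> norm_num

theorem IsPreSuperelliptic.dvd_and_encard (hp : IsPreSuperelliptic n f x y)
    (he : IsExceptionalCase n f x y) : n ∣ f.natDegree + delta f ∧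
      (branchPoints (xLine x)).encard = ((f.natDegree + delta f : ℕ) : ℕ∞) := by
  have hx := hp.curve.transcendental
  have hd : delta f ≤ 1 := by unfold delta; split_ifs <;> norm_num
  have key : ∀ m, IsReducedForm f m → f.natDegree + delta f = m → Even m → 4 ≤ m →
      HasKleinSubgroup (ReducedGroup n x y) → n ∣ f.natDegree + delta f ∧
      (branchPoints (xLine x)).encard = ((f.natDegree + delta f : ℕ) : ℕ∞) :=
    fun m hf hm heven h4 hK => (hf.isSeparableCurve hp.curve hp.two_le_level
      (by omega)).dvd_natDegree_add_delta hp.two_le_level hp.divides_or_coprime hK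
      (hm ▸ heven) (by omega)
  rcases he with ⟨hf, ⟨φ⟩⟩ | ⟨hf, ⟨φ⟩⟩ | ⟨hf, ⟨φ⟩⟩
  · obtain ⟨m, hm, h, hcases⟩ := exists_tetrahedralForm hx hf
    refine key m hm.toIsReducedForm h ?_ (by omega)
      (hasKleinSubgroup_alternatingGroup_four.map (φ := φ.symm.toMonoidHom) φ.symm.injective)
    rcases hcases with ⟨rfl, -⟩ | rfl <;> decide
  · obtain ⟨m, hm, h, hcases⟩ := exists_octahedralForm hx hf
    refine key m hm.toIsReducedForm h ?_ (by omega)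
      (hasKleinSubgroup_perm_four.map (φ := φ.symm.toMonoidHom) φ.symm.injective)
    rcases hcases with rfl | rfl | rfl | rfl | rfl | rfl | rfl <;> decide
  · obtain ⟨m, hm, h, hcases⟩ := exists_icosahedralForm hx hf
    refine key m hm.toIsReducedForm h ?_ (by omega)
      (hasKleinSubgroup_alternatingGroup_five.map (φ := φ.symm.toMonoidHom) φ.symm.injective)
    rcases hcases with rfl | rfl | rfl | rfl | rfl | rfl | rfl <;> decide

namespace IsSeparableCurve

variable (hc : IsSeparableCurve n f x y) (hn : 2 ≤ n) (hnm : n ∣ m)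
include hc hn hnm

theorem isPolyhedralAction_of_tetrahedralForm (hf : IsTetrahedralForm f m x) (hm : 4 ≤ m) :
    Finite hc.pointAction.range ∧ IsPolyhedralAction hc.pointAction.range (OnePoint ℂ) := by
  have hfin := hc.finite_range_pointAction hn
    (by rw [hf.toIsReducedForm.ncard_branchSet hn hnm]; omega)
  exact ⟨hfin, hc.isPolyhedralAction fun S hne hS h => three_le_ncard_of_octahedral hS hne
    (h _ (hc.exists_lift hf.rotation hnm)) (h _ (hc.exists_lift hf.octahedral hnm))⟩

theorem isPolyhedralAction_of_icosahedralForm (hf : IsIcosahedralForm f m x) (hm : 4 ≤ m) :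
    Finite hc.pointAction.range ∧ IsPolyhedralAction hc.pointAction.range (OnePoint ℂ) := by
  have hfin := hc.finite_range_pointAction hn
    (by rw [hf.toIsReducedForm.ncard_branchSet hn hnm]; omega)
  exact ⟨hfin, hc.isPolyhedralAction fun S hne hS h => three_le_ncard_of_icosahedral hS hne
    zetaFive_ne_zero (isPrimitiveRoot_zetaFive.pow_ne_one_of_pos_of_lt (by norm_num) (by norm_num))
    (h _ (hc.exists_lift hf.rotation hnm)) (h _ (hc.exists_lift hf.icosahedral hnm))⟩

theorem three_branchPoints (hf : IsReducedForm f m) [Finite hc.pointAction.range]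
    (hG : IsPolyhedralAction hc.pointAction.range (OnePoint ℂ))
    (h1 : m ≤ Nat.card hc.pointAction.range + 2) (h2 : m ≠ Nat.card hc.pointAction.range) :
    (branchPoints (quotientField n x y)).encard = 3 := by
  have hB := hf.ncard_branchSet hn hnm
  exact hc.encard_branchPoints_quotientField_eq_three hn (hf.divides_or_coprime hnm) hG
    (hc.branchSet_subset_exceptionalPoints hn hG (by rwa [hB]) (by rwa [hB]))

/-- The lifted symmetries do not bound the group from above; the branch set, invariant with 4 or 10
points, excludes orders 24 and 60. -/
theorem tetrahedral_case (hf : IsTetrahedralForm f m x) (hm : m = 4 ∨ m = 10) :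
    (branchPoints (quotientField n x y)).encard = 3 ∧
      Nonempty (ReducedGroup n x y ≃* alternatingGroup (Fin 4)) := by
  obtain ⟨hfin, hG⟩ := hc.isPolyhedralAction_of_tetrahedralForm hn hnm hf (by omega)
  have hB := hf.toIsReducedForm.ncard_branchSet hn hnm
  have hcard := hG.card_eq_twelve (finite_branchSet hn hc.separable)
    (Set.nonempty_of_ncard_ne_zero (by omega))
    (fun g p hp => hc.apply_mem_branchSet g.2 hp) (by omega)
  obtain ⟨φ⟩ := hG.nonempty_mulEquiv_alternatingGroup_four hcard
  exact ⟨hc.three_branchPoints hn hnm hf.toIsReducedForm hG (by omega) (by omega),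
    ⟨hc.reducedGroupEquiv.trans φ⟩⟩

/-- The lift of `z ↦ i z` puts an element of order four into the stabilizer of `0`, which occurs
only in order 24. -/
theorem octahedral_case (hf : IsOctahedralForm f m x)
    (hm : m = 12 ∨ m = 8 ∨ m = 6 ∨ m = 20 ∨ m = 18 ∨ m = 14 ∨ m = 26) :
    (branchPoints (quotientField n x y)).encard = 3 ∧
      Nonempty (ReducedGroup n x y ≃* Equiv.Perm (Fin 4)) := by
  obtain ⟨hfin, hG⟩ := hc.isPolyhedralAction_of_tetrahedralForm hn hnm hf.toIsTetrahedralForm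
    (by omega)
  have hcard := hG.card_eq_of_dvd_stabilizer.1 (dvd_card_stabilizer_of_rotation
    Complex.isPrimitiveRoot_I Complex.I_ne_zero (hc.exists_lift hf.rotation_I hnm))
  obtain ⟨φ⟩ := hG.nonempty_mulEquiv_perm_four hcard
  -- None of the degrees equals 24 and the largest is `26 = 24 + 2`, so every branch point has
  -- nontrivial stabilizer.
  exact ⟨hc.three_branchPoints hn hnm hf.toIsReducedForm hG (by omega) (by omega),
    ⟨hc.reducedGroupEquiv.trans φ⟩⟩

/-- The rotation of order five about `0` forces order 60; no degree equals 60 and the largest is `62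
= 60 + 2`. -/
theorem icosahedral_case (hf : IsIcosahedralForm f m x)
    (hm : m = 20 ∨ m = 12 ∨ m = 30 ∨ m = 32 ∨ m = 50 ∨ m = 42 ∨ m = 62) :
    (branchPoints (quotientField n x y)).encard = 3 ∧
      Nonempty (ReducedGroup n x y ≃* alternatingGroup (Fin 5)) := by
  obtain ⟨hfin, hG⟩ := hc.isPolyhedralAction_of_icosahedralForm hn hnm hf (by omega)
  have hcard := hG.card_eq_of_dvd_stabilizer.2 (dvd_card_stabilizer_of_rotation
    isPrimitiveRoot_zetaFive zetaFive_ne_zero (hc.exists_lift hf.rotation hnm))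
  obtain ⟨φ⟩ := hG.nonempty_mulEquiv_alternatingGroup_five hcard
  exact ⟨hc.three_branchPoints hn hnm hf.toIsReducedForm hG (by omega) (by omega),
    ⟨hc.reducedGroupEquiv.trans φ⟩⟩

end IsSeparableCurve

theorem IsCurveWithEquation.exceptional_of_dvd (hc : IsCurveWithEquation n f x y) (hn : 2 ≤ n)
    (hf : f ∈ listA4 ∪ listS4 ∪ listA5) (hne : ¬ (n = 2 ∧ f = p4))
    (hdvd : n ∣ f.natDegree + delta f) : IsPreSuperelliptic n f x y ∧
      (branchPoints (quotientField n x y)).encard = 3 ∧ IsExceptionalCase n f x y := by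
  have hx := hc.transcendental
  rcases hf with (hf | hf) | hf
  · obtain ⟨m, hm, h, hcases⟩ := exists_tetrahedralForm hx hf
    rw [h] at hdvd
    have hs := hm.toIsReducedForm.isSeparableCurve hc hn (by omega)
    obtain ⟨h1, h2⟩ := hs.tetrahedral_case hn hdvd hm (by omega)
    refine ⟨hm.toIsReducedForm.isPreSuperelliptic hc hn hdvd (by omega) ?_ _ hm.inversion, h1,
      Or.inl ⟨hf, h2⟩⟩
    rintro ⟨h3, h4⟩
    rcases hcases with ⟨-, h5⟩ | h5
    · exact hne ⟨h3, h5⟩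
    · omega
  · obtain ⟨m, hm, h, hcases⟩ := exists_octahedralForm hx hf
    rw [h] at hdvd
    have hs := hm.toIsReducedForm.isSeparableCurve hc hn (by omega)
    obtain ⟨h1, h2⟩ := hs.octahedral_case hn hdvd hm hcases
    exact ⟨hm.toIsReducedForm.isPreSuperelliptic hc hn hdvd (by omega) (by omega) _ hm.inversion,
      h1, Or.inr (Or.inl ⟨hf, h2⟩)⟩
  · obtain ⟨m, hm, h, hcases⟩ := exists_icosahedralForm hx hf
    rw [h] at hdvd
    have hs := hm.toIsReducedForm.isSeparableCurve hc hn (by omega)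
    obtain ⟨h1, h2⟩ := hs.icosahedral_case hn hdvd hm hcases
    exact ⟨hm.toIsReducedForm.isPreSuperelliptic hc hn hdvd (by omega) (by omega) _ hm.inversion,
      h1, Or.inr (Or.inr ⟨hf, h2⟩)⟩

end ExceptionalCurves

theorem mainTheorem12 {K : Type*} [Field K] [Algebra ℂ K] (n : ℕ) (f : ℂ[X]) (x y : K) :
    (IsPreSuperelliptic n f x y →
      (branchPoints (quotientField n x y)).encard = 3 →
      IsExceptionalCase n f x y →
        n ∣ f.natDegree + delta f ∧
        (branchPoints (xLine x)).encard = ((f.natDegree + delta f : ℕ) : ℕ∞)) ∧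
    (IsCurveWithEquation n f x y →
      2 ≤ n →
      f ∈ listA4 ∪ listS4 ∪ listA5 →
      ¬ (n = 2 ∧ f = p4) →
      n ∣ f.natDegree + delta f →
        IsPreSuperelliptic n f x y ∧
        (branchPoints (quotientField n x y)).encard = 3 ∧
        IsExceptionalCase n f x y) := by
  exact ⟨fun hp _ he => hp.dvd_and_encard he,
    fun hc hn hf hne hdvd => hc.exceptional_of_dvd hn hf hne hdvd⟩
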